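/- Smooth manifolds are finite-dimensional, Hausdorff and second countable, vector bundles are real, smooth and of constant finite rank, and $\mathbb{N}=\{0,1,2,\dots\}$. **The category VB2.** Its objects are triples $(E_1,\widetilde{E},\phi_E)$, where $E_1$ and $\widetilde{E}$ are vector bundles over a smooth manifold $M$ and $\phi_E:\widetilde{E}\to\wedge^2E_1$ is a surjective smooth vector-bundle map over $\mathrm{id}_M$. A morphism from $(E_1\to M,\widetilde{E},\phi_E)$ to $(F_1\to N,\widetilde{F},\phi_F)$ is a pair of smooth vector-bundle maps $\psi_1:E_1\to F_1$, $\widetilde\psi:\widetilde{E}\to\widetilde{F}$ covering the same smooth map $\psi:M\to N$ such that $\wedge^2\psi_1\circ\phi_E=\phi_F\circ\widetilde\psi$. **Degree 2 $\mathbb{N}$-manifolds.** A degree 2 $\mathbb{N}$-manifold is a pair $(M,C)$, where $M$ is a smooth manifold and $C$ is a sheaf of $\mathbb{N}$-graded, graded-commutative, unital $\mathbb{R}$-algebras on $M$ for which there are integers $m_1,m_2\ge 0$ such that each point of $M$ has an open neighbourhood $U$ with an isomorphism of sheaves of graded algebras $$C|_U\;\cong\; C^\infty_U\otimes\wedge\mathbb{R}^{m_1}\otimes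 S\,\mathbb{R}^{m_2},$$ where $C^\infty_U$ has degree $0$, $\mathbb{R}^{m_1}$ has degree $1$ and $\mathbb{R}^{m_2}$ has degree $2$. (Sheaves are taken in the category of graded algebras: $C(U)=\bigoplus_q C_q(U)$ and each $C_q$ is a sheaf.) A morphism $(N,C_N)\to(M,C_M)$ is a smooth map $\psi:N\to M$ together with a morphism $\psi^\sharp:C_M\to\psi_*C_N$ of sheaves of graded algebras. **The functor.** To $(E_1,\widetilde{E},\phi_E)$ over $M$, the functor $\mathcal F$ assigns $(M,C)$, where $C$ is the quotient, as a sheaf of graded algebras, of $\Gamma_{\wedge E_1^*}\otimes_{C^\infty_M}\Gamma_{S\widetilde{E}^*}$ (sections of $E_1^*$ have degree $1$ and sections of $\widetilde{E}^*$ have degree $2$) by the sheaf of ideals generated by the elements $T\otimes 1-1\otimes\phi_E^*T$ with $T$ a local section of $\wedge^2E_1^*$. To a morphism $(\psi_1,\widetilde\psi)$ over $\psi:M\to N$ it assigns $\psi$ together with the $\psi^\sharp$ which is induced by pull-back along $\psi$ on functions and by the fibrewise transposes of $\psi_1$ and $\widetilde\psi$ on sections of $F_1^*$ and $\widetilde{F}^*$.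 **Proposition.** For every object $(E_1,\widetilde{E},\phi_E)$ of VB2, $\mathcal F(E_1,\widetilde{E},\phi_E)$ is a degree 2 $\mathbb{N}$-manifold, and the functor $\mathcal F$ from VB2 to the category of degree 2 $\mathbb{N}$-manifolds is an equivalence of categories. -/

import Mathlib

open CategoryTheory TopologicalSpace TensorProduct
open scoped Manifold ContDiff DirectSum

noncomputable section

namespace DegTwo


/-!
### The fibrewise algebra

For a linear map `j : ⋀² V → W`, the algebra `(⋀ V ⊗ S W) / I`, where `I` is the two-sided ideal
generated by the elements `T ⊗ 1 - 1 ⊗ j T` with `T ∈ ⋀² V`. It is graded with `V` in degree one and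
`W` in degree two. As `S W` sits in even degrees, the ordinary algebra structure on the tensor
product agrees with the one given by the sign rule.
-/

section FibreAlgebra
variable {V W : Type} [AddCommGroup V] [Module ℝ V] [AddCommGroup W] [Module ℝ W]

/-- The relation `T ⊗ 1 ∼ 1 ⊗ j T` for `T ∈ ⋀² V`. -/
inductive FibreRel (j : ⋀[ℝ]^2 V →ₗ[ℝ] W) :
    ExteriorAlgebra ℝ V ⊗[ℝ] SymmetricAlgebra ℝ W →
    ExteriorAlgebra ℝ V ⊗[ℝ] SymmetricAlgebra ℝ W → Prop
  | wedge (T : ⋀[ℝ]^2 V) :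
      FibreRel j ((T : ExteriorAlgebra ℝ V) ⊗ₜ 1) (1 ⊗ₜ SymmetricAlgebra.ι ℝ W (j T))

/-- The algebra `(⋀ V ⊗ S W) / (T ⊗ 1 - 1 ⊗ j T)`. -/
def FibreAlg (j : ⋀[ℝ]^2 V →ₗ[ℝ] W) : Type := RingQuot (FibreRel j)

namespace FibreAlg
variable (j : ⋀[ℝ]^2 V →ₗ[ℝ] W)

instance : Ring (FibreAlg j) := inferInstanceAs (Ring (RingQuot (FibreRel j)))
instance : Algebra ℝ (FibreAlg j) := inferInstanceAs (Algebra ℝ (RingQuot (FibreRel j)))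

/-- The quotient map `⋀ V ⊗ S W → (⋀ V ⊗ S W) / I`. -/
def mk : ExteriorAlgebra ℝ V ⊗[ℝ] SymmetricAlgebra ℝ W →ₐ[ℝ] FibreAlg j :=
  RingQuot.mkAlgHom ℝ (FibreRel j)

theorem mk_surjective : Function.Surjective (mk j) := RingQuot.mkAlgHom_surjective ℝ _

/-- The degree one generators `v ⊗ 1`. -/
def gen₁ : V →ₗ[ℝ] FibreAlg j :=
  (mk j).toLinearMap ∘ₗ (TensorProduct.mk ℝ _ _).flip 1 ∘ₗ ExteriorAlgebra.ι ℝ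

/-- The degree two generators `1 ⊗ w`. -/
def gen₂ : W →ₗ[ℝ] FibreAlg j :=
  (mk j).toLinearMap ∘ₗ (TensorProduct.mk ℝ _ _) 1 ∘ₗ SymmetricAlgebra.ι ℝ W

theorem gen₁_apply (v : V) : gen₁ j v = mk j (ExteriorAlgebra.ι ℝ v ⊗ₜ 1) := rfl
theorem gen₂_apply (w : W) : gen₂ j w = mk j (1 ⊗ₜ SymmetricAlgebra.ι ℝ W w) := rfl

theorem mk_wedge (T : ⋀[ℝ]^2 V) :
    mk j ((T : ExteriorAlgebra ℝ V) ⊗ₜ 1) = gen₂ j (j T) :=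
  RingQuot.mkAlgHom_rel ℝ (FibreRel.wedge T)

theorem gen₁_sq (v : V) : gen₁ j v * gen₁ j v = 0 := by
  simp [gen₁_apply, ← map_mul]

theorem gen₁_mul_gen₁ (v v' : V) :
    gen₁ j v * gen₁ j v' = gen₂ j (j (exteriorPower.ιMulti ℝ 2 ![v, v'])) := by
  rw [← mk_wedge, gen₁_apply, gen₁_apply, ← map_mul]
  simp [ExteriorAlgebra.ιMulti_apply]

theorem gen₂_comm (w : W) (a : FibreAlg j) : gen₂ j w * a = a * gen₂ j w := by
  obtain ⟨t, rfl⟩ := mk_surjective j a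
  rw [gen₂_apply, ← map_mul, ← map_mul]
  congr 1
  induction t with
  | zero => simp
  | add x y hx hy => rw [mul_add, add_mul, hx, hy]
  | tmul x y => simp [mul_comm]

theorem gen₁_anticomm (v v' : V) : gen₁ j v * gen₁ j v' = -(gen₁ j v' * gen₁ j v) := by
  have h := gen₁_sq j (v + v')
  rw [map_add, add_mul, mul_add, mul_add, gen₁_sq, gen₁_sq] at h
  simp only [zero_add, add_zero] at h
  exact eq_neg_of_add_eq_zero_left h

/-- Extension of a linear map with commuting values to the symmetric algebra; the target need not be
commutative. -/
def symLift {B : Type} [Semiring B] [Algebra ℝ B] (f : W →ₗ[ℝ] B) (hf : ∀ x y, f x * f y = f y * f x) :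
    SymmetricAlgebra ℝ W →ₐ[ℝ] B :=
  RingCon.liftₐ _ (TensorAlgebra.lift ℝ f) (by
    unfold TensorAlgebra.symRingCon
    refine RingCon.ringConGen_le.2 fun x y h => ?_
    induction h with
    | mul_comm x y => 
      change TensorAlgebra.lift ℝ f _ = TensorAlgebra.lift ℝ f _
      simp [hf])


theorem symLift_ι {B : Type} [Semiring B] [Algebra ℝ B] (f : W →ₗ[ℝ] B)
    (hf : ∀ x y, f x * f y = f y * f x) (w : W) :
    symLift f hf (SymmetricAlgebra.ι ℝ W w) = f w := by
  change TensorAlgebra.lift ℝ f (TensorAlgebra.ι ℝ w) = f w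
  simp

/-- The monomial `v₁ ⋯ vₖ w₁ ⋯ wₗ` in the fibre algebra. -/
def monomial (p : List V × List W) : FibreAlg j :=
  (p.1.map (gen₁ j)).prod * (p.2.map (gen₂ j)).prod

theorem prod_gen₂_comm (l : List W) (a : FibreAlg j) :
    (l.map (gen₂ j)).prod * a = a * (l.map (gen₂ j)).prod := by
  induction l with
  | nil => simp
  | cons w l ih => simp only [List.map_cons, List.prod_cons]; rw [mul_assoc, ih, ← mul_assoc, gen₂_comm, mul_assoc]

theorem monomial_mul (p q : List V × List W) :
    monomial j p * monomial j q = monomial j (p.1 ++ q.1, p.2 ++ q.2) := by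
  simp only [monomial, List.map_append, List.prod_append]
  rw [mul_assoc, ← mul_assoc _ _ (List.map _ q.2).prod, prod_gen₂_comm]
  simp only [mul_assoc]

/-- The degree `q` part: the span of the monomials `v₁ ⋯ vₖ w₁ ⋯ wₗ` with `k + 2 l = q`. -/
def deg (q : ℕ) : Submodule ℝ (FibreAlg j) :=
  Submodule.span ℝ (monomial j '' {p | p.1.length + 2 * p.2.length = q})

theorem monomial_mem {q : ℕ} (p : List V × List W) (h : p.1.length + 2 * p.2.length = q) :
    monomial j p ∈ deg j q := Submodule.subset_span ⟨p, h, rfl⟩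

theorem gen₁_mem (v : V) : gen₁ j v ∈ deg j 1 := by
  simpa [monomial] using monomial_mem j (q := 1) ([v], []) rfl

theorem gen₂_mem (w : W) : gen₂ j w ∈ deg j 2 := by
  simpa [monomial] using monomial_mem j (q := 2) ([], [w]) rfl

instance gradedMonoid : SetLike.GradedMonoid (deg j) where
  one_mem := by simpa [monomial] using monomial_mem j (q := 0) ([], []) rfl
  mul_mem := by
    intro a b x y hx hy
    have := Submodule.mul_mem_mul hx hy
    rw [deg, deg, Submodule.span_mul_span] at this
    refine Submodule.span_le.2 ?_ this
    rintro _ ⟨_, ⟨p, hp, rfl⟩, _, ⟨q, hq, rfl⟩, rfl⟩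
    simp only [Set.mem_ofPred_eq] at hp hq
    simp only [monomial_mul]
    exact monomial_mem j _ (by simp; omega)

/-- Auxiliary: the degree one generators in the external direct sum. -/
def dgen₁ : V →ₗ[ℝ] ⨁ q, deg j q :=
  DirectSum.lof ℝ ℕ (fun q => deg j q) 1 ∘ₗ (gen₁ j).codRestrict _ (gen₁_mem j)

/-- Auxiliary: the degree two generators in the external direct sum. -/
def dgen₂ : W →ₗ[ℝ] ⨁ q, deg j q :=
  DirectSum.lof ℝ ℕ (fun q => deg j q) 2 ∘ₗ (gen₂ j).codRestrict _ (gen₂_mem j)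

theorem dgen₁_apply (v : V) :
    dgen₁ j v = DirectSum.of (fun q => deg j q) 1 ⟨gen₁ j v, gen₁_mem j v⟩ := rfl
theorem dgen₂_apply (w : W) :
    dgen₂ j w = DirectSum.of (fun q => deg j q) 2 ⟨gen₂ j w, gen₂_mem j w⟩ := rfl

theorem dgen₂_comm (w : W) (v : V) : dgen₁ j v * dgen₂ j w = dgen₂ j w * dgen₁ j v := by
  rw [dgen₁_apply, dgen₂_apply, DirectSum.of_mul_of, DirectSum.of_mul_of]
  exact DirectSum.of_eq_of_gradedMonoid_eq (Sigma.subtype_ext (add_comm _ _) (gen₂_comm j _ _).symm)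

theorem dgen₂_comm' (w w' : W) : dgen₂ j w * dgen₂ j w' = dgen₂ j w' * dgen₂ j w := by
  rw [dgen₂_apply, dgen₂_apply, DirectSum.of_mul_of, DirectSum.of_mul_of]
  exact DirectSum.of_eq_of_gradedMonoid_eq (Sigma.subtype_ext (add_comm _ _) (gen₂_comm j _ _))

theorem dgen₁_sq (v : V) : dgen₁ j v * dgen₁ j v = 0 := by
  rw [dgen₁_apply, DirectSum.of_mul_of]
  exact DFinsupp.single_eq_zero.mpr (Subtype.ext (gen₁_sq j v))

theorem dgen₁_mul_dgen₁ (v v' : V) :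
    dgen₁ j v * dgen₁ j v' = dgen₂ j (j (exteriorPower.ιMulti ℝ 2 ![v, v'])) := by
  rw [dgen₁_apply, dgen₁_apply, dgen₂_apply, DirectSum.of_mul_of]
  exact DirectSum.of_eq_of_gradedMonoid_eq (Sigma.subtype_ext rfl (gen₁_mul_gen₁ j _ _))

/-- Universal property of the fibre algebra, for targets that need not be commutative. -/
def lift {B : Type} [Semiring B] [Algebra ℝ B] (f : V →ₗ[ℝ] B) (g : W →ₗ[ℝ] B)
    (hf : ∀ v, f v * f v = 0) (hg : ∀ w w', g w * g w' = g w' * g w)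
    (hfg : ∀ v w, f v * g w = g w * f v)
    (hj : ∀ v v', f v * f v' = g (j (exteriorPower.ιMulti ℝ 2 ![v, v']))) :
    FibreAlg j →ₐ[ℝ] B :=
  RingQuot.liftAlgHom ℝ ⟨Algebra.TensorProduct.lift (ExteriorAlgebra.lift ℝ ⟨f, hf⟩) (symLift g hg)
    (by
      intro x y
      induction x using ExteriorAlgebra.induction with
      | algebraMap r => rw [AlgHom.commutes]; exact Algebra.commute_algebraMap_left _ _
      | mul a b ha hb => rw [map_mul]; exact ha.mul_left hb
      | add a b ha hb => rw [map_add]; exact ha.add_left hb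
      | ι v =>
        rw [ExteriorAlgebra.lift_ι_apply]
        induction y using SymmetricAlgebra.induction with
        | algebraMap r => rw [AlgHom.commutes]; exact Algebra.commute_algebraMap_right _ _
        | mul a b ha hb => rw [map_mul]; exact ha.mul_right hb
        | add a b ha hb => rw [map_add]; exact ha.add_right hb
        | ι w => rw [symLift_ι]; exact hfg v w), by
    rintro _ _ ⟨T⟩
    simp only [Algebra.TensorProduct.lift_tmul, map_one, mul_one, one_mul, symLift_ι]
    have : (ExteriorAlgebra.lift ℝ ⟨f, hf⟩).toLinearMap ∘ₗ (⋀[ℝ]^2 V).subtype = g ∘ₗ j := by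
      refine LinearMap.ext_on_range (exteriorPower.ιMulti_span ℝ 2 V) fun v => ?_
      have e : v = ![v 0, v 1] := by ext i; fin_cases i <;> rfl
      have := hj (v 0) (v 1)
      rw [← e] at this
      simp only [LinearMap.comp_apply, ← this]
      simp [ExteriorAlgebra.ιMulti_apply, Matrix.vecTail]
    exact LinearMap.congr_fun this T⟩

section
variable {B : Type} [Semiring B] [Algebra ℝ B] (f : V →ₗ[ℝ] B) (g : W →ₗ[ℝ] B)
    (hf : ∀ v, f v * f v = 0) (hg : ∀ w w', g w * g w' = g w' * g w)
    (hfg : ∀ v w, f v * g w = g w * f v)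
    (hj : ∀ v v', f v * f v' = g (j (exteriorPower.ιMulti ℝ 2 ![v, v'])))

@[simp] theorem lift_gen₁ (v : V) : lift j f g hf hg hfg hj (gen₁ j v) = f v := by
  refine (RingQuot.liftAlgHom_mkAlgHom_apply ℝ _ _ _).trans ?_
  simp

@[simp] theorem lift_gen₂ (w : W) : lift j f g hf hg hfg hj (gen₂ j w) = g w := by
  refine (RingQuot.liftAlgHom_mkAlgHom_apply ℝ _ _ _).trans ?_
  simp [symLift_ι]
end

theorem algHom_ext {B : Type} [Semiring B] [Algebra ℝ B] {F G : FibreAlg j →ₐ[ℝ] B}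
    (h₁ : ∀ v, F (gen₁ j v) = G (gen₁ j v)) (h₂ : ∀ w, F (gen₂ j w) = G (gen₂ j w)) : F = G := by
  refine RingQuot.ringQuot_ext' (s := FibreRel j) ℝ F G ?_
  refine Algebra.TensorProduct.ext (ExteriorAlgebra.hom_ext (LinearMap.ext h₁)) ?_
  refine AlgHom.ext fun y => ?_
  induction y using SymmetricAlgebra.induction with
  | algebraMap r => simp
  | mul a b ha hb => rw [map_mul, map_mul, ha, hb]
  | add a b ha hb => rw [map_add, map_add, ha, hb]
  | ι w => exact h₂ w

/-- Auxiliary: the decomposition of an element into its homogeneous components. -/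
def decomposeHom : FibreAlg j →ₐ[ℝ] ⨁ q, deg j q :=
  lift j (dgen₁ j) (dgen₂ j) (dgen₁_sq j) (dgen₂_comm' j) (fun v w => dgen₂_comm j w v)
    (dgen₁_mul_dgen₁ j)

theorem decomposeHom_monomial (q : ℕ) (p : List V × List W) (h : p.1.length + 2 * p.2.length = q) :
    decomposeHom j (monomial j p) =
      DirectSum.of (fun q => deg j q) q ⟨monomial j p, monomial_mem j p h⟩ := by
  obtain ⟨l, m⟩ := p
  induction l generalizing q with
  | nil =>
    induction m generalizing q with
    | nil => 
      simp only [monomial, List.map_nil, List.prod_nil, mul_one, map_one]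
      exact DirectSum.of_eq_of_gradedMonoid_eq (Sigma.subtype_ext h rfl)
    | cons w m ih =>
      have e : monomial j ([], w :: m) = gen₂ j w * monomial j ([], m) := by simp [monomial]
      refine (congrArg (decomposeHom j) e).trans ?_
      rw [map_mul, ih _ rfl, decomposeHom, lift_gen₂, dgen₂_apply, DirectSum.of_mul_of]
      refine DirectSum.of_eq_of_gradedMonoid_eq (Sigma.subtype_ext ?_ e.symm)
      change 2 + (0 + 2 * m.length) = q
      rw [← h, List.length_cons, List.length_nil]; ring
  | cons v l ih =>
    have e : monomial j (v :: l, m) = gen₁ j v * monomial j (l, m) := by simp [monomial, mul_assoc]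
    refine (congrArg (decomposeHom j) e).trans ?_
    rw [map_mul, ih _ rfl, decomposeHom, lift_gen₁, dgen₁_apply, DirectSum.of_mul_of]
    refine DirectSum.of_eq_of_gradedMonoid_eq (Sigma.subtype_ext ?_ e.symm)
    change 1 + (l.length + 2 * m.length) = q
    rw [← h, List.length_cons]; ring

/-- The fibre algebra is `ℕ`-graded. -/
instance gradedAlgebra : GradedAlgebra (deg j) :=
  GradedAlgebra.ofAlgHom _ (decomposeHom j)
    (by
      refine algHom_ext j (fun v => ?_) (fun w => ?_)
      · simp [decomposeHom, dgen₁_apply]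
      · simp [decomposeHom, dgen₂_apply])
    (by
      rintro q ⟨x, hx⟩
      induction hx using Submodule.span_induction with
      | mem x h => 
        obtain ⟨p, hp, rfl⟩ := h
        exact decomposeHom_monomial j q p hp
      | zero => simp only [map_zero]; symm; exact map_zero (DirectSum.of (fun q => deg j q) q)
      | add x y hx hy ihx ihy => 
        simp only [map_add]
        simp only at ihx ihy
        rw [ihx, ihy, ← map_add]; rfl
      | smul r x hx ih =>
        simp only [map_smul]
        simp only at ih
        rw [ih]
        exact (map_smul (DirectSum.lof ℝ ℕ (fun q => deg j q) q) r ⟨x, hx⟩).symm)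

theorem prod_gen₁_gen₁ (v : V) (l : List V) :
    gen₁ j v * (l.map (gen₁ j)).prod = (-1 : ℝ) ^ l.length • ((l.map (gen₁ j)).prod * gen₁ j v) := by
  induction l with
  | nil => simp
  | cons u l ih =>
    simp only [List.map_cons, List.prod_cons, List.length_cons]
    rw [← mul_assoc, gen₁_anticomm, neg_mul, mul_assoc, ih, mul_smul_comm, pow_succ, mul_assoc]
    simp

theorem prod_gen₁_prod (l m : List V) :
    (l.map (gen₁ j)).prod * (m.map (gen₁ j)).prod =
      (-1 : ℝ) ^ (l.length * m.length) • ((m.map (gen₁ j)).prod * (l.map (gen₁ j)).prod) := by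
  induction l with
  | nil => simp
  | cons v l ih =>
    simp only [List.map_cons, List.prod_cons, List.length_cons]
    rw [mul_assoc, ih, mul_smul_comm, ← mul_assoc, prod_gen₁_gen₁, smul_mul_assoc, smul_smul,
      mul_assoc, ← pow_add]
    congr 2; ring

/-- The fibre algebra is graded-commutative. -/
theorem graded_comm {p q : ℕ} {a b : FibreAlg j} (ha : a ∈ deg j p) (hb : b ∈ deg j q) :
    a * b = (-1 : ℝ) ^ (p * q) • (b * a) := by
  induction ha using Submodule.span_induction with
  | zero => simp
  | add x y _ _ hx hy => rw [add_mul, hx, hy, mul_add, smul_add]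
  | smul r x _ hx => rw [smul_mul_assoc, hx, mul_smul_comm, smul_comm]
  | mem x hx =>
    obtain ⟨⟨l, m⟩, h, rfl⟩ := hx
    induction hb using Submodule.span_induction with
    | zero => simp
    | add x y _ _ hx hy => rw [mul_add, hx, hy, add_mul, smul_add]
    | smul r x _ hx => rw [mul_smul_comm, hx, smul_mul_assoc, smul_comm]
    | mem y hy =>
      obtain ⟨⟨l', m'⟩, h', rfl⟩ := hy
      simp only [Set.mem_ofPred_eq] at h h'
      have e : (-1 : ℝ) ^ (p * q) = (-1) ^ (l.length * l'.length) := by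
        rw [← h, ← h']
        apply neg_one_pow_congr
        simp [Nat.even_mul, Nat.even_add]
      rw [e]
      simp only [monomial]
      rw [mul_assoc, prod_gen₂_comm, ← mul_assoc, mul_assoc, mul_assoc, prod_gen₂_comm j m']
      rw [← mul_assoc, prod_gen₁_prod, smul_mul_assoc]
      congr 1
      rw [mul_assoc, mul_assoc _ _ (_ * _), prod_gen₂_comm j m', mul_assoc]


section map
variable {V' W' : Type} [AddCommGroup V'] [Module ℝ V'] [AddCommGroup W'] [Module ℝ W']
  (j' : ⋀[ℝ]^2 V' →ₗ[ℝ] W') (f : V →ₗ[ℝ] V') (g : W →ₗ[ℝ] W')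
  (h : g ∘ₗ j = j' ∘ₗ exteriorPower.map 2 f)

/-- Functoriality of the fibre algebra. -/
def map : FibreAlg j →ₐ[ℝ] FibreAlg j' :=
  lift j (gen₁ j' ∘ₗ f) (gen₂ j' ∘ₗ g) (fun v => gen₁_sq j' (f v))
    (fun w w' => gen₂_comm j' (g w) _) (fun v w => (gen₂_comm j' (g w) _).symm)
    (fun v v' => by
      have := LinearMap.congr_fun h (exteriorPower.ιMulti ℝ 2 ![v, v'])
      simp only [LinearMap.comp_apply] at this ⊢
      rw [this, gen₁_mul_gen₁, exteriorPower.map_apply_ιMulti]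
      congr 3)

@[simp] theorem map_gen₁ (v : V) : map j j' f g h (gen₁ j v) = gen₁ j' (f v) := by simp [map]
@[simp] theorem map_gen₂ (w : W) : map j j' f g h (gen₂ j w) = gen₂ j' (g w) := by simp [map]

theorem map_mem {q : ℕ} {a : FibreAlg j} (ha : a ∈ deg j q) : map j j' f g h a ∈ deg j' q := by
  induction ha using Submodule.span_induction with
  | zero => simp
  | add x y _ _ hx hy => rw [map_add]; exact add_mem hx hy
  | smul r x _ hx => rw [map_smul]; exact Submodule.smul_mem _ r hx
  | mem x hx =>
    obtain ⟨⟨l, m⟩, hp, rfl⟩ := hx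
    have : map j j' f g h (monomial j (l, m)) = monomial j' (l.map f, m.map g) := by
      simp only [monomial, map_mul, map_list_prod, List.map_map]
      congr 3
      · ext v; simp
      · ext v; simp
    rw [this]
    exact monomial_mem j' _ (by simpa using hp)
end map

end FibreAlg
end FibreAlgebra

/-! ### The subalgebra spanned by a multiplicative family of subspaces -/

section Total
variable {R : Type} [Ring R] [Algebra ℝ R] (𝒞 : ℕ → Submodule ℝ R) [SetLike.GradedMonoid 𝒞]

/-- The sum `∑ q, 𝒞 q` of a multiplicative family of subspaces, as a subalgebra. -/
def total : Subalgebra ℝ R :=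
  (⨆ q, 𝒞 q).toSubalgebra
    (Submodule.mem_iSup_of_mem 0 SetLike.GradedOne.one_mem) (by
      intro s t hs ht
      have h := Submodule.mul_mem_mul hs ht
      refine (?_ : (⨆ q, 𝒞 q) * (⨆ q, 𝒞 q) ≤ ⨆ q, 𝒞 q) h
      rw [Submodule.iSup_mul]
      refine iSup_le fun i => ?_
      rw [Submodule.mul_iSup]
      refine iSup_le fun k => le_trans ?_ (le_iSup 𝒞 (i + k))
      exact Submodule.mul_le.2 fun a ha b hb => SetLike.GradedMul.mul_mem ha hb)

theorem mem_total {s : R} : s ∈ total 𝒞 ↔ s ∈ ⨆ q, 𝒞 q := Iff.rfl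

theorem le_total {q : ℕ} {s : R} (hs : s ∈ 𝒞 q) : s ∈ total 𝒞 :=
  (mem_total 𝒞).2 (Submodule.mem_iSup_of_mem q hs)

/-- The subspace `𝒞 q` inside `∑ q, 𝒞 q`. -/
def totalGr (q : ℕ) : Submodule ℝ (total 𝒞) := (𝒞 q).comap (total 𝒞).val.toLinearMap

theorem mem_totalGr {q : ℕ} {s : total 𝒞} : s ∈ totalGr 𝒞 q ↔ s.1 ∈ 𝒞 q := Iff.rfl

instance : SetLike.GradedMonoid (totalGr 𝒞) where
  one_mem := (SetLike.GradedOne.one_mem : (1 : R) ∈ 𝒞 0)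
  mul_mem i k s t hs ht := (SetLike.GradedMul.mul_mem hs ht : s.1 * t.1 ∈ 𝒞 (i + k))

theorem totalGr_isInternal (hinj : iSupIndep 𝒞) : DirectSum.IsInternal (totalGr 𝒞) := by
  refine DirectSum.isInternal_submodule_of_iSupIndep_of_iSup_eq_top ?_ ?_
  · have := hinj
    rw [iSupIndep_iff_dfinsupp_lsum_injective] at this ⊢
    intro a b hab
    let incl : ∀ q, totalGr 𝒞 q →ₗ[ℝ] 𝒞 q := fun q =>
      ((total 𝒞).val.toLinearMap.comp (totalGr 𝒞 q).subtype).codRestrict (𝒞 q) fun s => s.2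
    have hincl : ∀ q, Function.Injective (incl q) := fun q s t h =>
      Subtype.ext (Subtype.ext (congrArg (fun z : 𝒞 q => (z : R)) h))
    apply DFinsupp.mapRange_injective (fun q => incl q) (fun q => map_zero _) |>.2 hincl
    apply this
    have key : ∀ d : Π₀ q, totalGr 𝒞 q,
        (DFinsupp.lsum ℕ fun q => (𝒞 q).subtype) (d.mapRange (fun q => incl q) (fun q => map_zero _)) =
        ((DFinsupp.lsum ℕ fun q => (totalGr 𝒞 q).subtype) d).1 := by
      intro d
      induction d using DFinsupp.induction with
      | h0 => simp
      | ha q s f _ _ ih => 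
        rw [DFinsupp.mapRange_add _ _ (fun q => map_add _), map_add, ih, map_add, DFinsupp.mapRange_single]
        simp only [DFinsupp.lsum_single]
        rfl
    rw [key, key, hab]
  · rw [eq_top_iff]
    rintro ⟨s, hs⟩ -
    have : ∀ s (hs : s ∈ ⨆ q, 𝒞 q), ∃ h : s ∈ total 𝒞, (⟨s, h⟩ : total 𝒞) ∈ ⨆ q, totalGr 𝒞 q := by
      intro s hs
      induction hs using Submodule.iSup_induction' with
      | mem q s hs => 
        exact ⟨le_total 𝒞 hs, Submodule.mem_iSup_of_mem q ((mem_totalGr 𝒞).2 hs)⟩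
      | zero => exact ⟨zero_mem _, zero_mem _⟩
      | add s t _ _ hs ht =>
        obtain ⟨h, hs⟩ := hs
        obtain ⟨h', ht⟩ := ht
        exact ⟨add_mem h h', add_mem hs ht⟩
    exact (this s hs).2

/-- The grading of `total 𝒞` by an independent multiplicative family `𝒞`. -/
@[reducible] def totalGraded (hinj : iSupIndep 𝒞) : GradedAlgebra (totalGr 𝒞) :=
  { (inferInstance : SetLike.GradedMonoid (totalGr 𝒞)),
    (totalGr_isInternal 𝒞 hinj).chooseDecomposition with }

theorem total_comm
    (hcomm : ∀ (p q : ℕ) (a b : R), a ∈ 𝒞 p → b ∈ 𝒞 q → a * b = (-1 : ℝ) ^ (p * q) • (b * a))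
    (p q : ℕ) (a b : total 𝒞) (ha : a ∈ totalGr 𝒞 p) (hb : b ∈ totalGr 𝒞 q) :
    a * b = (-1 : ℝ) ^ (p * q) • (b * a) :=
  Subtype.ext (hcomm p q a.1 b.1 ha hb)
end Total

/-! ### Graded-commutative algebras -/

/-- An `ℕ`-graded graded-commutative unital real algebra. -/
structure GrAlg where
  carrier : Type
  [ring : Ring carrier]
  [algebra : Algebra ℝ carrier]
  gr : ℕ → Submodule ℝ carrier
  [graded : GradedAlgebra gr]
  comm : ∀ (p q : ℕ) (a b : carrier), a ∈ gr p → b ∈ gr q → a * b = (-1 : ℝ) ^ (p * q) • (b * a)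

namespace GrAlg
attribute [instance] ring algebra graded
instance : CoeSort GrAlg Type := ⟨carrier⟩

/-- Morphisms are the unital algebra homomorphisms that preserve the degree. -/
instance : Category GrAlg where
  Hom A B := A.gr →ₐᵍ[ℝ] B.gr
  id A := GradedAlgHom.id ℝ A.gr
  comp f g := GradedAlgHom.comp g f

instance : ConcreteCategory GrAlg (fun A B => A.gr →ₐᵍ[ℝ] B.gr) where
  hom f := f
  ofHom f := f

/-- A graded-algebra map from an algebra map that preserves degrees. -/
def ofHom {A B : GrAlg} (f : A →ₐ[ℝ] B) (hf : ∀ q a, a ∈ A.gr q → f a ∈ B.gr q) : A ⟶ B :=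
  ({ f with map_mem := fun {q a} h => hf q a h } : A.gr →ₐᵍ[ℝ] B.gr)

/-- The functor that takes the degree `q` part. -/
def homogeneous (q : ℕ) : GrAlg ⥤ Type where
  obj A := A.gr q
  map {A B} f := ↾fun a : A.gr q => (⟨ConcreteCategory.hom f a.1, GradedAlgHom.map_mem f a.2⟩ : B.gr q)
end GrAlg

/-! ### Manifolds and vector bundles -/

/-- A smooth finite-dimensional manifold: Hausdorff, second countable, without boundary. -/
structure Mfd where
  carrier : Type
  dim : ℕ
  [top : TopologicalSpace carrier]
  [charted : ChartedSpace (EuclideanSpace ℝ (Fin dim)) carrier]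
  [smooth : IsManifold (𝓡 dim) ∞ carrier]
  [t2 : T2Space carrier]
  [secondCountable : SecondCountableTopology carrier]

namespace Mfd
attribute [instance] top charted smooth t2 secondCountable
instance : CoeSort Mfd Type := ⟨carrier⟩
end Mfd

/-- A smooth real vector bundle of finite rank over `M`. -/
structure SmoothVB (M : Mfd) where
  rank : ℕ
  Fib : M → Type
  [addCommGroup : ∀ x, AddCommGroup (Fib x)]
  [module : ∀ x, Module ℝ (Fib x)]
  [topFib : ∀ x, TopologicalSpace (Fib x)]
  [topTotal : TopologicalSpace (Bundle.TotalSpace (EuclideanSpace ℝ (Fin rank)) Fib)]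
  [fiberBundle : FiberBundle (EuclideanSpace ℝ (Fin rank)) Fib]
  [vectorBundle : VectorBundle ℝ (EuclideanSpace ℝ (Fin rank)) Fib]
  [smooth : ContMDiffVectorBundle ∞ (EuclideanSpace ℝ (Fin rank)) Fib (𝓡 M.dim)]

namespace SmoothVB
attribute [instance] addCommGroup module topFib topTotal fiberBundle vectorBundle smooth
variable {M : Mfd} (E : SmoothVB M)

/-- The total space. -/
abbrev Total : Type := Bundle.TotalSpace (EuclideanSpace ℝ (Fin E.rank)) E.Fib

/-- The model with corners of the total space. -/
abbrev totalModel := (𝓡 M.dim).prod 𝓘(ℝ, EuclideanSpace ℝ (Fin E.rank))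

/-- The section `α` of the dual bundle is smooth over `U`: the fibrewise linear function that it defines
on the total space is smooth over `U`. (Values of `α` outside `U` play no role.) -/
def IsSmoothDual (U : Opens M) (α : ∀ x : M, Module.Dual ℝ (E.Fib x)) : Prop :=
  ContMDiffOn E.totalModel 𝓘(ℝ) ∞ (fun p : E.Total => α p.proj p.snd)
    {p | p.proj ∈ U}

/-- Smooth vector-bundle maps covering `ψ`. -/
structure BundleMap {M N : Mfd} (ψ : M → N) (E : SmoothVB M) (F : SmoothVB N) where
  map : ∀ x : M, E.Fib x →ₗ[ℝ] F.Fib (ψ x)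
  smooth : ContMDiff E.totalModel F.totalModel ∞
    (fun p : E.Total => (⟨ψ p.proj, map p.proj p.snd⟩ : F.Total))

end SmoothVB

/-- A triple `(E₁, Ẽ, φ)` of two vector bundles over a manifold `M` (`Et` stands for `Ẽ`) and a surjective
smooth vector-bundle map `φ : Ẽ → ⋀² E₁` over the identity of `M`. Smoothness of `φ`: the fibre
coordinates of `⋀² E₁` are the linear functions `α ∧ β` with `α`, `β` local smooth sections of the dual
of `E₁`, and `φ` is smooth when all functions `v ↦ ⟨α ∧ β, φ v⟩` on the total space of `Ẽ` are
smooth. -/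
structure VB2 where
  M : Mfd
  E₁ : SmoothVB M
  Et : SmoothVB M
  φ : ∀ x : M, Et.Fib x →ₗ[ℝ] ⋀[ℝ]^2 (E₁.Fib x)
  φ_surjective : ∀ x, Function.Surjective (φ x)
  φ_smooth : ∀ (U : Opens M) (α β : ∀ x : M, Module.Dual ℝ (E₁.Fib x)),
    E₁.IsSmoothDual U α → E₁.IsSmoothDual U β →
    Et.IsSmoothDual U fun x =>
      exteriorPower.pairingDual ℝ (E₁.Fib x) 2 (exteriorPower.ιMulti ℝ 2 ![α x, β x]) ∘ₗ φ x

namespace VB2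

/-- A pair of smooth vector-bundle maps `E₁ → F₁`, `Ẽ → F̃` over the same smooth map of bases which is
compatible with `φ_E` and `φ_F`. -/
@[ext] structure Hom (E F : VB2) where
  base : E.M → F.M
  base_smooth : ContMDiff (𝓡 E.M.dim) (𝓡 F.M.dim) ∞ base
  map₁ : SmoothVB.BundleMap base E.E₁ F.E₁
  mapt : SmoothVB.BundleMap base E.Et F.Et
  compat : ∀ x, exteriorPower.map 2 (map₁.map x) ∘ₗ E.φ x = F.φ (base x) ∘ₗ mapt.map x

instance : Category VB2 where
  Hom := Hom
  id E :=
    { base := id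
      base_smooth := contMDiff_id
      map₁ := ⟨fun _ => LinearMap.id, contMDiff_id⟩
      mapt := ⟨fun _ => LinearMap.id, contMDiff_id⟩
      compat := fun x => by rw [exteriorPower.map_id]; rfl }
  comp f g :=
    { base := g.base ∘ f.base
      base_smooth := g.base_smooth.comp f.base_smooth
      map₁ := ⟨fun x => g.map₁.map (f.base x) ∘ₗ f.map₁.map x, g.map₁.smooth.comp f.map₁.smooth⟩
      mapt := ⟨fun x => g.mapt.map (f.base x) ∘ₗ f.mapt.map x, g.mapt.smooth.comp f.mapt.smooth⟩
      compat := fun x => by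
        dsimp only
        rw [exteriorPower.map_comp, LinearMap.comp_assoc, f.compat, ← LinearMap.comp_assoc,
          g.compat]; rfl }

end VB2

/-! ### Degree 2 N-manifolds -/

/-- A smooth manifold with a presheaf of graded-commutative algebras. -/
structure GradedSpace where
  body : Mfd
  sheaf : TopCat.Presheaf GrAlg (TopCat.of body)

namespace GradedSpace

/-- The underlying presheafed space. -/
def toPresheafed (X : GradedSpace) : AlgebraicGeometry.PresheafedSpace GrAlg :=
  ⟨TopCat.of X.body, X.sheaf⟩

/-- A smooth map `ψ : X → Y` together with a morphism `C_Y → ψ_* C_X` of presheaves of graded algebras. -/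
@[ext] structure Hom (X Y : GradedSpace) where
  hom : X.toPresheafed ⟶ Y.toPresheafed
  smooth : ContMDiff (𝓡 X.body.dim) (𝓡 Y.body.dim) (M := X.body) (M' := Y.body) ∞ hom.base

instance : Category GradedSpace where
  Hom := Hom
  id X := ⟨𝟙 _, contMDiff_id⟩
  comp f g := ⟨f.hom ≫ g.hom, g.smooth.comp f.smooth⟩

end GradedSpace

section Model
variable (M : Mfd) (m₁ m₂ : ℕ)

/-- The local model `C^∞(V) ⊗ ⋀ ℝ^{m₁} ⊗ S ℝ^{m₂}` over an open set `V`. -/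
abbrev Model (V : Opens M) : Type :=
  C^∞⟮𝓡 M.dim, V; 𝓘(ℝ), ℝ⟯ ⊗[ℝ]
    (ExteriorAlgebra ℝ (Fin m₁ → ℝ) ⊗[ℝ] SymmetricAlgebra ℝ (Fin m₂ → ℝ))

variable {M} in
/-- The degree `q` part of the local model: `ℝ^{m₁}` has degree one and `ℝ^{m₂}` degree two. -/
def Model.gr (V : Opens M) (q : ℕ) : Submodule ℝ (Model M m₁ m₂ V) :=
  Submodule.span ℝ {s | ∃ (a b : ℕ) (f : C^∞⟮𝓡 M.dim, V; 𝓘(ℝ), ℝ⟯)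
    (η : ExteriorAlgebra ℝ (Fin m₁ → ℝ)) (P : SymmetricAlgebra ℝ (Fin m₂ → ℝ)),
    a + 2 * b = q ∧ η ∈ ⋀[ℝ]^a (Fin m₁ → ℝ) ∧
    P ∈ LinearMap.range (SymmetricAlgebra.ι ℝ (Fin m₂ → ℝ)) ^ b ∧ s = f ⊗ₜ (η ⊗ₜ P)}

variable {M} in
/-- Restriction of smooth functions. -/
def smoothRes {V U : Opens M} (h : V ≤ U) :
    C^∞⟮𝓡 M.dim, U; 𝓘(ℝ), ℝ⟯ →ₐ[ℝ] C^∞⟮𝓡 M.dim, V; 𝓘(ℝ), ℝ⟯ where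
  __ := ContMDiffMap.restrictRingHom (𝓡 M.dim) 𝓘(ℝ) (n := ∞) ℝ h
  commutes' _ := rfl

variable {M} in
/-- Restriction in the local model. -/
def Model.res {V U : Opens M} (h : V ≤ U) : Model M m₁ m₂ U →ₐ[ℝ] Model M m₁ m₂ V :=
  Algebra.TensorProduct.map (smoothRes h) (AlgHom.id ℝ _)
end Model

namespace GradedSpace
variable (X : GradedSpace)

/-- The graded algebra of sections over `U`. -/
abbrev sections (U : Opens X.body) : GrAlg := X.sheaf.obj (Opposite.op U)

/-- The restriction morphism. -/
def resHom {V U : Opens X.body} (h : V ≤ U) : X.sections U ⟶ X.sections V :=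
  X.sheaf.map (homOfLE h).op

/-- Restriction of sections. -/
def res {V U : Opens X.body} (h : V ≤ U) : X.sections U → X.sections V :=
  ConcreteCategory.hom (X.resHom h)

section
variable {X} {Y Z : GradedSpace}

/-- The preimage of an open set under a smooth map. -/
abbrev pre {X Y : GradedSpace} {ψ : X.body → Y.body}
    (hψ : ContMDiff (𝓡 X.body.dim) (𝓡 Y.body.dim) ∞ ψ) (U : Opens Y.body) : Opens X.body :=
  ⟨ψ ⁻¹' U, U.2.preimage hψ.continuous⟩

/-- The morphism given by a smooth map and compatible maps of graded algebras over all open sets. -/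
def mkHom (ψ : X.body → Y.body) (hψ : ContMDiff (𝓡 X.body.dim) (𝓡 Y.body.dim) ∞ ψ)
    (app : ∀ U : Opens Y.body, Y.sections U ⟶ X.sections (pre hψ U))
    (nat : ∀ {V U : Opens Y.body} (h : V ≤ U),
      Y.resHom h ≫ app V = app U ≫ X.resHom (V := pre hψ V) (U := pre hψ U) fun _ hx => h hx) :
    X ⟶ Y :=
  Hom.mk (X := X) (Y := Y)
    { base := TopCat.ofHom ⟨ψ, hψ.continuous⟩
      c := { app := fun U => app U.unop
             naturality := fun _ _ h => nat h.unop.le } } hψ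

theorem mkHom_congr (ψ : X.body → Y.body) (hψ : ContMDiff (𝓡 X.body.dim) (𝓡 Y.body.dim) ∞ ψ)
    {app app' : ∀ U : Opens Y.body, Y.sections U ⟶ X.sections (pre hψ U)}
    (e : ∀ U, app U = app' U) (nat) (nat') : mkHom ψ hψ app nat = mkHom ψ hψ app' nat' := by
  obtain rfl : app = app' := funext e
  rfl

theorem mkHom_id (X : GradedSpace) :
    mkHom id contMDiff_id (fun U => 𝟙 (X.sections U)) (fun _ => rfl) = 𝟙 X := rfl

theorem mkHom_comp (ψ : X.body → Y.body) (hψ) (app) (nat) (ψ' : Y.body → Z.body) (hψ') (app')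
    (nat') :
    mkHom ψ hψ app nat ≫ mkHom ψ' hψ' app' nat' =
      mkHom (ψ' ∘ ψ) (hψ'.comp hψ) (fun U => app' U ≫ app (pre hψ' U)) (fun h => by
        rw [← Category.assoc, nat' h, Category.assoc, nat, Category.assoc]) := rfl
end

/-- An isomorphism, over the open set `U`, of presheaves of graded algebras between the given one and
`C^∞ ⊗ ⋀ ℝ^{m₁} ⊗ S ℝ^{m₂}`. -/
structure LocalTrivialization (m₁ m₂ : ℕ) (U : Opens X.body) where
  iso : ∀ V : Opens X.body, V ≤ U → X.sections V ≃ₐ[ℝ] Model X.body m₁ m₂ V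
  mem_iff : ∀ (V : Opens X.body) (hV : V ≤ U) (q : ℕ) (s : X.sections V),
    s ∈ (X.sections V).gr q ↔ iso V hV s ∈ Model.gr m₁ m₂ V q
  res_iso : ∀ (V V' : Opens X.body) (hV : V ≤ U) (h : V' ≤ V) (s : X.sections V),
    iso V' (h.trans hV) (X.res h s) = Model.res m₁ m₂ h (iso V hV s)

/-- `X` is a degree 2 `ℕ`-manifold: its structure presheaf is a sheaf of graded algebras (limits of graded
algebras are computed degree by degree), locally isomorphic to `C^∞ ⊗ ⋀ ℝ^{m₁} ⊗ S ℝ^{m₂}`. -/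
structure IsDegreeTwo : Prop where
  isSheaf : ∀ q : ℕ, TopCat.Presheaf.IsSheaf (X.sheaf ⋙ GrAlg.homogeneous q)
  locallyTrivial : ∃ m₁ m₂ : ℕ, ∀ x : X.body, ∃ U : Opens X.body, x ∈ U ∧
    Nonempty (X.LocalTrivialization m₁ m₂ U)

end GradedSpace

/-- Being a degree 2 `ℕ`-manifold, as a property of objects. -/
def isDegreeTwo : ObjectProperty GradedSpace := fun X => X.IsDegreeTwo

/-- The category of degree 2 `ℕ`-manifolds and their morphisms. -/
abbrev NMan2 := isDegreeTwo.FullSubcategory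

/-! ### The functor -/

namespace VB2
variable (E : VB2)

/-- The map `⋀² E₁* → Ẽ*` at `x`, dual to `φ`. -/
def iota (x : E.M) :
    ⋀[ℝ]^2 (Module.Dual ℝ (E.E₁.Fib x)) →ₗ[ℝ] Module.Dual ℝ (E.Et.Fib x) :=
  (E.φ x).dualMap ∘ₗ exteriorPower.pairingDual ℝ (E.E₁.Fib x) 2

/-- The algebra `(⋀ E₁* ⊗ S Ẽ*) / I` at `x`. -/
abbrev Alg (x : E.M) : Type := FibreAlg (E.iota x)

/-- All sections over `U`, smooth or not, of the bundle of algebras `(⋀ E₁* ⊗ S Ẽ*) / I`. -/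
def RoughSec (U : Opens E.M) : Type := ∀ x : U, E.Alg x

instance (U : Opens E.M) : Ring (E.RoughSec U) := inferInstanceAs (Ring (∀ x : U, E.Alg x))
instance (U : Opens E.M) : Algebra ℝ (E.RoughSec U) :=
  inferInstanceAs (Algebra ℝ (∀ x : U, E.Alg x))

/-- The value at a point. -/
def eval {U : Opens E.M} (x : U) : E.RoughSec U →ₐ[ℝ] E.Alg x :=
  Pi.evalAlgHom ℝ (fun y : U => E.Alg y) x

/-- Restriction to a smaller open set. -/
def restrict {V U : Opens E.M} (h : V ≤ U) : E.RoughSec U →ₐ[ℝ] E.RoughSec V :=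
  AlgHom.pi fun x : V => E.eval ⟨x.1, h x.2⟩

/-- The smooth functions on `U`, as sections of the bundle of algebras. -/
def functionSec (U : Opens E.M) : Set (E.RoughSec U) :=
  {s | ∃ f : E.M → ℝ, ContMDiffOn (𝓡 E.M.dim) 𝓘(ℝ) ∞ f U ∧
    s = fun x : U => algebraMap ℝ (E.Alg x) (f x)}

/-- The smooth sections of `E₁*` over `U`, as sections of the bundle of algebras. -/
def dual₁Sec (U : Opens E.M) : Set (E.RoughSec U) :=
  {s | ∃ α : ∀ x : E.M, Module.Dual ℝ (E.E₁.Fib x), E.E₁.IsSmoothDual U α ∧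
    s = fun x : U => FibreAlg.gen₁ (E.iota x) (α x)}

/-- The smooth sections of `Ẽ*` over `U`, as sections of the bundle of algebras. -/
def dualtSec (U : Opens E.M) : Set (E.RoughSec U) :=
  {s | ∃ β : ∀ x : E.M, Module.Dual ℝ (E.Et.Fib x), E.Et.IsSmoothDual U β ∧
    s = fun x : U => FibreAlg.gen₂ (E.iota x) (β x)}

/-- Polynomial expressions over `U` in smooth functions and smooth sections of `E₁*` and `Ẽ*`. -/
def polySec (U : Opens E.M) : Subalgebra ℝ (E.RoughSec U) :=
  Algebra.adjoin ℝ (E.functionSec U ∪ E.dual₁Sec U ∪ E.dualtSec U)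

theorem restrict_polySec {V U : Opens E.M} (h : V ≤ U) {s : E.RoughSec U} (hs : s ∈ E.polySec U) :
    E.restrict h s ∈ E.polySec V := by
  have : E.polySec U ≤ (E.polySec V).comap (E.restrict h) := by
    refine Algebra.adjoin_le ?_
    rintro _ ((⟨f, hf, rfl⟩ | ⟨α, hα, rfl⟩) | ⟨β, hβ, rfl⟩)
    · exact Algebra.subset_adjoin (Or.inl (Or.inl ⟨f, hf.mono h, rfl⟩))
    · exact Algebra.subset_adjoin (Or.inl (Or.inr ⟨α, hα.mono fun p hp => h hp, rfl⟩))
    · exact Algebra.subset_adjoin (Or.inr ⟨β, hβ.mono fun p hp => h hp, rfl⟩)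
  exact this hs

/-- The smooth sections over `U` of the bundle of algebras: near every point they are polynomial
expressions in smooth functions and smooth sections of `E₁*` and `Ẽ*`. This is the subsheaf of algebras
of the sheaf of all sections that is generated by smooth functions and smooth sections of `E₁*` and `Ẽ*`,
that is, the quotient sheaf `(⋀ Γ(E₁*) ⊗ S Γ(Ẽ*)) / I`. -/
def locPoly (U : Opens E.M) : Subalgebra ℝ (E.RoughSec U) where
  carrier := {s | ∀ x : U, ∃ (V : Opens E.M) (h : V ≤ U), x.1 ∈ V ∧ E.restrict h s ∈ E.polySec V}
  mul_mem' := by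
    intro s t hs ht x
    obtain ⟨V, hV, hx, h⟩ := hs x
    obtain ⟨V', hV', hx', h'⟩ := ht x
    refine ⟨V ⊓ V', inf_le_left.trans hV, ⟨hx, hx'⟩, ?_⟩
    rw [map_mul]
    exact mul_mem (E.restrict_polySec inf_le_left h) (E.restrict_polySec inf_le_right h')
  add_mem' := by
    intro s t hs ht x
    obtain ⟨V, hV, hx, h⟩ := hs x
    obtain ⟨V', hV', hx', h'⟩ := ht x
    refine ⟨V ⊓ V', inf_le_left.trans hV, ⟨hx, hx'⟩, ?_⟩
    rw [map_add]
    exact add_mem (E.restrict_polySec inf_le_left h) (E.restrict_polySec inf_le_right h')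
  algebraMap_mem' r x := ⟨U, le_rfl, x.2, (E.polySec U).algebraMap_mem r⟩

/-- The smooth sections over `U` of degree `q`. -/
def degSec (U : Opens E.M) (q : ℕ) : Submodule ℝ (E.RoughSec U) :=
  Subalgebra.toSubmodule (E.locPoly U) ⊓
    ⨅ x : U, (FibreAlg.deg (E.iota x) q).comap (E.eval x).toLinearMap

theorem mem_degSec {U : Opens E.M} {q : ℕ} {s : E.RoughSec U} :
    s ∈ E.degSec U q ↔ s ∈ E.locPoly U ∧ ∀ x : U, s x ∈ FibreAlg.deg (E.iota x) q := by
  simp only [degSec, Submodule.mem_inf, Subalgebra.mem_toSubmodule, Submodule.mem_iInf]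
  rfl

instance (U : Opens E.M) : SetLike.GradedMonoid (E.degSec U) where
  one_mem := E.mem_degSec.2 ⟨one_mem _, fun _ => SetLike.GradedOne.one_mem⟩
  mul_mem _ _ _ _ hs ht := E.mem_degSec.2 ⟨mul_mem (E.mem_degSec.1 hs).1 (E.mem_degSec.1 ht).1,
    fun x => SetLike.GradedMul.mul_mem ((E.mem_degSec.1 hs).2 x) ((E.mem_degSec.1 ht).2 x)⟩

theorem iSupIndep_degSec (U : Opens E.M) : iSupIndep (E.degSec U) := by
  intro q
  rw [Submodule.disjoint_def]
  intro s hs hs'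
  funext x
  have h : (⨆ k, ⨆ _ : k ≠ q, E.degSec U k) ≤
      (⨆ k, ⨆ _ : k ≠ q, FibreAlg.deg (E.iota x) k).comap
        (E.eval x).toLinearMap :=
    iSup₂_le fun k hk t ht =>
      Submodule.mem_iSup_of_mem k (Submodule.mem_iSup_of_mem hk ((E.mem_degSec.1 ht).2 x))
  exact (Submodule.disjoint_def.1 ((DirectSum.Decomposition.isInternal
    (FibreAlg.deg (E.iota x))).submodule_iSupIndep q)) (s x)
    ((E.mem_degSec.1 hs).2 x) (h hs')

/-- The graded algebra over `U`: the sum over `q` of the smooth sections of degree `q`. -/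
def secAlg (U : Opens E.M) : GrAlg where
  carrier := total (E.degSec U)
  gr := totalGr (E.degSec U)
  graded := totalGraded (E.degSec U) (E.iSupIndep_degSec U)
  comm := total_comm (E.degSec U) fun _ _ _ _ hs ht => funext fun x =>
    FibreAlg.graded_comm (E.iota x) ((E.mem_degSec.1 hs).2 x) ((E.mem_degSec.1 ht).2 x)

/-- An algebra map of rough sections that respects the degree-`q` smooth sections for all `q`. -/
def secHom {E F : VB2} {U : Opens E.M} {V : Opens F.M} (g : E.RoughSec U →ₐ[ℝ] F.RoughSec V)
    (hg : ∀ q s, s ∈ E.degSec U q → g s ∈ F.degSec V q) : E.secAlg U ⟶ F.secAlg V :=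
  GrAlg.ofHom
    ((g.comp (total (E.degSec U)).val).codRestrict (total (F.degSec V)) (by
      rintro ⟨s, hs⟩
      have : (⨆ q, E.degSec U q) ≤ (⨆ q, F.degSec V q).comap g.toLinearMap :=
        iSup_le fun q s hs => Submodule.mem_iSup_of_mem q (hg q s hs)
      exact this hs))
    (fun q s hs => hg q s.1 hs)

theorem secHom_congr {E F : VB2} {U : Opens E.M} {V : Opens F.M}
    {g g' : E.RoughSec U →ₐ[ℝ] F.RoughSec V} (e : g = g') (hg hg') :
    secHom g hg = secHom g' hg' := by
  subst e; rfl

theorem secHom_comp {E F G : VB2} {U : Opens E.M} {V : Opens F.M} {W : Opens G.M}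
    (g : E.RoughSec U →ₐ[ℝ] F.RoughSec V) (g' : F.RoughSec V →ₐ[ℝ] G.RoughSec W) (hg hg') :
    secHom g hg ≫ secHom g' hg' = secHom (g'.comp g) (fun q s hs => hg' q _ (hg q s hs)) :=
  rfl

theorem secHom_id (E : VB2) (U : Opens E.M) :
    secHom (AlgHom.id ℝ (E.RoughSec U)) (fun _ _ hs => hs) = 𝟙 (E.secAlg U) :=
  rfl

theorem restrict_degSec {V U : Opens E.M} (h : V ≤ U) (q : ℕ) (s : E.RoughSec U)
    (hs : s ∈ E.degSec U q) : E.restrict h s ∈ E.degSec V q := by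
  rw [mem_degSec] at hs ⊢
  refine ⟨fun x => ?_, fun x => hs.2 (⟨x.1, h x.2⟩ : U)⟩
  obtain ⟨W, hW, hx, hp⟩ := hs.1 ⟨x.1, h x.2⟩
  exact ⟨V ⊓ W, inf_le_left, ⟨x.2, hx⟩, E.restrict_polySec inf_le_right hp⟩

/-- Restriction, as a morphism of graded algebras. -/
def resSec {V U : Opens E.M} (h : V ≤ U) : E.secAlg U ⟶ E.secAlg V :=
  secHom (E.restrict h) (E.restrict_degSec h)

/-- The structure sheaf attached to `(E₁, Ẽ, φ)`. -/
def structureSheaf : TopCat.Presheaf GrAlg (TopCat.of E.M) where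
  obj U := E.secAlg U.unop
  map h := E.resSec h.unop.le
  map_id _ := rfl
  map_comp _ _ := rfl

variable {E} {F : VB2} (f : E ⟶ F)

theorem iota_natural (x : E.M) :
    (f.mapt.map x).dualMap ∘ₗ F.iota (f.base x) =
      E.iota x ∘ₗ exteriorPower.map 2 (f.map₁.map x).dualMap := by
  apply exteriorPower.linearMap_ext
  refine AlternatingMap.ext fun α => LinearMap.ext fun v => ?_
  have h := LinearMap.congr_fun (f.compat x) v
  simp only [LinearMap.comp_apply] at h
  simp only [iota, LinearMap.compAlternatingMap_apply, LinearMap.comp_apply,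
    LinearMap.dualMap_apply, exteriorPower.map_apply_ιMulti]
  rw [← h]
  generalize E.φ x v = T
  suffices exteriorPower.pairingDual ℝ _ 2 (exteriorPower.ιMulti ℝ 2 α) ∘ₗ
      exteriorPower.map 2 (f.map₁.map x) = exteriorPower.pairingDual ℝ _ 2
        (exteriorPower.ιMulti ℝ 2 ((f.map₁.map x).dualMap ∘ α)) from LinearMap.congr_fun this T
  apply exteriorPower.linearMap_ext
  ext v
  simp

/-- The algebra map from the fibre over `f x` to the fibre over `x` that is induced by the transposes of the
two bundle maps. -/
def algPull (x : E.M) : F.Alg (f.base x) →ₐ[ℝ] E.Alg x :=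
  FibreAlg.map _ _ (f.map₁.map x).dualMap (f.mapt.map x).dualMap (iota_natural f x)

/-- The preimage of an open set in the base. -/
def preimage (U : Opens F.M) : Opens E.M := ⟨f.base ⁻¹' U, U.2.preimage f.base_smooth.continuous⟩

/-- Pullback of sections. -/
def secPull (U : Opens F.M) : F.RoughSec U →ₐ[ℝ] E.RoughSec (preimage f U) :=
  AlgHom.pi fun x : preimage f U => (algPull f x.1).comp (F.eval ⟨f.base x.1, x.2⟩)

theorem secPull_polySec (U : Opens F.M) {s : F.RoughSec U} (hs : s ∈ F.polySec U) :
    secPull f U s ∈ E.polySec (preimage f U) := by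
  have : F.polySec U ≤ (E.polySec (preimage f U)).comap (secPull f U) := by
    refine Algebra.adjoin_le ?_
    rintro _ ((⟨a, ha, rfl⟩ | ⟨α, hα, rfl⟩) | ⟨β, hβ, rfl⟩)
    · refine Algebra.subset_adjoin (Or.inl (Or.inl ⟨a ∘ f.base,
        ha.comp f.base_smooth.contMDiffOn fun x hx => hx, ?_⟩))
      exact funext fun x => (algPull f x.1).commutes _
    · refine Algebra.subset_adjoin (Or.inl (Or.inr ⟨fun x => (f.map₁.map x).dualMap (α (f.base x)),
        hα.comp f.map₁.smooth.contMDiffOn fun p hp => hp, ?_⟩))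
      exact funext fun x => FibreAlg.map_gen₁ _ _ _ _ _ _
    · refine Algebra.subset_adjoin (Or.inr ⟨fun x => (f.mapt.map x).dualMap (β (f.base x)),
        hβ.comp f.mapt.smooth.contMDiffOn fun p hp => hp, ?_⟩)
      exact funext fun x => FibreAlg.map_gen₂ _ _ _ _ _ _
  exact this hs

theorem secPull_degSec (U : Opens F.M) (q : ℕ) (s : F.RoughSec U) (hs : s ∈ F.degSec U q) :
    secPull f U s ∈ E.degSec (preimage f U) q := by
  rw [mem_degSec] at hs ⊢
  refine ⟨fun x => ?_, fun x => FibreAlg.map_mem _ _ _ _ _ (hs.2 (⟨f.base x.1, x.2⟩ : U))⟩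
  obtain ⟨W, hW, hx, hp⟩ := hs.1 (⟨f.base x.1, x.2⟩ : U)
  exact ⟨preimage f W, fun y hy => hW hy, hx, secPull_polySec f W hp⟩

theorem algPull_gen₁ (x : E.M) (v : Module.Dual ℝ (F.E₁.Fib (f.base x))) :
    algPull f x (FibreAlg.gen₁ _ v) = FibreAlg.gen₁ (E.iota x) (v ∘ₗ f.map₁.map x) :=
  FibreAlg.map_gen₁ _ _ _ _ _ _

theorem algPull_gen₂ (x : E.M) (w : Module.Dual ℝ (F.Et.Fib (f.base x))) :
    algPull f x (FibreAlg.gen₂ _ w) = FibreAlg.gen₂ (E.iota x) (w ∘ₗ f.mapt.map x) :=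
  FibreAlg.map_gen₂ _ _ _ _ _ _

theorem algPull_id (x : E.M) : algPull (𝟙 E) x = AlgHom.id ℝ _ :=
  FibreAlg.algHom_ext _ (fun v => algPull_gen₁ (𝟙 E) x v) (fun w => algPull_gen₂ (𝟙 E) x w)

theorem algPull_comp {G : VB2} (g : F ⟶ G) (x : E.M) :
    algPull (f ≫ g) x = (algPull f x).comp (algPull g (f.base x)) := by
  refine FibreAlg.algHom_ext _ (fun v => ?_) (fun w => ?_)
  · calc algPull (f ≫ g) x (FibreAlg.gen₁ _ v)
      _ = FibreAlg.gen₁ (E.iota x) (v ∘ₗ (f ≫ g).map₁.map x) := algPull_gen₁ (f ≫ g) x v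
      _ = FibreAlg.gen₁ (E.iota x) ((v ∘ₗ g.map₁.map (f.base x)) ∘ₗ f.map₁.map x) :=
        congrArg (FibreAlg.gen₁ (E.iota x)) rfl
      _ = algPull f x (FibreAlg.gen₁ _ (v ∘ₗ g.map₁.map (f.base x))) :=
        (algPull_gen₁ f x _).symm
      _ = algPull f x (algPull g (f.base x) (FibreAlg.gen₁ _ v)) :=
        congrArg (algPull f x) (algPull_gen₁ g (f.base x) v).symm
  · calc algPull (f ≫ g) x (FibreAlg.gen₂ _ w)
      _ = FibreAlg.gen₂ (E.iota x) (w ∘ₗ (f ≫ g).mapt.map x) := algPull_gen₂ (f ≫ g) x w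
      _ = FibreAlg.gen₂ (E.iota x) ((w ∘ₗ g.mapt.map (f.base x)) ∘ₗ f.mapt.map x) :=
        congrArg (FibreAlg.gen₂ (E.iota x)) rfl
      _ = algPull f x (FibreAlg.gen₂ _ (w ∘ₗ g.mapt.map (f.base x))) :=
        (algPull_gen₂ f x _).symm
      _ = algPull f x (algPull g (f.base x) (FibreAlg.gen₂ _ w)) :=
        congrArg (algPull f x) (algPull_gen₂ g (f.base x) w).symm

theorem secPull_id (U : Opens E.M) : secPull (𝟙 E) U = AlgHom.id ℝ _ :=
  AlgHom.ext fun s => funext fun x => AlgHom.congr_fun (algPull_id x.1) (s x)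

theorem secPull_comp {G : VB2} (g : F ⟶ G) (U : Opens G.M) :
    secPull (f ≫ g) U = (secPull f (preimage g U)).comp (secPull g U) :=
  AlgHom.ext fun s => funext fun x =>
    AlgHom.congr_fun (algPull_comp f g x.1) (s ⟨g.base (f.base x.1), x.2⟩)

theorem secPull_restrict {V U : Opens F.M} (h : V ≤ U) :
    (secPull f V).comp (F.restrict h) =
      (E.restrict fun _ hx => h hx : E.RoughSec (preimage f U) →ₐ[ℝ] E.RoughSec (preimage f V)).comp
        (secPull f U) :=
  AlgHom.ext fun _ => funext fun _ => rfl

/-- Pullback of sections, as a morphism of graded algebras. -/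
def pullSec (U : Opens F.M) : F.secAlg U ⟶ E.secAlg (preimage f U) :=
  secHom (secPull f U) (secPull_degSec f U)

theorem pullSec_res {V U : Opens F.M} (h : V ≤ U) :
    F.resSec h ≫ pullSec f V =
      pullSec f U ≫ E.resSec (V := preimage f V) (U := preimage f U) (fun _ hx => h hx) :=
  secHom_congr (secPull_restrict f h)
    (fun q s hs => secPull_degSec f V q _ (F.restrict_degSec h q s hs))
    (fun q s hs => E.restrict_degSec (V := preimage f V) (U := preimage f U)
      (fun _ hx => h hx) q _ (secPull_degSec f U q s hs))

theorem pullSec_id (U : Opens E.M) : pullSec (𝟙 E) U = 𝟙 (E.secAlg U) :=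
  (secHom_congr (secPull_id U) (secPull_degSec (𝟙 E) U) (fun _ _ hs => hs)).trans (secHom_id E U)

theorem pullSec_comp {G : VB2} (g : F ⟶ G) (U : Opens G.M) :
    pullSec (f ≫ g) U = pullSec g U ≫ pullSec f (preimage g U) :=
  (secHom_congr (secPull_comp f g U) (secPull_degSec (f ≫ g) U) (fun q s hs =>
      secPull_degSec f _ q _ (secPull_degSec g _ q s hs))).trans
    (secHom_comp (secPull g U) (secPull f _) (secPull_degSec g _) (secPull_degSec f _)).symm

/-- The morphism of manifolds with graded structure sheaf induced by a morphism of triples. -/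
def pullHom : GradedSpace.Hom ⟨E.M, E.structureSheaf⟩ ⟨F.M, F.structureSheaf⟩ :=
  GradedSpace.mkHom f.base f.base_smooth (pullSec f) (pullSec_res f)

theorem pullHom_id : pullHom (𝟙 E) = 𝟙 (GradedSpace.mk E.M E.structureSheaf) :=
  (GradedSpace.mkHom_congr (X := ⟨E.M, E.structureSheaf⟩) (Y := ⟨E.M, E.structureSheaf⟩)
    id contMDiff_id (pullSec_id (E := E)) _ (fun _ => rfl)).trans
    (GradedSpace.mkHom_id _)

theorem pullHom_comp {G : VB2} (g : F ⟶ G) :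
    pullHom (f ≫ g) = (show GradedSpace.mk E.M E.structureSheaf ⟶
      GradedSpace.mk F.M F.structureSheaf from pullHom f) ≫ pullHom g :=
  (GradedSpace.mkHom_congr (X := ⟨E.M, E.structureSheaf⟩) (Y := ⟨G.M, G.structureSheaf⟩)
    (g.base ∘ f.base) _ (pullSec_comp f g) _ _).trans
    (GradedSpace.mkHom_comp (X := ⟨E.M, E.structureSheaf⟩) (Y := ⟨F.M, F.structureSheaf⟩)
      (Z := ⟨G.M, G.structureSheaf⟩) f.base f.base_smooth (pullSec f) (pullSec_res f)
      g.base g.base_smooth (pullSec g) (pullSec_res g)).symm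

end VB2

/-- The functor `(E₁, Ẽ, φ) ↦ (M, (⋀ Γ(E₁*) ⊗ S Γ(Ẽ*)) / I)`, with values in manifolds with a presheaf of
graded algebras. -/
def functorF : VB2 ⥤ GradedSpace where
  obj E := ⟨E.M, E.structureSheaf⟩
  map f := VB2.pullHom f
  map_id _ := VB2.pullHom_id
  map_comp f g := VB2.pullHom_comp f g

end DegTwo

end

open CategoryTheory TopologicalSpace TensorProduct
open scoped Manifold ContDiff DirectSum

noncomputable section

namespace DegTwo

/-! ### The fibre algebra in low degrees -/

namespace FibreAlg

section General
variable {V W : Type} [AddCommGroup V] [Module ℝ V] [AddCommGroup W] [Module ℝ W]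
  (j : ⋀[ℝ]^2 V →ₗ[ℝ] W)

/-! The proof reduces sheaf-theoretic statements to linear algebra in the fibres.

Objects. Since `φ` is onto and `⋀²` of a finite-dimensional dual is the dual of `⋀²`, the map `⋀²
E₁* → Ẽ*` dual to `φ` is injective (`iota_injective`). In a fibre it therefore splits, `Ẽ* ≅ ⋀² E₁*
⊕ Q`; the relation eliminates the first summand and leaves `⋀ E₁* ⊗ S Q` (`splitEquiv`). A splitting
chosen at one point persists nearby, because invertibility of a matrix of smooth functions is an
open condition (`exists_frame`). This gives the local model with `m₁ = rank E₁` and `m₂ = rank Ẽ -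
(rank E₁ choose 2)`. Conversely, the fibre algebra remembers the triple: its parts of degree 0, 1, 2
are `ℝ`, `E₁*`, `Ẽ*`, and the product of degree one elements is the dual of `φ`.

Morphisms. The decisive point is that a morphism of sheaves acts fibrewise. A compatible family of
characters of the functions defined near `y` is evaluation at `y`, because a function that does not
vanish at `y` is invertible near `y` (`character_eq_eval`). A degree-preserving map sends functions
to degree 0, that is, to scalars at each point; so the image of a section at a point depends only on
the value of that section at the image point (`exists_factor`). The resulting algebra maps of fibres
are determined in degrees 1 and 2, where their transposes are the two bundle maps. Multiplicativity
is compatibility with `φ`, and smoothness holds because smooth sections go to smooth sections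
(`exists_hom`). Faithfulness is the injectivity of the generators in the fibre algebra.

Essential surjectivity. The same factorization, applied to two local trivializations, gives
transition maps of the model fibre. In degrees 1 and 2 they are smooth cocycles compatible with `⋀²`
(`modelCocycle`), and the bundles with these cocycles form a triple. Its frames have the same
transition maps as the given trivializations (`tau_transition`), so the local isomorphisms agree on
overlaps, and the sheaf property in each degree glues them (`isIso_comparison`). -/

theorem exists_of_mem_deg_zero {a : FibreAlg j} (ha : a ∈ deg j 0) :
    ∃ r : ℝ, a = algebraMap ℝ _ r := by
  have : deg j 0 ≤ LinearMap.range (Algebra.linearMap ℝ (FibreAlg j)) := by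
    refine Submodule.span_le.2 ?_
    rintro _ ⟨⟨l, m⟩, h, rfl⟩
    simp only [Set.mem_ofPred_eq] at h
    obtain rfl : l = [] := List.length_eq_zero_iff.1 (by omega)
    obtain rfl : m = [] := List.length_eq_zero_iff.1 (by omega)
    exact ⟨1, by simp [monomial]⟩
  obtain ⟨r, hr⟩ := this ha
  exact ⟨r, hr.symm⟩

theorem exists_of_mem_deg_one {a : FibreAlg j} (ha : a ∈ deg j 1) : ∃ v : V, a = gen₁ j v := by
  have : deg j 1 ≤ LinearMap.range (gen₁ j) := by
    refine Submodule.span_le.2 ?_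
    rintro _ ⟨⟨l, m⟩, h, rfl⟩
    simp only [Set.mem_ofPred_eq] at h
    obtain ⟨v, rfl⟩ := List.length_eq_one_iff.1 (by omega : l.length = 1)
    obtain rfl : m = [] := List.length_eq_zero_iff.1 (by simp at h; simp [h])
    exact ⟨v, by simp [monomial]⟩
  obtain ⟨r, hr⟩ := this ha
  exact ⟨r, hr.symm⟩

/-- A monomial of degree two is `w` or `v v'`, and the defining relation turns `v v'` into a degree
two generator. So degree two contains nothing beyond `W`. -/
theorem exists_of_mem_deg_two {a : FibreAlg j} (ha : a ∈ deg j 2) : ∃ w : W, a = gen₂ j w := by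
  have : deg j 2 ≤ LinearMap.range (gen₂ j) := by
    refine Submodule.span_le.2 ?_
    rintro _ ⟨⟨l, m⟩, h, rfl⟩
    simp only [Set.mem_ofPred_eq] at h
    rcases Nat.lt_or_ge 0 m.length with hm | hm
    · obtain ⟨w, rfl⟩ := List.length_eq_one_iff.1 (by omega : m.length = 1)
      obtain rfl : l = [] := List.length_eq_zero_iff.1 (by simp at h; simp [h])
      exact ⟨w, by simp [monomial]⟩
    · obtain rfl : m = [] := List.length_eq_zero_iff.1 (by omega)
      obtain ⟨v, v', rfl⟩ := List.length_eq_two.1 (by simpa using h : l.length = 2)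
      exact ⟨_, by simp [monomial, gen₁_mul_gen₁]; rfl⟩
  obtain ⟨r, hr⟩ := this ha
  exact ⟨r, hr.symm⟩

theorem adjoin_gen : Algebra.adjoin ℝ (Set.range (gen₁ j) ∪ Set.range (gen₂ j)) = ⊤ := by
  rw [eq_top_iff]
  have h : (⨆ q, deg j q) ≤ Subalgebra.toSubmodule
      (Algebra.adjoin ℝ (Set.range (gen₁ j) ∪ Set.range (gen₂ j))) := by
    refine iSup_le fun q => Submodule.span_le.2 ?_
    rintro _ ⟨⟨l, m⟩, -, rfl⟩
    refine Subalgebra.mul_mem _ (list_prod_mem fun x hx => ?_) (list_prod_mem fun x hx => ?_)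
    · obtain ⟨v, -, rfl⟩ := List.mem_map.1 hx
      exact Algebra.subset_adjoin (Or.inl ⟨v, rfl⟩)
    · obtain ⟨v, -, rfl⟩ := List.mem_map.1 hx
      exact Algebra.subset_adjoin (Or.inr ⟨v, rfl⟩)
  intro a _
  refine h ?_
  rw [(DirectSum.Decomposition.isInternal (deg j)).submodule_iSup_eq_top]
  trivial

theorem mem_of_gen_mem (S : Subalgebra ℝ (FibreAlg j)) (h₁ : ∀ v, gen₁ j v ∈ S)
    (h₂ : ∀ w, gen₂ j w ∈ S) (a : FibreAlg j) : a ∈ S := by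
  have : Algebra.adjoin ℝ (Set.range (gen₁ j) ∪ Set.range (gen₂ j)) ≤ S := by
    refine Algebra.adjoin_le ?_
    rintro _ (⟨v, rfl⟩ | ⟨w, rfl⟩)
    exacts [h₁ v, h₂ w]
  rw [adjoin_gen] at this
  exact this trivial

/-- A monomial of degree `q` has at most `q` factors of each kind, so degree `q` sits in a finite
sum of products of powers of two finite-dimensional subspaces. Finiteness allows smooth families in
degree `q` to be written with finitely many smooth coefficients. -/
instance finite_deg [Module.Finite ℝ V] [Module.Finite ℝ W] (q : ℕ) :
    Module.Finite ℝ (deg j q) := by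
  let P : Submodule ℝ (FibreAlg j) := ⨆ k : Fin (q + 1), ⨆ l : Fin (q + 1),
    LinearMap.range (gen₁ j) ^ (k : ℕ) * LinearMap.range (gen₂ j) ^ (l : ℕ)
  have hP : P.FG := Submodule.fg_iSup _ fun k => Submodule.fg_iSup _ fun l =>
    ((Module.Finite.iff_fg.1 inferInstance : (LinearMap.range (gen₁ j)).FG).pow _).mul
      ((Module.Finite.iff_fg.1 inferInstance : (LinearMap.range (gen₂ j)).FG).pow _)
  have : Module.Finite ℝ P := Module.Finite.iff_fg.2 hP
  have key : ∀ {U : Type} [AddCommGroup U] [Module ℝ U] (f : U →ₗ[ℝ] FibreAlg j) (l : List U),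
      (l.map f).prod ∈ LinearMap.range f ^ l.length := by
    intro U _ _ f l
    induction l with
    | nil => exact Submodule.one_le.1 le_rfl
    | cons u l ih =>
      rw [List.map_cons, List.prod_cons, List.length_cons, pow_succ']
      exact Submodule.mul_mem_mul ⟨u, rfl⟩ ih
  have hle : deg j q ≤ P := by
    refine Submodule.span_le.2 ?_
    rintro _ ⟨⟨l, m⟩, h, rfl⟩
    simp only [Set.mem_ofPred_eq] at h
    refine Submodule.mem_iSup_of_mem ⟨l.length, by omega⟩
      (Submodule.mem_iSup_of_mem ⟨m.length, by omega⟩ ?_)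
    exact Submodule.mul_mem_mul (key _ l) (key _ m)
  exact Submodule.finiteDimensional_of_le hle

/-- The augmentation, which kills the generators. -/
def aug : FibreAlg j →ₐ[ℝ] ℝ :=
  lift j 0 0 (by simp) (by simp) (by simp) (by simp)

variable {V' W' : Type} [AddCommGroup V'] [Module ℝ V'] [AddCommGroup W'] [Module ℝ W']

/-- Isomorphic data have isomorphic fibre algebras. -/
def congr (j' : ⋀[ℝ]^2 V' →ₗ[ℝ] W') (f : V ≃ₗ[ℝ] V') (g : W ≃ₗ[ℝ] W')
    (h : g.toLinearMap ∘ₗ j = j' ∘ₗ exteriorPower.map 2 f.toLinearMap) :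
    FibreAlg j ≃ₐ[ℝ] FibreAlg j' :=
  have h' : g.symm.toLinearMap ∘ₗ j' = j ∘ₗ exteriorPower.map 2 f.symm.toLinearMap := by
    have e : j' = g.toLinearMap ∘ₗ j ∘ₗ exteriorPower.map 2 f.symm.toLinearMap := by
      rw [← LinearMap.comp_assoc, h, LinearMap.comp_assoc, ← exteriorPower.map_comp]
      simp [exteriorPower.map_id]
    rw [e, ← LinearMap.comp_assoc]
    simp
  AlgEquiv.ofAlgHom (map j j' f.toLinearMap g.toLinearMap h)
    (map j' j f.symm.toLinearMap g.symm.toLinearMap h')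
    (algHom_ext _ (by simp) (by simp)) (algHom_ext _ (by simp) (by simp))

section
variable (j' : ⋀[ℝ]^2 V' →ₗ[ℝ] W') (f : V ≃ₗ[ℝ] V') (g : W ≃ₗ[ℝ] W')
    (h : g.toLinearMap ∘ₗ j = j' ∘ₗ exteriorPower.map 2 f.toLinearMap)

@[simp] theorem congr_gen₁ (v : V) : congr j j' f g h (gen₁ j v) = gen₁ j' (f v) :=
  map_gen₁ _ _ _ _ _ _
@[simp] theorem congr_gen₂ (w : W) : congr j j' f g h (gen₂ j w) = gen₂ j' (g w) :=
  map_gen₂ _ _ _ _ _ _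
@[simp] theorem congr_symm_gen₁ (v : V') : (congr j j' f g h).symm (gen₁ j' v) = gen₁ j (f.symm v) :=
  map_gen₁ _ _ _ _ _ _
@[simp] theorem congr_symm_gen₂ (w : W') : (congr j j' f g h).symm (gen₂ j' w) = gen₂ j (g.symm w) :=
  map_gen₂ _ _ _ _ _ _

theorem congr_mem {q : ℕ} {a : FibreAlg j} : congr j j' f g h a ∈ deg j' q ↔ a ∈ deg j q := by
  refine ⟨fun ha => ?_, fun ha => map_mem _ _ _ _ _ ha⟩
  have := map_mem j' j f.symm.toLinearMap g.symm.toLinearMap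
    (by
      have e : j' = g.toLinearMap ∘ₗ j ∘ₗ exteriorPower.map 2 f.symm.toLinearMap := by
        rw [← LinearMap.comp_assoc, h, LinearMap.comp_assoc, ← exteriorPower.map_comp]
        simp [exteriorPower.map_id]
      rw [e, ← LinearMap.comp_assoc]
      simp) ha
  convert this
  exact ((congr j j' f g h).symm_apply_apply a).symm
end

end General

/-! ### The split case -/

section Split
variable (V Q : Type) [AddCommGroup V] [Module ℝ V] [AddCommGroup Q] [Module ℝ Q]

/-- The fibre algebra of the inclusion of `⋀² V` in `⋀² V × Q`. -/
abbrev Split : Type := FibreAlg (LinearMap.inl ℝ (⋀[ℝ]^2 V) Q)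

variable {V} in
-- Moving a vector past a product of two vectors costs two signs. The universal property of the
-- fibre algebra needs this for the images of the degree two generators.
theorem commute_wedge_two (T : ⋀[ℝ]^2 V) (a : ExteriorAlgebra ℝ V) :
    Commute (T : ExteriorAlgebra ℝ V) a := by
  induction a using ExteriorAlgebra.induction with
  | algebraMap r => exact Algebra.commute_algebraMap_right _ _
  | mul a b ha hb => exact ha.mul_right hb
  | add a b ha hb => exact ha.add_right hb
  | ι u =>
    have : LinearMap.mulRight ℝ (ExteriorAlgebra.ι ℝ u) ∘ₗ (⋀[ℝ]^2 V).subtype =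
        LinearMap.mulLeft ℝ (ExteriorAlgebra.ι ℝ u) ∘ₗ (⋀[ℝ]^2 V).subtype := by
      refine LinearMap.ext_on_range (exteriorPower.ιMulti_span ℝ 2 V) fun v => ?_
      have h : ∀ x y : V, ExteriorAlgebra.ι ℝ x * ExteriorAlgebra.ι ℝ y =
          -(ExteriorAlgebra.ι ℝ y * ExteriorAlgebra.ι ℝ x) := fun x y =>
        eq_neg_of_add_eq_zero_left (ExteriorAlgebra.ι_add_mul_swap x y)
      simp only [LinearMap.comp_apply, Submodule.subtype_apply, LinearMap.mulRight_apply,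
        LinearMap.mulLeft_apply, exteriorPower.ιMulti_apply_coe, ExteriorAlgebra.ιMulti_apply,
        List.ofFn_succ, List.ofFn_zero, List.prod_cons, List.prod_nil, mul_one]
      rw [mul_assoc, h _ u, mul_neg, ← mul_assoc, h _ u, neg_mul, neg_neg, mul_assoc]
    exact LinearMap.congr_fun this T

/-- `⋀ V ⊗ S Q` as a fibre algebra. -/
def splitTo : Split V Q →ₐ[ℝ] ExteriorAlgebra ℝ V ⊗[ℝ] SymmetricAlgebra ℝ Q :=
  lift _ ((TensorProduct.mk ℝ _ _).flip 1 ∘ₗ ExteriorAlgebra.ι ℝ)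
    (LinearMap.coprod ((TensorProduct.mk ℝ _ _).flip 1 ∘ₗ (⋀[ℝ]^2 V).subtype)
      ((TensorProduct.mk ℝ _ _) 1 ∘ₗ SymmetricAlgebra.ι ℝ Q))
    (by simp)
    (by
      intro w w'
      simp [mul_add, add_mul, (commute_wedge_two w.1 _).eq, mul_comm]
      abel)
    (by intro v w; simp [mul_add, add_mul, (commute_wedge_two w.1 _).eq])
    (by intro v v'; simp [ExteriorAlgebra.ιMulti_apply])

/-- The inverse of `splitTo`. -/
def splitInv : ExteriorAlgebra ℝ V ⊗[ℝ] SymmetricAlgebra ℝ Q →ₐ[ℝ] Split V Q :=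
  Algebra.TensorProduct.lift (ExteriorAlgebra.lift ℝ ⟨gen₁ _, gen₁_sq _⟩)
    (symLift (gen₂ _ ∘ₗ LinearMap.inr ℝ _ _) fun _ _ => gen₂_comm _ _ _) (by
      intro x y
      induction y using SymmetricAlgebra.induction with
      | algebraMap r => rw [AlgHom.commutes]; exact Algebra.commute_algebraMap_right _ _
      | mul a b ha hb => rw [map_mul]; exact ha.mul_right hb
      | add a b ha hb => rw [map_add]; exact ha.add_right hb
      | ι w => rw [symLift_ι]; exact (gen₂_comm _ _ _).symm)

@[simp] theorem splitInv_ι_left (v : V) :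
    splitInv V Q (ExteriorAlgebra.ι ℝ v ⊗ₜ 1) = gen₁ _ v := by
  simp [splitInv]

@[simp] theorem splitInv_ι_right (p : Q) :
    splitInv V Q (1 ⊗ₜ SymmetricAlgebra.ι ℝ Q p) = gen₂ _ (0, p) := by
  simp [splitInv, symLift_ι]

theorem splitInv_wedge (T : ⋀[ℝ]^2 V) :
    splitInv V Q ((T : ExteriorAlgebra ℝ V) ⊗ₜ 1) = gen₂ _ (T, 0) := by
  have : (splitInv V Q).toLinearMap ∘ₗ (TensorProduct.mk ℝ _ _).flip 1 ∘ₗ (⋀[ℝ]^2 V).subtype =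
      gen₂ _ ∘ₗ LinearMap.inl ℝ (⋀[ℝ]^2 V) Q := by
    refine LinearMap.ext_on_range (exteriorPower.ιMulti_span ℝ 2 V) fun v => ?_
    have e : v = ![v 0, v 1] := by ext i; fin_cases i <;> rfl
    have := gen₁_mul_gen₁ (LinearMap.inl ℝ (⋀[ℝ]^2 V) Q) (v 0) (v 1)
    rw [← e] at this
    simp only [LinearMap.comp_apply]
    rw [← this, ← splitInv_ι_left, ← splitInv_ι_left, ← map_mul]
    simp [ExteriorAlgebra.ιMulti_apply, Matrix.vecTail]
  exact LinearMap.congr_fun this T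

@[simp] theorem splitTo_gen₁ (v : V) : splitTo V Q (gen₁ _ v) = ExteriorAlgebra.ι ℝ v ⊗ₜ 1 := by
  simp [splitTo]

@[simp] theorem splitTo_gen₂ (w : ⋀[ℝ]^2 V × Q) : splitTo V Q (gen₂ _ w) =
    (w.1 : ExteriorAlgebra ℝ V) ⊗ₜ 1 + 1 ⊗ₜ SymmetricAlgebra.ι ℝ Q w.2 := by
  simp [splitTo]

/-- The fibre algebra of the inclusion of `⋀² V` in `⋀² V × Q` is `⋀ V ⊗ S Q`. -/
def splitEquiv : Split V Q ≃ₐ[ℝ] ExteriorAlgebra ℝ V ⊗[ℝ] SymmetricAlgebra ℝ Q :=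
  AlgEquiv.ofAlgHom (splitTo V Q) (splitInv V Q)
    (by
      refine Algebra.TensorProduct.ext (ExteriorAlgebra.hom_ext (LinearMap.ext fun v => ?_)) ?_
      · simp
      · refine AlgHom.ext fun y => ?_
        induction y using SymmetricAlgebra.induction with
        | algebraMap r => simp
        | mul a b ha hb => rw [map_mul, map_mul, ha, hb]
        | add a b ha hb => rw [map_add, map_add, ha, hb]
        | ι w => simp)
    (by
      refine algHom_ext _ (fun v => by simp) (fun w => ?_)
      have : gen₂ (LinearMap.inl ℝ (⋀[ℝ]^2 V) Q) w = gen₂ _ (w.1, 0) + gen₂ _ (0, w.2) := by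
        rw [← map_add]; simp
      simp [splitInv_wedge, this])

/-- The grading of `⋀ V ⊗ S Q`. -/
def splitGr (q : ℕ) : Submodule ℝ (ExteriorAlgebra ℝ V ⊗[ℝ] SymmetricAlgebra ℝ Q) :=
  Submodule.span ℝ {s | ∃ (a b : ℕ) (η : ExteriorAlgebra ℝ V) (P : SymmetricAlgebra ℝ Q),
    a + 2 * b = q ∧ η ∈ ⋀[ℝ]^a V ∧ P ∈ LinearMap.range (SymmetricAlgebra.ι ℝ Q) ^ b ∧ s = η ⊗ₜ P}

theorem splitInv_mem {a b : ℕ} {η : ExteriorAlgebra ℝ V} {P : SymmetricAlgebra ℝ Q}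
    (hη : η ∈ ⋀[ℝ]^a V) (hP : P ∈ LinearMap.range (SymmetricAlgebra.ι ℝ Q) ^ b) :
    splitInv V Q (η ⊗ₜ P) ∈ deg (LinearMap.inl ℝ (⋀[ℝ]^2 V) Q) (a + 2 * b) := by
  have h₁ : splitInv V Q (η ⊗ₜ 1) ∈ deg (LinearMap.inl ℝ (⋀[ℝ]^2 V) Q) a := by
    induction hη using Submodule.pow_induction_on_left' with
    | algebraMap r =>
      have : splitInv V Q (algebraMap ℝ _ r ⊗ₜ 1) = algebraMap ℝ _ r :=
        (splitInv V Q).commutes r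
      rw [this, Algebra.algebraMap_eq_smul_one]
      exact Submodule.smul_mem _ _ SetLike.GradedOne.one_mem
    | add x y i _ _ hx hy => rw [TensorProduct.add_tmul, map_add]; exact add_mem hx hy
    | mem_mul m hm i x _ hx =>
      obtain ⟨v, rfl⟩ := hm
      have : (ExteriorAlgebra.ι ℝ v * x) ⊗ₜ[ℝ] (1 : SymmetricAlgebra ℝ Q) =
        (ExteriorAlgebra.ι ℝ v ⊗ₜ 1) * (x ⊗ₜ 1) := by simp
      rw [this, map_mul, splitInv_ι_left, Nat.succ_eq_add_one, add_comm]
      exact SetLike.GradedMul.mul_mem (gen₁_mem _ v) hx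
  have h₂ : splitInv V Q (1 ⊗ₜ P) ∈ deg (LinearMap.inl ℝ (⋀[ℝ]^2 V) Q) (2 * b) := by
    induction hP using Submodule.pow_induction_on_left' with
    | algebraMap r =>
      have : splitInv V Q (1 ⊗ₜ algebraMap ℝ _ r) = algebraMap ℝ _ r := by
        rw [← (splitInv V Q).commutes r, Algebra.TensorProduct.algebraMap_apply']
      rw [this, Algebra.algebraMap_eq_smul_one]
      exact Submodule.smul_mem _ _ (SetLike.GradedOne.one_mem (A := deg _))
    | add x y i _ _ hx hy => rw [TensorProduct.tmul_add, map_add]; exact add_mem hx hy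
    | mem_mul m hm i x _ hx =>
      obtain ⟨v, rfl⟩ := hm
      have : (1 : ExteriorAlgebra ℝ V) ⊗ₜ[ℝ] (SymmetricAlgebra.ι ℝ Q v * x) =
        (1 ⊗ₜ SymmetricAlgebra.ι ℝ Q v) * (1 ⊗ₜ x) := by simp
      rw [this, map_mul, splitInv_ι_right, Nat.succ_eq_add_one, mul_add, mul_one, add_comm]
      exact SetLike.GradedMul.mul_mem (gen₂_mem _ _) hx
  have : η ⊗ₜ[ℝ] P = (η ⊗ₜ 1) * (1 ⊗ₜ P) := by simp
  rw [this, map_mul]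
  exact SetLike.GradedMul.mul_mem h₁ h₂

/-- The spans `splitGr` are multiplicative, so it is enough to place the generators in degrees one
and two. With `splitInv_mem` this matches the grading of the fibre algebra with that of the local
model. -/
theorem splitTo_mem {q : ℕ} {x : Split V Q} (hx : x ∈ deg (LinearMap.inl ℝ (⋀[ℝ]^2 V) Q) q) :
    splitTo V Q x ∈ splitGr V Q q := by
  have hmul : ∀ {k l : ℕ} {s t}, s ∈ splitGr V Q k → t ∈ splitGr V Q l →
      s * t ∈ splitGr V Q (k + l) := by
    intro k l s t hs ht
    have := Submodule.mul_mem_mul hs ht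
    rw [splitGr, splitGr, Submodule.span_mul_span] at this
    refine Submodule.span_le.2 ?_ this
    rintro _ ⟨_, ⟨a, b, η, P, h, hη, hP, rfl⟩, _, ⟨a', b', η', P', h', hη', hP', rfl⟩, rfl⟩
    refine Submodule.subset_span ⟨a + a', b + b', η * η', P * P', by omega, ?_, ?_, by simp⟩
    · exact SetLike.GradedMul.mul_mem (A := fun i : ℕ => ⋀[ℝ]^i V) hη hη'
    · rw [pow_add]; exact Submodule.mul_mem_mul hP hP'
  have hone : (1 : ExteriorAlgebra ℝ V ⊗[ℝ] SymmetricAlgebra ℝ Q) ∈ splitGr V Q 0 :=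
    Submodule.subset_span ⟨0, 0, 1, 1, rfl,
      SetLike.GradedOne.one_mem (A := fun i : ℕ => ⋀[ℝ]^i V), by simp, rfl⟩
  have h₁ : ∀ v, splitTo V Q (gen₁ _ v) ∈ splitGr V Q 1 := fun v => by
    rw [splitTo_gen₁]
    refine Submodule.subset_span ⟨1, 0, _, 1, rfl, ?_, by simp, rfl⟩
    simp
  have h₂ : ∀ w, splitTo V Q (gen₂ _ w) ∈ splitGr V Q 2 := fun w => by
    rw [splitTo_gen₂]
    -- The components of `w` in `⋀² V` and in `Q` have bidegrees `(2, 0)` and `(0, 1)`; both have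
    -- total degree two.
    refine add_mem (Submodule.subset_span ⟨2, 0, _, 1, rfl, w.1.2, by simp, rfl⟩)
      (Submodule.subset_span ⟨0, 1, 1, _, rfl,
        SetLike.GradedOne.one_mem (A := fun i : ℕ => ⋀[ℝ]^i V), ?_, rfl⟩)
    rw [pow_one]; exact ⟨w.2, rfl⟩
  refine (Submodule.span_le (p := (splitGr V Q q).comap (splitTo V Q).toLinearMap)).2 ?_ hx
  rintro _ ⟨⟨l, m⟩, h, rfl⟩
  simp only [Set.mem_ofPred_eq] at h
  subst h
  simp only [monomial]
  rw [SetLike.mem_coe, Submodule.mem_comap, AlgHom.toLinearMap_apply, map_mul]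
  refine hmul ?_ ?_
  · clear hx
    induction l with
    | nil => simpa using hone
    | cons v l ih =>
      rw [List.map_cons, List.prod_cons, map_mul, List.length_cons, add_comm]
      exact hmul (h₁ v) ih
  · clear hx
    induction m with
    | nil => simpa using hone
    | cons v l ih =>
      rw [List.map_cons, List.prod_cons, map_mul, List.length_cons, mul_add, mul_one, add_comm]
      exact hmul (h₂ v) ih

/-- The projection of `⋀ V ⊗ S Q` to `⋀ V`. -/
def splitLeft : ExteriorAlgebra ℝ V ⊗[ℝ] SymmetricAlgebra ℝ Q →ₗ[ℝ] ExteriorAlgebra ℝ V :=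
  (TensorProduct.rid ℝ _).toLinearMap ∘ₗ
    TensorProduct.map LinearMap.id SymmetricAlgebra.algebraMapInv.toLinearMap

/-- The projection of `⋀ V ⊗ S Q` to `S Q`. -/
def splitRight : ExteriorAlgebra ℝ V ⊗[ℝ] SymmetricAlgebra ℝ Q →ₗ[ℝ] SymmetricAlgebra ℝ Q :=
  (TensorProduct.lid ℝ _).toLinearMap ∘ₗ
    TensorProduct.map ExteriorAlgebra.algebraMapInv.toLinearMap LinearMap.id

theorem split_gen₁_injective : Function.Injective (gen₁ (LinearMap.inl ℝ (⋀[ℝ]^2 V) Q)) := by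
  refine (injective_iff_map_eq_zero _).2 fun v hv => ?_
  simpa [splitLeft] using congrArg (splitLeft V Q) (congrArg (splitTo V Q) hv)

/-- Projection to `⋀ V` recovers the component in `⋀² V`. Once that vanishes, projection to `S Q`
recovers the component in `Q`, which is detected by linear functionals extended to characters of `S
Q`. -/
theorem split_gen₂_injective : Function.Injective (gen₂ (LinearMap.inl ℝ (⋀[ℝ]^2 V) Q)) := by
  refine (injective_iff_map_eq_zero _).2 fun w hw => ?_
  have h₁ := congrArg (splitLeft V Q) (congrArg (splitTo V Q) hw)
  simp [splitLeft, SymmetricAlgebra.algebraMapInv_ι] at h₁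
  have h₂ := congrArg (splitRight V Q) (congrArg (splitTo V Q) hw)
  simp [splitRight, h₁] at h₂
  have h₃ : w.2 = 0 := (Module.forall_dual_apply_eq_zero_iff ℝ _).1 fun f => by
    simpa using congrArg (SymmetricAlgebra.lift f) h₂
  exact Prod.ext h₁ h₃

end Split

end FibreAlg

/-! ### Duality of exterior powers -/

/-- The pairing carries the basis of `⋀ⁿ V*` built from the dual basis to the dual of the induced
basis of `⋀ⁿ V`. -/
theorem pairingDual_bijective (V : Type) [AddCommGroup V] [Module ℝ V] [Module.Finite ℝ V] (n : ℕ) :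
    Function.Bijective (exteriorPower.pairingDual ℝ V n) := by
  let b := Module.finBasis ℝ V
  let B := b.dualBasis.exteriorPower (n := n)
  let C := (b.exteriorPower (n := n)).dualBasis
  have : exteriorPower.pairingDual ℝ V n = (B.equiv C (Equiv.refl _)).toLinearMap := by
    refine B.ext fun s => ?_
    rw [LinearEquiv.coe_coe, Module.Basis.equiv_apply, Equiv.refl_apply, Module.Basis.coe_dualBasis,
      exteriorPower.basis_coord, exteriorPower.basis_apply, Module.Basis.coe_dualBasis]
    rfl
  rw [this]
  exact (B.equiv C (Equiv.refl _)).bijective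

/-! ### Smooth functions on open sets -/

section SmoothFunctions
variable {M : Mfd}

/-- The algebra of smooth functions on an open set. -/
abbrev SmoothFun (M : Mfd) (V : Opens M) : Type := C^∞⟮𝓡 M.dim, V; 𝓘(ℝ), ℝ⟯

/-- Smoothness of a real function on an open set. -/
abbrev IsSmooth (V : Opens M) (g : V → ℝ) : Prop := ContMDiff (𝓡 M.dim) 𝓘(ℝ) ∞ g

/-- Extension by zero of a function on an open set. -/
def extendZero (V : Opens M) (g : V → ℝ) : M → ℝ := Function.extend Subtype.val g 0

@[simp] theorem extendZero_coe (V : Opens M) (g : V → ℝ) (x : V) : extendZero V g x = g x :=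
  Subtype.val_injective.extend_apply _ _ _

theorem contMDiffOn_iff_isSmooth {V : Opens M} {f : M → ℝ} :
    ContMDiffOn (𝓡 M.dim) 𝓘(ℝ) ∞ f V ↔ IsSmooth V fun x => f x := by
  refine ⟨fun h x => contMDiffAt_subtype_iff.2 (h.contMDiffAt (V.2.mem_nhds x.2)), fun h x hx => ?_⟩
  exact (contMDiffAt_subtype_iff.1 (h ⟨x, hx⟩)).contMDiffWithinAt

theorem contMDiffOn_extendZero {V : Opens M} {g : V → ℝ} :
    ContMDiffOn (𝓡 M.dim) 𝓘(ℝ) ∞ (extendZero V g) V ↔ IsSmooth V g := by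
  rw [contMDiffOn_iff_isSmooth]
  simp

theorem isSmooth_of_locally {V : Opens M} {g : V → ℝ}
    (h : ∀ x : V, ∃ (V' : Opens M) (hV : V' ≤ V), x.1 ∈ V' ∧
      IsSmooth V' fun y => g ⟨y.1, hV y.2⟩) : IsSmooth V g := by
  rw [← contMDiffOn_extendZero]
  intro x hx
  obtain ⟨V', hV, hx', hg⟩ := h ⟨x, hx⟩
  have : ContMDiffOn (𝓡 M.dim) 𝓘(ℝ) ∞ (extendZero V g) V' := by
    rw [contMDiffOn_iff_isSmooth]
    convert hg using 2 with y
    exact extendZero_coe V g ⟨y.1, hV y.2⟩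
  exact (this.contMDiffAt (V'.2.mem_nhds hx')).contMDiffWithinAt

theorem IsSmooth.mono {V V' : Opens M} {g : V → ℝ} (hg : IsSmooth V g) (h : V' ≤ V) :
    IsSmooth V' fun y => g ⟨y.1, h y.2⟩ :=
  hg.comp (contMDiff_inclusion h)

/-- Evaluation of smooth functions at a point. -/
def evalFun {V : Opens M} (x : V) : SmoothFun M V →ₐ[ℝ] ℝ where
  toFun f := f x
  map_one' := rfl
  map_mul' _ _ := rfl
  map_zero' := rfl
  map_add' _ _ := rfl
  commutes' _ := rfl

/-- A smooth function as an element of the algebra of smooth functions. -/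
def SmoothFun.mk {V : Opens M} (g : V → ℝ) (hg : IsSmooth V g) : SmoothFun M V := ⟨g, hg⟩

/-- A compatible family of characters of the algebras of smooth functions on the neighbourhoods of a
point is evaluation at that point. -/
theorem character_eq_eval {U₀ : Opens M} {y : M}
    (χ : ∀ U : Opens M, U ≤ U₀ → y ∈ U → SmoothFun M U →ₐ[ℝ] ℝ)
    (hχ : ∀ (U U' : Opens M) (h : U' ≤ U) (hU : U ≤ U₀) (hy : y ∈ U') (f : SmoothFun M U),
      χ U' (h.trans hU) hy (smoothRes h f) = χ U hU (h hy) f)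
    (U : Opens M) (hU : U ≤ U₀) (hy : y ∈ U) (f : SmoothFun M U) :
    χ U hU hy f = f ⟨y, hy⟩ := by
  by_contra hne
  let g : SmoothFun M U := f - algebraMap ℝ _ (χ U hU hy f)
  have hg : χ U hU hy g = 0 := by simp [g]
  have hgx : ∀ x, g x = f x - χ U hU hy f := fun x => rfl
  -- On the open set where `g` does not vanish it is a unit, yet by compatibility the character at
  -- `y` still kills it. This gives `0 = 1`.
  let U' : Opens M := ⟨{x | ∃ h : x ∈ U, g ⟨x, h⟩ ≠ 0}, by
    have : {x | ∃ h : x ∈ U, g ⟨x, h⟩ ≠ 0} = Subtype.val '' {x : U | g x ≠ 0} := by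
      ext x
      simp
    rw [this]
    exact U.2.isOpenMap_subtype_val _ (isOpen_ne_fun g.contMDiff.continuous continuous_const)⟩
  have hU' : U' ≤ U := fun x hx => hx.1
  have hy' : y ∈ U' := ⟨hy, by rw [hgx]; exact fun h => hne (sub_eq_zero.1 h).symm⟩
  let k : SmoothFun M U' := ⟨fun x => (g ⟨x.1, hU' x.2⟩)⁻¹,
    (IsSmooth.mono g.contMDiff hU').inv₀ fun x => x.2.2⟩
  have hk : smoothRes hU' g * k = 1 := by
    ext x
    exact mul_inv_cancel₀ x.2.2
  have := congrArg (χ U' (hU'.trans hU) hy') hk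
  rw [map_mul, hχ U U' hU' hU hy', hg, zero_mul, map_one] at this
  exact zero_ne_one this

end SmoothFunctions

/-! ### Sections of the local model as functions -/

/-- The inclusion of `⋀² ℝ^{m₁}` in `⋀² ℝ^{m₁} × ℝ^{m₂}`. -/
abbrev modelIncl (m₁ m₂ : ℕ) :
    ⋀[ℝ]^2 (Fin m₁ → ℝ) →ₗ[ℝ] ⋀[ℝ]^2 (Fin m₁ → ℝ) × (Fin m₂ → ℝ) :=
  LinearMap.inl ℝ _ _

/-- The fibre of the local model, as a fibre algebra. -/
abbrev ModelFib (m₁ m₂ : ℕ) : Type := FibreAlg (modelIncl m₁ m₂)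

namespace Model
variable {M : Mfd} {m₁ m₂ : ℕ} {V : Opens M}

/-- The value of a section of the local model at a point. -/
def ev (x : V) : Model M m₁ m₂ V →ₐ[ℝ] ModelFib m₁ m₂ :=
  (FibreAlg.splitInv (Fin m₁ → ℝ) (Fin m₂ → ℝ)).comp
    ((Algebra.TensorProduct.lid ℝ _).toAlgHom.comp
      (Algebra.TensorProduct.map (evalFun x) (AlgHom.id ℝ _)))

/-- The section `f b` of the local model. -/
def single (f : SmoothFun M V) : ModelFib m₁ m₂ →ₗ[ℝ] Model M m₁ m₂ V :=
  TensorProduct.mk ℝ _ _ f ∘ₗ (FibreAlg.splitTo (Fin m₁ → ℝ) (Fin m₂ → ℝ)).toLinearMap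

theorem ev_tmul (x : V) (f : SmoothFun M V)
    (a : ExteriorAlgebra ℝ (Fin m₁ → ℝ) ⊗[ℝ] SymmetricAlgebra ℝ (Fin m₂ → ℝ)) :
    ev x (f ⊗ₜ[ℝ] a) = f x • FibreAlg.splitInv (Fin m₁ → ℝ) (Fin m₂ → ℝ) a := by
  refine (congrArg (FibreAlg.splitInv (Fin m₁ → ℝ) (Fin m₂ → ℝ)) ?_).trans
    (map_smul (FibreAlg.splitInv (Fin m₁ → ℝ) (Fin m₂ → ℝ)) (f x) a)
  refine (congrArg (Algebra.TensorProduct.lid ℝ _) (Algebra.TensorProduct.map_tmul _ _ _ _)).trans ?_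
  exact Algebra.TensorProduct.lid_tmul _ _

@[simp] theorem ev_single (x : V) (f : SmoothFun M V) (b : ModelFib m₁ m₂) :
    ev x (single f b) = f x • b := by
  refine (ev_tmul x f _).trans ?_
  congr 1
  exact (FibreAlg.splitEquiv _ _).symm_apply_apply b

theorem ev_res {V' : Opens M} (h : V' ≤ V) (x : V') (s : Model M m₁ m₂ V) :
    ev x (Model.res m₁ m₂ h s) = ev ⟨x.1, h x.2⟩ s := by
  induction s using TensorProduct.induction_on with
  | zero => simp
  | add s t hs ht => rw [map_add, map_add, map_add, hs, ht]
  | tmul f a =>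
    rw [ev_tmul, Model.res]
    exact ev_tmul x (smoothRes h f) a

/-- The function obtained from a section of the local model and a linear functional on the fibre. -/
def coef (l : Module.Dual ℝ (ModelFib m₁ m₂)) : Model M m₁ m₂ V →ₗ[ℝ] SmoothFun M V :=
  (TensorProduct.rid ℝ _).toLinearMap ∘ₗ TensorProduct.map LinearMap.id
    (l ∘ₗ (FibreAlg.splitInv (Fin m₁ → ℝ) (Fin m₂ → ℝ)).toLinearMap)

theorem coef_apply (l : Module.Dual ℝ (ModelFib m₁ m₂)) (s : Model M m₁ m₂ V) (x : V) :
    coef l s x = l (ev x s) := by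
  induction s using TensorProduct.induction_on with
  | zero => simp
  | add s t hs ht => rw [map_add, map_add, map_add, ← hs, ← ht]; rfl
  | tmul f a =>
    rw [ev_tmul, map_smul, smul_eq_mul, mul_comm]
    simp [coef]

theorem isSmooth_ev (l : Module.Dual ℝ (ModelFib m₁ m₂)) (s : Model M m₁ m₂ V) :
    IsSmooth V fun x => l (ev x s) := by
  simp only [← coef_apply]
  exact (coef l s).contMDiff

/-- In a basis of `⋀ ⊗ S` a section has finitely many nonzero coefficients, which are smooth
functions. Each is obtained by applying a coordinate functional to the values, so the values
determine it. -/
theorem ext_ev {s t : Model M m₁ m₂ V} (h : ∀ x, ev x s = ev x t) : s = t := by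
  let b := Module.Basis.ofVectorSpace ℝ
    (ExteriorAlgebra ℝ (Fin m₁ → ℝ) ⊗[ℝ] SymmetricAlgebra ℝ (Fin m₂ → ℝ))
  classical
  refine (TensorProduct.equivFinsuppOfBasisRight b (M := SmoothFun M V)).injective ?_
  refine Finsupp.ext fun i => ?_
  have key : ∀ s : Model M m₁ m₂ V, TensorProduct.equivFinsuppOfBasisRight b s i =
      coef (b.coord i ∘ₗ (FibreAlg.splitTo (Fin m₁ → ℝ) (Fin m₂ → ℝ)).toLinearMap) s := by
    intro s
    induction s using TensorProduct.induction_on with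
    | zero => simp
    | add s t hs ht => rw [map_add, map_add, Finsupp.add_apply, hs, ht]
    | tmul f a =>
      rw [TensorProduct.equivFinsuppOfBasisRight_apply_tmul_apply]
      simp only [coef, LinearMap.comp_apply, TensorProduct.map_tmul, LinearMap.id_apply,
        AlgHom.toLinearMap_apply, LinearEquiv.coe_coe, TensorProduct.rid_tmul]
      congr 1
      exact congrArg (b.coord i) ((FibreAlg.splitEquiv _ _).apply_symm_apply a).symm
  rw [key, key]
  ext x
  rw [coef_apply, coef_apply, h]

theorem ev_mem {q : ℕ} {s : Model M m₁ m₂ V} (hs : s ∈ Model.gr m₁ m₂ V q) (x : V) :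
    ev x s ∈ FibreAlg.deg (modelIncl m₁ m₂) q := by
  refine (Submodule.span_le (p := (FibreAlg.deg (modelIncl m₁ m₂) q).comap
    (ev x).toLinearMap)).2 ?_ hs
  rintro _ ⟨a, b, f, η, P, rfl, hη, hP, rfl⟩
  rw [SetLike.mem_coe, Submodule.mem_comap, AlgHom.toLinearMap_apply, ev_tmul]
  exact Submodule.smul_mem _ _ (FibreAlg.splitInv_mem _ _ hη hP)

theorem single_mem {q : ℕ} (f : SmoothFun M V) {b : ModelFib m₁ m₂}
    (hb : b ∈ FibreAlg.deg (modelIncl m₁ m₂) q) : single f b ∈ Model.gr m₁ m₂ V q := by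
  have := FibreAlg.splitTo_mem _ _ hb
  refine (Submodule.span_le (p := (Model.gr m₁ m₂ V q).comap (TensorProduct.mk ℝ _ _ f))).2 ?_ this
  rintro _ ⟨a, b, η, P, h, hη, hP, rfl⟩
  exact Submodule.subset_span ⟨a, b, f, η, P, h, hη, hP, rfl⟩

/-- A homogeneous function with values in the fibre of the local model which is smooth is a section of
the local model. -/
theorem exists_ev_eq {q : ℕ} {b : V → ModelFib m₁ m₂}
    (hb : ∀ x, b x ∈ FibreAlg.deg (modelIncl m₁ m₂) q)
    (hs : ∀ l : Module.Dual ℝ (ModelFib m₁ m₂), IsSmooth V fun x => l (b x)) :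
    ∃ t ∈ Model.gr m₁ m₂ V q, ∀ x, ev x t = b x := by
  let B := Module.finBasis ℝ (FibreAlg.deg (modelIncl m₁ m₂) q)
  -- A linear projection onto degree `q` extends the coordinates there to functionals on the whole
  -- fibre, to which the smoothness hypothesis applies.
  obtain ⟨p, hp⟩ := (FibreAlg.deg (modelIncl m₁ m₂) q).subtype.exists_leftInverse_of_injective
    (Submodule.ker_subtype _)
  refine ⟨∑ i, single (SmoothFun.mk _ (hs (B.coord i ∘ₗ p))) (B i : ModelFib m₁ m₂),
    sum_mem fun i _ => single_mem _ (B i).2, fun x => ?_⟩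
  rw [map_sum]
  have h₁ : p (b x) = ⟨b x, hb x⟩ := LinearMap.congr_fun hp ⟨b x, hb x⟩
  have h₂ := congrArg Subtype.val (B.sum_repr ⟨b x, hb x⟩)
  rw [Submodule.coe_sum] at h₂
  refine (Finset.sum_congr rfl fun i _ => ?_).trans h₂
  rw [ev_single, Submodule.coe_smul]
  congr 1
  exact congrArg (B.coord i) h₁

/-- A section with values in degree `q` is rebuilt as an element of the degree `q` part with the
same values, and values determine sections. -/
theorem mem_gr_iff {q : ℕ} {s : Model M m₁ m₂ V} :
    s ∈ Model.gr m₁ m₂ V q ↔ ∀ x, ev x s ∈ FibreAlg.deg (modelIncl m₁ m₂) q := by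
  refine ⟨fun h x => ev_mem h x, fun h => ?_⟩
  obtain ⟨t, ht, e⟩ := exists_ev_eq h fun l => isSmooth_ev l s
  rwa [← ext_ev e]

theorem span_single : Submodule.span ℝ {s : Model M m₁ m₂ V | ∃ f b, s = single f b} = ⊤ := by
  rw [← TensorProduct.span_tmul_eq_top]
  congr 1
  ext s
  constructor
  · rintro ⟨f, b, rfl⟩; exact ⟨f, _, rfl⟩
  · rintro ⟨f, a, rfl⟩
    refine ⟨f, FibreAlg.splitInv _ _ a, ?_⟩
    exact congrArg (f ⊗ₜ[ℝ] ·) ((FibreAlg.splitEquiv _ _).apply_symm_apply a).symm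

/-- The products `f b` with `b` constant as an algebra map in `b`. -/
def const : ModelFib m₁ m₂ →ₐ[ℝ] Model M m₁ m₂ V :=
  Algebra.TensorProduct.includeRight.comp (FibreAlg.splitTo (Fin m₁ → ℝ) (Fin m₂ → ℝ))

/-- Smooth functions as sections of the local model. -/
def func : SmoothFun M V →ₐ[ℝ] Model M m₁ m₂ V := Algebra.TensorProduct.includeLeft

theorem single_eq (f : SmoothFun M V) (b : ModelFib m₁ m₂) : single f b = func f * const b := by
  refine ext_ev fun x => ?_
  simp [single, func, const, Algebra.TensorProduct.tmul_mul_tmul]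

@[simp] theorem ev_const (x : V) (b : ModelFib m₁ m₂) :
    ev x (const b : Model M m₁ m₂ V) = b := by
  have : (const b : Model M m₁ m₂ V) = single 1 b := rfl
  rw [this, ev_single]
  exact one_smul _ _

@[simp] theorem ev_func (x : V) (f : SmoothFun M V) :
    ev x (func f : Model M m₁ m₂ V) = algebraMap ℝ _ (f x) := by
  rw [func, Algebra.TensorProduct.includeLeft_apply, ev_tmul, map_one,
    Algebra.algebraMap_eq_smul_one]

end Model

/-! ### Frames of dual bundles -/

/-- Smoothness on an open set of a real function on a manifold. -/
abbrev SmoothOn {M : Mfd} (U : Opens M) (f : M → ℝ) : Prop :=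
  ContMDiffOn (𝓡 M.dim) 𝓘(ℝ) ∞ f U

theorem smoothOn_matrix_det {M : Mfd} {U : Opens M} {n : ℕ} {A : M → Matrix (Fin n) (Fin n) ℝ}
    (hA : ∀ i k, SmoothOn U fun x => A x i k) : SmoothOn U fun x => (A x).det := by
  simp only [Matrix.det_apply', SmoothOn]
  exact contMDiffOn_finsetSum fun σ _ => contMDiffOn_const.mul (contMDiffOn_finsetProd fun i _ => hA _ _)

/-- Cramer's rule: the entries of the adjugate are themselves determinants. -/
theorem smoothOn_matrix_inv {M : Mfd} {U : Opens M} {n : ℕ} {A : M → Matrix (Fin n) (Fin n) ℝ}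
    (hA : ∀ i k, SmoothOn U fun x => A x i k) (hdet : ∀ x ∈ U, (A x).det ≠ 0) (i k : Fin n) :
    SmoothOn U fun x => (A x)⁻¹ i k := by
  simp only [Matrix.inv_def, Matrix.smul_apply, smul_eq_mul, Ring.inverse_eq_inv',
    Matrix.adjugate_apply]
  refine ((smoothOn_matrix_det hA).inv₀ hdet).mul (smoothOn_matrix_det fun a b => ?_)
  simp only [Matrix.updateRow_apply]
  split_ifs
  exacts [contMDiffOn_const, hA a b]

namespace SmoothVB
variable {M : Mfd} (E : SmoothVB M)

variable {E} in
theorem IsSmoothDual.of_locally {U : Opens M} {α : ∀ x : M, Module.Dual ℝ (E.Fib x)}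
    (h : ∀ x ∈ U, ∃ V : Opens M, x ∈ V ∧ ∃ β, E.IsSmoothDual V β ∧ ∀ y ∈ V, α y = β y) :
    E.IsSmoothDual U α := by
  intro p hp
  obtain ⟨V, hV, β, hβ, e⟩ := h p.proj hp
  have ho : IsOpen {p : E.Total | p.proj ∈ V} :=
    V.2.preimage (FiberBundle.continuous_proj (EuclideanSpace ℝ (Fin E.rank)) E.Fib)
  have : ContMDiffOn E.totalModel 𝓘(ℝ) ∞ (fun p : E.Total => α p.proj p.snd) {p | p.proj ∈ V} :=
    ContMDiffOn.congr hβ fun q hq => by rw [e q.proj hq]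
  exact (this.contMDiffAt (ho.mem_nhds hV)).contMDiffWithinAt

variable {E} in
theorem IsSmoothDual.mono {U V : Opens M} {α : ∀ x : M, Module.Dual ℝ (E.Fib x)}
    (h : E.IsSmoothDual U α) (hV : V ≤ U) : E.IsSmoothDual V α :=
  ContMDiffOn.mono h fun _ hp => hV hp

variable {E} in
theorem IsSmoothDual.congr {U : Opens M} {α β : ∀ x : M, Module.Dual ℝ (E.Fib x)}
    (h : E.IsSmoothDual U β) (e : ∀ x ∈ U, α x = β x) : E.IsSmoothDual U α :=
  ContMDiffOn.congr h fun q hq => by rw [e q.proj hq]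

variable {E} in
theorem IsSmoothDual.sum_smul {ι : Type} {s : Finset ι} {U : Opens M} {f : ι → M → ℝ}
    {α : ι → ∀ x : M, Module.Dual ℝ (E.Fib x)} (hf : ∀ i, SmoothOn U (f i))
    (hα : ∀ i, E.IsSmoothDual U (α i)) :
    E.IsSmoothDual U fun x => ∑ i ∈ s, f i x • α i x := by
  simp only [IsSmoothDual, LinearMap.sum_apply, LinearMap.smul_apply, smul_eq_mul]
  refine contMDiffOn_finsetSum fun i _ => ContMDiffOn.mul ?_ (hα i)
  exact (hf i).comp (Bundle.contMDiff_proj E.Fib).contMDiffOn fun p hp => hp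

variable {E} in
theorem IsSmoothDual.add {U : Opens M} {α β : ∀ x : M, Module.Dual ℝ (E.Fib x)}
    (hα : E.IsSmoothDual U α) (hβ : E.IsSmoothDual U β) : E.IsSmoothDual U fun x => α x + β x :=
  ContMDiffOn.add hα hβ

theorem isSmoothDual_zero (U : Opens M) : E.IsSmoothDual U fun _ => 0 :=
  contMDiffOn_const

/-- A frame over `U` of the dual of a vector bundle, with model fibre `P`. -/
structure DualFrame (P : Type) [AddCommGroup P] [Module ℝ P] (U : Opens M) where
  frm : ∀ x : M, P →ₗ[ℝ] Module.Dual ℝ (E.Fib x)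
  inv : ∀ x : M, Module.Dual ℝ (E.Fib x) →ₗ[ℝ] P
  inv_frm : ∀ x ∈ U, ∀ u, inv x (frm x u) = u
  frm_inv : ∀ x ∈ U, ∀ α, frm x (inv x α) = α
  smooth_frm : ∀ u, E.IsSmoothDual U fun x => frm x u
  smooth_inv : ∀ V ≤ U, ∀ α : ∀ x : M, Module.Dual ℝ (E.Fib x), E.IsSmoothDual V α →
    ∀ l : Module.Dual ℝ P, SmoothOn V fun x => l (inv x (α x))

/-! ### Operations on frames and their persistence near a point -/

namespace DualFrame
variable {E} {P : Type} [AddCommGroup P] [Module ℝ P] {U : Opens M} (D : E.DualFrame P U)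

/-- The frame as an isomorphism. -/
def equiv {x : M} (hx : x ∈ U) : P ≃ₗ[ℝ] Module.Dual ℝ (E.Fib x) :=
  LinearEquiv.ofLinearMap (D.frm x) (D.inv x) (LinearMap.ext (D.frm_inv x hx))
    (LinearMap.ext (D.inv_frm x hx))

@[simp] theorem equiv_apply {x : M} (hx : x ∈ U) (u : P) : D.equiv hx u = D.frm x u := rfl

/-- Restriction of a frame. -/
def restrict {V : Opens M} (h : V ≤ U) : E.DualFrame P V where
  frm := D.frm
  inv := D.inv
  inv_frm x hx := D.inv_frm x (h hx)
  frm_inv x hx := D.frm_inv x (h hx)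
  smooth_frm u := (D.smooth_frm u).mono h
  smooth_inv W hW := D.smooth_inv W (hW.trans h)

/-- Change of the model fibre. -/
def congr {P' : Type} [AddCommGroup P'] [Module ℝ P'] (c : P' ≃ₗ[ℝ] P) : E.DualFrame P' U where
  frm x := D.frm x ∘ₗ c.toLinearMap
  inv x := c.symm.toLinearMap ∘ₗ D.inv x
  inv_frm x hx u := by simp [D.inv_frm x hx]
  frm_inv x hx u := by simp [D.frm_inv x hx]
  smooth_frm u := D.smooth_frm (c u)
  smooth_inv V hV α hα l := D.smooth_inv V hV α hα (l ∘ₗ c.symm.toLinearMap)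

theorem isSmoothDual_of_coord [Module.Finite ℝ P] {V : Opens M} (hV : V ≤ U)
    {α : ∀ x : M, Module.Dual ℝ (E.Fib x)}
    (h : ∀ l : Module.Dual ℝ P, SmoothOn V fun x => l (D.inv x (α x))) : E.IsSmoothDual V α := by
  let b := Module.finBasis ℝ P
  refine (IsSmoothDual.sum_smul (s := Finset.univ) (fun i => h (b.coord i))
    fun i => (D.smooth_frm (b i)).mono hV).congr fun x hx => ?_
  have h₁ := congrArg (D.frm x) (b.sum_repr (D.inv x (α x)))
  rw [D.frm_inv x (hV hx), map_sum] at h₁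
  exact h₁.symm.trans (Finset.sum_congr rfl fun i _ => map_smul _ _ _)

/-- Smooth sections that form a frame at a point form a frame near that point. -/
theorem exists_of_bijective [Module.Finite ℝ P] (D : E.DualFrame P U) {P' : Type} [AddCommGroup P'] [Module ℝ P']
    [Module.Finite ℝ P'] (β : ∀ x : M, P' →ₗ[ℝ] Module.Dual ℝ (E.Fib x))
    (hβ : ∀ u, E.IsSmoothDual U fun x => β x u) {x₀ : M} (hx₀ : x₀ ∈ U)
    (hbij : Function.Bijective (β x₀)) :
    ∃ U' ≤ U, x₀ ∈ U' ∧ ∃ D' : E.DualFrame P' U', D'.frm = β := by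
  have hdim : Module.finrank ℝ P' = Module.finrank ℝ P :=
    ((LinearEquiv.ofBijective _ hbij).trans (D.equiv hx₀).symm).finrank_eq
  let b := Module.finBasis ℝ P
  let b' := Module.finBasisOfFinrankEq ℝ P' hdim
  let A : M → Matrix _ _ ℝ := fun x => LinearMap.toMatrix b' b (D.inv x ∘ₗ β x)
  have hA : ∀ i k, SmoothOn U fun x => A x i k := fun i k => by
    have := D.smooth_inv U le_rfl _ (hβ (b' k)) (b.coord i)
    simpa [A, LinearMap.toMatrix_apply] using this
  have hdet := smoothOn_matrix_det hA
  -- `A` is the matrix of `β` in the given frame; its entries are smooth, so the points where it is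
  -- invertible form an open set.
  let U' : Opens M := ⟨{x | x ∈ U ∧ (A x).det ≠ 0},
    hdet.continuousOn.isOpen_inter_preimage U.2 isOpen_ne⟩
  have hU' : U' ≤ U := fun x hx => hx.1
  have hx₀' : x₀ ∈ U' := by
    refine ⟨hx₀, ?_⟩
    have : D.inv x₀ ∘ₗ β x₀ =
        ((LinearEquiv.ofBijective _ hbij).trans (D.equiv hx₀).symm).toLinearMap := rfl
    simp only [A, this]
    exact (LinearEquiv.isUnit_det _ b' b).ne_zero
  refine ⟨U', hU', hx₀', ?_⟩
  have h₁ : ∀ x ∈ U', (Matrix.toLin b b' (A x)⁻¹) ∘ₗ (D.inv x ∘ₗ β x) = LinearMap.id := by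
    intro x hx
    apply (LinearMap.toMatrix b' b').injective
    rw [LinearMap.toMatrix_comp b' b b', LinearMap.toMatrix_toLin, LinearMap.toMatrix_id]
    exact Matrix.nonsing_inv_mul _ (isUnit_iff_ne_zero.2 hx.2)
  have h₂ : ∀ x ∈ U', (D.inv x ∘ₗ β x) ∘ₗ (Matrix.toLin b b' (A x)⁻¹) = LinearMap.id := by
    intro x hx
    apply (LinearMap.toMatrix b b).injective
    rw [LinearMap.toMatrix_comp b b' b, LinearMap.toMatrix_toLin, LinearMap.toMatrix_id]
    exact Matrix.mul_nonsing_inv _ (isUnit_iff_ne_zero.2 hx.2)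
  -- The inverse of `β` takes coordinates in the old frame and applies the inverse matrix, whose
  -- entries are smooth.
  refine ⟨⟨β, fun x => (Matrix.toLin b b' (A x)⁻¹) ∘ₗ D.inv x, ?_, ?_, ?_, ?_⟩, rfl⟩
  · intro x hx u
    exact LinearMap.congr_fun (h₁ x hx) u
  · intro x hx α
    have := LinearMap.congr_fun (h₂ x hx) (D.inv x α)
    have := congrArg (D.frm x) this
    simpa [D.frm_inv x (hU' hx)] using this
  · exact fun u => (hβ u).mono hU'
  · intro V hV α hα l
    have h₃ : ∀ x, l ((Matrix.toLin b b' (A x)⁻¹ ∘ₗ D.inv x) (α x)) =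
        ∑ k, ∑ i, (A x)⁻¹ k i * b.coord i (D.inv x (α x)) * l (b' k) := by
      intro x
      rw [LinearMap.comp_apply, Matrix.toLin_apply, map_sum]
      simp only [map_smul, smul_eq_mul, Matrix.mulVec, dotProduct, Finset.sum_mul,
        Module.Basis.coord_apply]
    simp only [h₃]
    refine contMDiffOn_finsetSum fun k _ => contMDiffOn_finsetSum fun i _ => ContMDiffOn.mul
      (ContMDiffOn.mul ?_ (D.smooth_inv V (hV.trans hU') α hα _)) contMDiffOn_const
    exact ContMDiffOn.mono (smoothOn_matrix_inv (fun i k => (hA i k).mono hU')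
      (fun x hx => hx.2) k i) hV

end DualFrame

/-- The domain of the preferred trivialization at a point. -/
def trivSet (x₀ : M) : Opens M :=
  ⟨(trivializationAt (EuclideanSpace ℝ (Fin E.rank)) E.Fib x₀).baseSet,
    (trivializationAt (EuclideanSpace ℝ (Fin E.rank)) E.Fib x₀).open_baseSet⟩

theorem mem_trivSet (x₀ : M) : x₀ ∈ E.trivSet x₀ :=
  FiberBundle.mem_baseSet_trivializationAt _ _ x₀

/-- The frame of the dual bundle given by a trivialization. -/
def trivFrame (x₀ : M) :
    E.DualFrame (Module.Dual ℝ (EuclideanSpace ℝ (Fin E.rank))) (E.trivSet x₀) where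
  frm x := ((trivializationAt (EuclideanSpace ℝ (Fin E.rank)) E.Fib x₀).linearMapAt ℝ x).dualMap
  inv x := ((trivializationAt (EuclideanSpace ℝ (Fin E.rank)) E.Fib x₀).symmₗ ℝ x).dualMap
  inv_frm x hx u := by
    ext v
    simp only [LinearMap.dualMap_apply]
    rw [Bundle.Trivialization.linearMapAt_symmₗ _ hx]
  frm_inv x hx u := by
    ext v
    simp only [LinearMap.dualMap_apply]
    rw [Bundle.Trivialization.symmₗ_linearMapAt _ hx]
  smooth_frm u := by
    let e := trivializationAt (EuclideanSpace ℝ (Fin E.rank)) E.Fib x₀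
    have h : ContMDiffOn E.totalModel 𝓘(ℝ, EuclideanSpace ℝ (Fin E.rank)) ∞
        (fun p : E.Total => (e p).2) e.source :=
      contMDiff_snd.comp_contMDiffOn (e.contMDiffOn (IB := 𝓡 M.dim) (n := ∞))
    have h' := (LinearMap.toContinuousLinearMap u).contMDiff.comp_contMDiffOn h
    refine (h'.mono fun p hp => e.mem_source.2 hp).congr fun p hp => ?_
    simp only [LinearMap.dualMap_apply]
    rw [Bundle.Trivialization.coe_linearMapAt_of_mem _ hp]
    rfl
  smooth_inv V hV α hα l := by
    let e := trivializationAt (EuclideanSpace ℝ (Fin E.rank)) E.Fib x₀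
    -- A functional on the dual of a Euclidean space is evaluation at some `v`. So the coordinate in
    -- question is `α` applied to the local section with constant coordinate `v`.
    obtain ⟨v, rfl⟩ := (Module.evalEquiv ℝ (EuclideanSpace ℝ (Fin E.rank))).surjective l
    have h₁ : ContMDiffOn (𝓡 M.dim) ((𝓡 M.dim).prod 𝓘(ℝ, EuclideanSpace ℝ (Fin E.rank))) ∞
        (fun x : M => (x, v)) V := (contMDiff_id.prodMk contMDiff_const).contMDiffOn
    have h₂ := (e.contMDiffOn_symm (IB := 𝓡 M.dim) (n := ∞)).comp h₁
      fun x hx => e.mem_target.2 (hV hx)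
    refine (ContMDiffOn.comp hα h₂ fun x hx => ?_).congr fun x hx => ?_
    · have : (e.toOpenPartialHomeomorph.symm (x, v)).proj = x :=
        e.proj_symm_apply (e.mem_target.2 (hV hx))
      change (e.toOpenPartialHomeomorph.symm (x, v)).proj ∈ V
      rw [this]
      exact hx
    · refine Eq.trans ?_ (congrArg (fun p : E.Total => α p.proj p.snd) (e.mk_symm (hV hx) v))
      simp only [Module.evalEquiv_apply, Module.Dual.eval_apply, LinearMap.dualMap_apply]
      rw [Bundle.Trivialization.symmₗ_apply _ (hV hx)]

end SmoothVB

/-! ### Frames of triples and local triviality -/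

namespace SmoothVB
variable {M : Mfd} (E : SmoothVB M)

instance finite_fib (x : M) : Module.Finite ℝ (E.Fib x) :=
  Module.Finite.equiv (Bundle.Trivialization.linearEquivAt ℝ
    (trivializationAt (EuclideanSpace ℝ (Fin E.rank)) E.Fib x) x (E.mem_trivSet x)).symm

end SmoothVB

namespace VB2
variable (E : VB2)

theorem iota_ιMulti (x : E.M) (α β : Module.Dual ℝ (E.E₁.Fib x)) :
    E.iota x (exteriorPower.ιMulti ℝ 2 ![α, β]) =
      exteriorPower.pairingDual ℝ (E.E₁.Fib x) 2 (exteriorPower.ιMulti ℝ 2 ![α, β]) ∘ₗ E.φ x := rfl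

/-- The transpose of a surjection is injective, and the pairing is bijective in finite dimension.
This is where surjectivity of `φ` enters. -/
theorem iota_injective (x : E.M) : Function.Injective (E.iota x) := by
  rw [iota, LinearMap.coe_comp]
  exact (LinearMap.dualMap_injective_of_surjective (E.φ_surjective x)).comp
    (pairingDual_bijective _ 2).1

/-- A frame over `U` of `E₁*` and a frame of `Ẽ*` that extends the frame of `⋀² E₁*`. -/
structure Frame (m₁ m₂ : ℕ) (U : Opens E.M) where
  d₁ : E.E₁.DualFrame (Fin m₁ → ℝ) U
  dt : E.Et.DualFrame (⋀[ℝ]^2 (Fin m₁ → ℝ) × (Fin m₂ → ℝ)) U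
  compat : ∀ x ∈ U, dt.frm x ∘ₗ modelIncl m₁ m₂ = E.iota x ∘ₗ exteriorPower.map 2 (d₁.frm x)

/-- A frame of `E₁*` induces one of `⋀² E₁*`, which `iota` embeds in `Ẽ*`. At `x₀` its image, read
in a trivialization, has a complement `q`; sections with constant coordinates in `q` complete it to
a basis at `x₀`, hence to a frame near `x₀`. -/
theorem exists_frame (x₀ : E.M) : ∃ U : Opens E.M, x₀ ∈ U ∧
    Nonempty (E.Frame E.E₁.rank (E.Et.rank - E.E₁.rank.choose 2) U) := by
  let m₁ := E.E₁.rank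
  let m₂ := E.Et.rank - E.E₁.rank.choose 2
  let c₁ : (Fin m₁ → ℝ) ≃ₗ[ℝ] Module.Dual ℝ (EuclideanSpace ℝ (Fin E.E₁.rank)) :=
    LinearEquiv.ofFinrankEq _ _ (by rw [Subspace.dual_finrank_eq]; simp [m₁])
  let U : Opens E.M := E.E₁.trivSet x₀ ⊓ E.Et.trivSet x₀
  have hx₀ : x₀ ∈ U := ⟨E.E₁.mem_trivSet x₀, E.Et.mem_trivSet x₀⟩
  let d₁ : E.E₁.DualFrame (Fin m₁ → ℝ) U :=
    ((E.E₁.trivFrame x₀).congr c₁).restrict inf_le_left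
  let d' := (E.Et.trivFrame x₀).restrict (inf_le_right : U ≤ E.Et.trivSet x₀)
  let J : ⋀[ℝ]^2 (Fin m₁ → ℝ) →ₗ[ℝ] Module.Dual ℝ (EuclideanSpace ℝ (Fin E.Et.rank)) :=
    d'.inv x₀ ∘ₗ E.iota x₀ ∘ₗ exteriorPower.map 2 (d₁.frm x₀)
  have hJ : Function.Injective J :=
    ((d'.equiv hx₀).symm.injective.comp (E.iota_injective x₀)).comp
      (exteriorPower.map_injective_field (d₁.equiv hx₀).injective)
  obtain ⟨q, hq⟩ := Submodule.exists_isCompl (LinearMap.range J)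
  -- The truncated subtraction in `m₂` is a true one: injectivity of `J` forces the binomial
  -- coefficient to be at most the rank of `Ẽ`.
  have hfin : Module.finrank ℝ (Fin m₂ → ℝ) = Module.finrank ℝ q := by
    have h₁ := Submodule.finrank_add_eq_of_isCompl hq
    rw [LinearMap.finrank_range_of_inj hJ, exteriorPower.finrank_eq, Subspace.dual_finrank_eq] at h₁
    simp only [Module.finrank_fintype_fun_eq_card, Fintype.card_fin, finrank_euclideanSpace, m₁, m₂] at h₁ ⊢
    omega
  have : Module.Free ℝ q := Module.Free.of_divisionRing ℝ q
  let c : (Fin m₂ → ℝ) ≃ₗ[ℝ] q := LinearEquiv.ofFinrankEq _ _ hfin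
  let β : ∀ x : E.M, ⋀[ℝ]^2 (Fin m₁ → ℝ) × (Fin m₂ → ℝ) →ₗ[ℝ] Module.Dual ℝ (E.Et.Fib x) :=
    fun x => LinearMap.coprod (E.iota x ∘ₗ exteriorPower.map 2 (d₁.frm x))
      (d'.frm x ∘ₗ q.subtype ∘ₗ c.toLinearMap)
  have hβ : ∀ u, E.Et.IsSmoothDual U fun x => β x u := by
    rintro ⟨T, p⟩
    simp only [β, LinearMap.coprod_apply]
    refine SmoothVB.IsSmoothDual.add ?_ (d'.smooth_frm _)
    -- `φ_smooth` concerns decomposable elements only, and these span `⋀²`.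
    have hT : T ∈ Submodule.span ℝ (Set.range (exteriorPower.ιMulti ℝ 2 (M := Fin m₁ → ℝ))) := by
      rw [exteriorPower.ιMulti_span]; trivial
    induction hT using Submodule.span_induction with
    | zero => simpa using E.Et.isSmoothDual_zero U
    | add s t _ _ hs ht => simpa using hs.add ht
    | smul r s _ hs =>
      have := SmoothVB.IsSmoothDual.sum_smul (s := {()}) (f := fun _ _ => r)
        (fun _ => contMDiffOn_const) fun _ : Unit => hs
      simpa using this
    | mem s hs =>
      obtain ⟨v, rfl⟩ := hs
      have e : v = ![v 0, v 1] := by ext i; fin_cases i <;> rfl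
      refine (E.φ_smooth U _ _ (d₁.smooth_frm (v 0)) (d₁.smooth_frm (v 1))).congr fun x _ => ?_
      rw [← iota_ιMulti, LinearMap.comp_apply, exteriorPower.map_apply_ιMulti]
      congr 2
  have hbij : Function.Bijective (β x₀) := by
    let Φ := ((LinearEquiv.ofInjective J hJ).prodCongr c).trans
      ((Submodule.prodEquivOfIsCompl _ _ hq).trans (d'.equiv hx₀))
    have : β x₀ = Φ.toLinearMap := by
      refine LinearMap.prod_ext ?_ ?_
      · refine LinearMap.ext fun T => ?_
        simp [β, Φ, J, d'.frm_inv x₀ hx₀]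
      · refine LinearMap.ext fun T => ?_
        simp [β, Φ]
    rw [this]
    exact Φ.bijective
  obtain ⟨U', hU', hx₀', D, hD⟩ := d'.exists_of_bijective β hβ hx₀ hbij
  refine ⟨U', hx₀', ⟨⟨d₁.restrict hU', D, fun x hx => ?_⟩⟩⟩
  rw [hD]
  refine LinearMap.ext fun T => ?_
  simp [β]
  rfl

/-! ### The local trivialization given by a frame -/

namespace Frame
variable {E} {m₁ m₂ : ℕ} {U : Opens E.M} (D : E.Frame m₁ m₂ U)

/-- The identification of the fibre of the local model with the fibre over a point. -/
def tau {x : E.M} (hx : x ∈ U) : ModelFib m₁ m₂ ≃ₐ[ℝ] E.Alg x :=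
  FibreAlg.congr _ _ (D.d₁.equiv hx) (D.dt.equiv hx) (D.compat x hx)

theorem tau_gen₁ {x : E.M} (hx : x ∈ U) (v : Fin m₁ → ℝ) :
    D.tau hx (FibreAlg.gen₁ _ v) = FibreAlg.gen₁ (E.iota x) (D.d₁.frm x v) :=
  FibreAlg.congr_gen₁ _ _ _ _ _ _

theorem tau_gen₂ {x : E.M} (hx : x ∈ U) (w) :
    D.tau hx (FibreAlg.gen₂ _ w) = FibreAlg.gen₂ (E.iota x) (D.dt.frm x w) :=
  FibreAlg.congr_gen₂ _ _ _ _ _ _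

theorem tau_symm_gen₁ {x : E.M} (hx : x ∈ U) (α : Module.Dual ℝ (E.E₁.Fib x)) :
    (D.tau hx).symm (FibreAlg.gen₁ _ α) = FibreAlg.gen₁ _ (D.d₁.inv x α) :=
  FibreAlg.congr_symm_gen₁ _ _ _ _ _ _

theorem tau_symm_gen₂ {x : E.M} (hx : x ∈ U) (β : Module.Dual ℝ (E.Et.Fib x)) :
    (D.tau hx).symm (FibreAlg.gen₂ _ β) = FibreAlg.gen₂ _ (D.dt.inv x β) :=
  FibreAlg.congr_symm_gen₂ _ _ _ _ _ _

theorem tau_mem {x : E.M} (hx : x ∈ U) {q : ℕ} {a : ModelFib m₁ m₂} :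
    D.tau hx a ∈ FibreAlg.deg (E.iota x) q ↔ a ∈ FibreAlg.deg (modelIncl m₁ m₂) q :=
  FibreAlg.congr_mem _ _ _ _ _

theorem tau_symm_mem {x : E.M} (hx : x ∈ U) {q : ℕ} {a : E.Alg x} :
    (D.tau hx).symm a ∈ FibreAlg.deg (modelIncl m₁ m₂) q ↔ a ∈ FibreAlg.deg (E.iota x) q := by
  rw [← D.tau_mem hx, AlgEquiv.apply_symm_apply]

/-- Sections of the local model as sections of the bundle of algebras. -/
def toSec {V : Opens E.M} (hV : V ≤ U) : Model E.M m₁ m₂ V →ₐ[ℝ] E.RoughSec V :=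
  AlgHom.pi fun x : V => (D.tau (hV x.2)).toAlgHom.comp (Model.ev x)

theorem toSec_apply {V : Opens E.M} (hV : V ≤ U) (t : Model E.M m₁ m₂ V) (x : V) :
    D.toSec hV t x = D.tau (hV x.2) (Model.ev x t) := rfl

theorem toSec_injective {V : Opens E.M} (hV : V ≤ U) : Function.Injective (D.toSec hV) := by
  intro s t h
  exact Model.ext_ev fun x => (D.tau (hV x.2)).injective (congrFun h x)

theorem toSec_res {V V' : Opens E.M} (hV : V ≤ U) (h : V' ≤ V) (t : Model E.M m₁ m₂ V) :
    D.toSec (h.trans hV) (Model.res m₁ m₂ h t) = E.restrict h (D.toSec hV t) := by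
  funext x
  rw [toSec_apply, Model.ev_res]
  rfl

/-- The model is spanned by products of a smooth function and a constant element. Constant elements
are polynomials in the generators, and the generators go to the sections of the frame. -/
theorem toSec_mem_polySec {V : Opens E.M} (hV : V ≤ U) (t : Model E.M m₁ m₂ V) :
    D.toSec hV t ∈ E.polySec V := by
  have hconst : ∀ b, D.toSec hV (Model.const b) ∈ E.polySec V := by
    intro b
    refine FibreAlg.mem_of_gen_mem _ ((E.polySec V).comap ((D.toSec hV).comp Model.const))
      (fun v => ?_) (fun w => ?_) b
    · refine Algebra.subset_adjoin (Or.inl (Or.inr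
        ⟨fun x => D.d₁.frm x v, (D.d₁.smooth_frm v).mono hV, funext fun x => ?_⟩))
      simp only [RingHom.coe_coe, AlgHom.comp_apply]
      rw [toSec_apply, Model.ev_const, tau_gen₁]
    · refine Algebra.subset_adjoin (Or.inr
        ⟨fun x => D.dt.frm x w, (D.dt.smooth_frm w).mono hV, funext fun x => ?_⟩)
      simp only [RingHom.coe_coe, AlgHom.comp_apply]
      rw [toSec_apply, Model.ev_const, tau_gen₂]
  have hle : Submodule.span ℝ {s : Model E.M m₁ m₂ V | ∃ f b, s = Model.single f b} ≤
      (Subalgebra.toSubmodule (E.polySec V)).comap (D.toSec hV).toLinearMap := by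
    refine Submodule.span_le.2 ?_
    rintro _ ⟨f, b, rfl⟩
    rw [SetLike.mem_coe, Submodule.mem_comap, AlgHom.toLinearMap_apply, Model.single_eq, map_mul]
    refine (E.polySec V).mul_mem (Algebra.subset_adjoin (Or.inl (Or.inl
      ⟨extendZero V f, contMDiffOn_extendZero.2 f.contMDiff, funext fun x => ?_⟩))) (hconst b)
    rw [toSec_apply, Model.ev_func, AlgEquiv.commutes, extendZero_coe]
  rw [Model.span_single] at hle
  exact hle trivial

theorem exists_toSec_eq_of_deg {V : Opens E.M} (hV : V ≤ U) {q : ℕ} {s : E.RoughSec V}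
    (hdeg : ∀ x : V, s x ∈ FibreAlg.deg (E.iota x) q)
    (hs : ∀ l : Module.Dual ℝ (ModelFib m₁ m₂),
      IsSmooth V fun x => l ((D.tau (hV x.2)).symm (s x))) :
    ∃ t ∈ Model.gr m₁ m₂ V q, D.toSec hV t = s := by
  obtain ⟨t, ht, h⟩ := Model.exists_ev_eq (b := fun x : V => (D.tau (hV x.2)).symm (s x))
    (fun x => (D.tau_symm_mem (hV x.2)).2 (hdeg x)) hs
  refine ⟨t, ht, funext fun x => ?_⟩
  rw [toSec_apply, h, AlgEquiv.apply_symm_apply]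

/-- The image of `toSec` is a subalgebra, so only the three kinds of generators have to be hit.
Sections of `E₁*` and `Ẽ*` are homogeneous with smooth coordinates in the frame. -/
theorem exists_toSec_eq {V : Opens E.M} (hV : V ≤ U) {s : E.RoughSec V} (hs : s ∈ E.polySec V) :
    ∃ t, D.toSec hV t = s := by
  have : E.polySec V ≤ (D.toSec hV).range := by
    refine Algebra.adjoin_le ?_
    rintro _ ((⟨f, hf, rfl⟩ | ⟨α, hα, rfl⟩) | ⟨β, hβ, rfl⟩)
    · refine ⟨Model.func (SmoothFun.mk _ (contMDiffOn_iff_isSmooth.1 hf)), funext fun x => ?_⟩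
      exact (congrArg (D.tau (hV x.2)) (Model.ev_func _ _)).trans (AlgEquiv.commutes _ _)
    · obtain ⟨t, -, h⟩ := D.exists_toSec_eq_of_deg hV (q := 1)
        (s := fun x : V => FibreAlg.gen₁ (E.iota x) (α x)) (fun x => FibreAlg.gen₁_mem _ _)
        (fun l => by
          simp only [tau_symm_gen₁]
          exact contMDiffOn_iff_isSmooth.1 (D.d₁.smooth_inv V hV α hα (l ∘ₗ FibreAlg.gen₁ _)))
      exact ⟨t, h⟩
    · obtain ⟨t, -, h⟩ := D.exists_toSec_eq_of_deg hV (q := 2)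
        (s := fun x : V => FibreAlg.gen₂ (E.iota x) (β x)) (fun x => FibreAlg.gen₂_mem _ _)
        (fun l => by
          simp only [tau_symm_gen₂]
          exact contMDiffOn_iff_isSmooth.1 (D.dt.smooth_inv V hV β hβ (l ∘ₗ FibreAlg.gen₂ _)))
      exact ⟨t, h⟩
  exact this hs

theorem isSmooth_of_mem_locPoly {V : Opens E.M} (hV : V ≤ U) {s : E.RoughSec V}
    (hs : s ∈ E.locPoly V) (l : Module.Dual ℝ (ModelFib m₁ m₂)) :
    IsSmooth V fun x => l ((D.tau (hV x.2)).symm (s x)) := by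
  refine isSmooth_of_locally fun x => ?_
  obtain ⟨V', hV', hx, h⟩ := hs x
  refine ⟨V', hV', hx, ?_⟩
  obtain ⟨t, ht⟩ := D.exists_toSec_eq (hV'.trans hV) h
  convert Model.isSmooth_ev l t using 2 with y
  congr 1
  rw [AlgEquiv.symm_apply_eq]
  exact (congrFun ht y).symm

/-- Smoothness of the coordinates in the frame is a local condition. Hence over a framed open set a
homogeneous, locally polynomial section comes from a single section of the model. -/
theorem exists_toSec_eq_of_mem_degSec {V : Opens E.M} (hV : V ≤ U) {q : ℕ} {s : E.RoughSec V}
    (hs : s ∈ E.degSec V q) : ∃ t ∈ Model.gr m₁ m₂ V q, D.toSec hV t = s :=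
  D.exists_toSec_eq_of_deg hV (E.mem_degSec.1 hs).2 fun l =>
    D.isSmooth_of_mem_locPoly hV (E.mem_degSec.1 hs).1 l

theorem toSec_mem_degSec {V : Opens E.M} (hV : V ≤ U) {q : ℕ} {t : Model E.M m₁ m₂ V} :
    D.toSec hV t ∈ E.degSec V q ↔ t ∈ Model.gr m₁ m₂ V q := by
  rw [E.mem_degSec, Model.mem_gr_iff]
  refine ⟨fun h x => (D.tau_mem (hV x.2)).1 (h.2 x), fun h => ⟨fun x => ⟨V, le_rfl, x.2, ?_⟩,
    fun x => (D.tau_mem (hV x.2)).2 (h x)⟩⟩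
  exact D.toSec_mem_polySec hV t

/-- Both sides consist of finite sums of homogeneous elements, so they are compared degree by
degree. A section that is merely locally polynomial may have unbounded degree, which is why `total`
appears instead of `locPoly`. -/
theorem range_toSec {V : Opens E.M} (hV : V ≤ U) (s : E.RoughSec V) :
    (∃ t, D.toSec hV t = s) ↔ s ∈ total (E.degSec V) := by
  constructor
  · rintro ⟨t, rfl⟩
    have hle : Submodule.span ℝ {s : Model E.M m₁ m₂ V | ∃ f b, s = Model.single f b} ≤
        (⨆ q, E.degSec V q).comap (D.toSec hV).toLinearMap := by
      refine Submodule.span_le.2 ?_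
      rintro _ ⟨f, b, rfl⟩
      have hb : b ∈ (⨆ q, FibreAlg.deg (modelIncl m₁ m₂) q) := by
        rw [(DirectSum.Decomposition.isInternal
          (FibreAlg.deg (modelIncl m₁ m₂))).submodule_iSup_eq_top]
        trivial
      have hle' : (⨆ q, FibreAlg.deg (modelIncl m₁ m₂) q) ≤
          (⨆ q, E.degSec V q).comap ((D.toSec hV).toLinearMap ∘ₗ Model.single f) :=
        iSup_le fun q b hb => Submodule.mem_iSup_of_mem q
          ((D.toSec_mem_degSec hV).2 (Model.single_mem f hb))
      exact hle' hb
    rw [Model.span_single] at hle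
    exact hle trivial
  · intro hs
    have : (⨆ q, E.degSec V q) ≤ LinearMap.range (D.toSec hV).toLinearMap :=
      iSup_le fun q s hs => by
        obtain ⟨t, -, h⟩ := D.exists_toSec_eq_of_mem_degSec hV hs
        exact ⟨t, h⟩
    exact this hs

/-- The sections of the structure sheaf are the sections of the local model. -/
def equivSec {V : Opens E.M} (hV : V ≤ U) : Model E.M m₁ m₂ V ≃ₐ[ℝ] E.secAlg V :=
  AlgEquiv.ofBijective ((D.toSec hV).codRestrict (total (E.degSec V))
      fun t => (D.range_toSec hV _).1 ⟨t, rfl⟩)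
    ⟨fun _ _ h => D.toSec_injective hV (congrArg Subtype.val h), fun s => by
      obtain ⟨t, h⟩ := (D.range_toSec hV s.1).2 s.2
      exact ⟨t, Subtype.ext h⟩⟩

theorem equivSec_res {V V' : Opens E.M} (hV : V ≤ U) (h : V' ≤ V) (t : Model E.M m₁ m₂ V) :
    D.equivSec (h.trans hV) (Model.res m₁ m₂ h t) =
      (ConcreteCategory.hom (E.resSec h) (D.equivSec hV t) : E.secAlg V') :=
  Subtype.ext (D.toSec_res hV h t)

/-- The local trivialization of the structure sheaf given by a frame. -/
def localTrivialization : (functorF.obj E).LocalTrivialization m₁ m₂ U where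
  iso V hV := (D.equivSec hV).symm
  mem_iff V hV q s := by
    obtain ⟨t, rfl⟩ := (D.equivSec hV).surjective s
    refine Iff.trans ?_ (Iff.of_eq (congrArg (· ∈ Model.gr m₁ m₂ V q)
      ((D.equivSec hV).symm_apply_apply t).symm))
    exact D.toSec_mem_degSec hV
  res_iso V V' hV h s := by
    obtain ⟨t, rfl⟩ := (D.equivSec hV).surjective s
    refine Eq.trans ?_ (congrArg (Model.res m₁ m₂ h) ((D.equivSec hV).symm_apply_apply t).symm)
    exact (congrArg (D.equivSec (h.trans hV)).symm (D.equivSec_res hV h t).symm).trans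
      ((D.equivSec (h.trans hV)).symm_apply_apply _)

end Frame

/-- Sections of degree `q` are functions into the fibres, restricted by conditions at points or near
points. Compatible families therefore glue pointwise, the value at `x` being taken from any member
of the cover that contains `x`. -/
theorem isSheaf_homogeneous (q : ℕ) :
    TopCat.Presheaf.IsSheaf ((functorF.obj E).sheaf ⋙ GrAlg.homogeneous q) := by
  refine TopCat.Presheaf.isSheaf_of_isSheafUniqueGluing_types _ fun ι U sf hsf => ?_
  have hcompat : ∀ i k (x : E.M) (hi : x ∈ U i) (hk : x ∈ U k),
      (sf i).1.1 ⟨x, hi⟩ = (sf k).1.1 ⟨x, hk⟩ := fun i k x hi hk =>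
    congrFun (congrArg (fun s => s.1.1) (hsf i k)) ⟨x, hi, hk⟩
  have hmem : ∀ x : (iSup U : Opens E.M), ∃ i, x.1 ∈ U i := fun x => Opens.mem_iSup.1 x.2
  choose idx hidx using hmem
  let s : E.RoughSec (iSup U) := fun x => (sf (idx x)).1.1 ⟨x.1, hidx x⟩
  have hres : ∀ i (x : E.M) (hx : x ∈ U i), s ⟨x, Opens.mem_iSup.2 ⟨i, hx⟩⟩ = (sf i).1.1 ⟨x, hx⟩ :=
    fun i x hx => hcompat _ _ _ _ _
  have hs : s ∈ E.degSec (iSup U) q := by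
    rw [mem_degSec]
    refine ⟨fun x => ?_, fun x => (E.mem_degSec.1 (sf (idx x)).2).2 ⟨x.1, hidx x⟩⟩
    obtain ⟨V, hV, hx, h⟩ := (E.mem_degSec.1 (sf (idx x)).2).1 ⟨x.1, hidx x⟩
    refine ⟨V, hV.trans (le_iSup U _), hx, ?_⟩
    convert h using 1
    exact funext fun y => hres _ _ _
  refine ⟨⟨⟨s, le_total _ hs⟩, hs⟩, fun i => ?_, fun t ht => ?_⟩
  · exact Subtype.ext (Subtype.ext (funext fun x => hres i x.1 x.2))
  · refine Subtype.ext (Subtype.ext (funext fun x => ?_))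
    exact congrFun (congrArg (fun s => s.1.1) (ht (idx x))) ⟨x.1, hidx x⟩

theorem isDegreeTwo_obj : isDegreeTwo (functorF.obj E) where
  isSheaf := E.isSheaf_homogeneous
  locallyTrivial := ⟨_, _, fun x => by
    obtain ⟨U, hx, ⟨D⟩⟩ := E.exists_frame x
    exact ⟨U, hx, ⟨D.localTrivialization⟩⟩⟩

end VB2

/-! ### Compatible characters of the local model -/

namespace Model
variable {M : Mfd} {m₁ m₂ : ℕ} {V : Opens M}

theorem res_func {V' : Opens M} (h : V' ≤ V) (f : SmoothFun M V) :
    Model.res m₁ m₂ h (func f) = func (smoothRes h f) :=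
  ext_ev fun x => by rw [ev_res, ev_func, ev_func]; rfl

theorem res_const {V' : Opens M} (h : V' ≤ V) (b : ModelFib m₁ m₂) :
    Model.res m₁ m₂ h (const b) = const b :=
  ext_ev fun x => by rw [ev_res, ev_const, ev_const]

/-- A compatible family of algebra maps on the sections of the local model near a point which maps
functions to scalars depends only on the value at the point. -/
theorem exists_factor {U₀ : Opens M} {y : M} (hy₀ : y ∈ U₀) {R : Type} [Ring R] [Algebra ℝ R]
    (ε : R →ₐ[ℝ] ℝ) (χ : ∀ V : Opens M, V ≤ U₀ → y ∈ V → Model M m₁ m₂ V →ₐ[ℝ] R)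
    (hχ : ∀ (V V' : Opens M) (h : V' ≤ V) (hV : V ≤ U₀) (hy : y ∈ V') (t : Model M m₁ m₂ V),
      χ V' (h.trans hV) hy (Model.res m₁ m₂ h t) = χ V hV (h hy) t)
    (hfun : ∀ (V : Opens M) (hV : V ≤ U₀) (hy : y ∈ V) (f : SmoothFun M V),
      ∃ r : ℝ, χ V hV hy (func f) = algebraMap ℝ R r) :
    ∃ B : ModelFib m₁ m₂ →ₐ[ℝ] R, (∀ b, B b = χ U₀ le_rfl hy₀ (const b)) ∧
      ∀ (V : Opens M) (hV : V ≤ U₀) (hy : y ∈ V) (t : Model M m₁ m₂ V),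
        χ V hV hy t = B (ev ⟨y, hy⟩ t) := by
  refine ⟨(χ U₀ le_rfl hy₀).comp const, fun _ => rfl, fun V hV hy t => ?_⟩
  -- Composing with `ε` makes the restriction to functions a compatible family of characters, hence
  -- evaluation at `y`. Nothing is lost, as the values were scalars before `ε` was applied.
  have hchar : ∀ (V : Opens M) (hV : V ≤ U₀) (hy : y ∈ V) (f : SmoothFun M V),
      χ V hV hy (func f) = algebraMap ℝ R (f ⟨y, hy⟩) := by
    intro V hV hy f
    have := character_eq_eval (y := y) (fun V hV hy => ε.comp ((χ V hV hy).comp func))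
      (fun V V' h hV hy f => by
        simp only [AlgHom.comp_apply]
        rw [← res_func, hχ V V' h hV hy]) V hV hy f
    obtain ⟨r, hr⟩ := hfun V hV hy f
    simp only [AlgHom.comp_apply, hr, AlgHom.commutes, Algebra.algebraMap_self_apply] at this
    rw [hr, this]
  have ht : t ∈ Submodule.span ℝ {s : Model M m₁ m₂ V | ∃ f b, s = Model.single f b} := by
    rw [span_single]; trivial
  induction ht using Submodule.span_induction with
  | zero => simp
  | add s t _ _ hs ht => rw [map_add, map_add, map_add, hs, ht]
  | smul r s _ hs => rw [map_smul, map_smul, map_smul, hs]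
  | mem s hs =>
    obtain ⟨f, b, rfl⟩ := hs
    rw [single_eq, map_mul, hchar, map_mul, map_mul, ev_func, AlgHom.commutes, ev_const,
      AlgHom.comp_apply, ← res_const hV b, hχ U₀ V hV le_rfl hy]

end Model

/-! ### Duality for bundle maps -/

/-- Reflexivity of the finite-dimensional space `W`: the bidual of `V` maps to `W`, and `V` maps to
its bidual. -/
theorem exists_transpose {V W : Type} [AddCommGroup V] [Module ℝ V] [AddCommGroup W] [Module ℝ W]
    [Module.Finite ℝ W] (L : Module.Dual ℝ W →ₗ[ℝ] Module.Dual ℝ V) :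
    ∃ g : V →ₗ[ℝ] W, ∀ w : Module.Dual ℝ W, w ∘ₗ g = L w := by
  refine ⟨(Module.evalEquiv ℝ W).symm.toLinearMap ∘ₗ L.dualMap ∘ₗ Module.Dual.eval ℝ V,
    fun w => LinearMap.ext fun v => ?_⟩
  simp

theorem pairingDual_map {V W : Type} [AddCommGroup V] [Module ℝ V] [AddCommGroup W] [Module ℝ W]
    (g : V →ₗ[ℝ] W) (α β : Module.Dual ℝ W) (T : ⋀[ℝ]^2 V) :
    exteriorPower.pairingDual ℝ W 2 (exteriorPower.ιMulti ℝ 2 ![α, β]) (exteriorPower.map 2 g T) =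
      exteriorPower.pairingDual ℝ V 2 (exteriorPower.ιMulti ℝ 2 ![α ∘ₗ g, β ∘ₗ g]) T := by
  suffices exteriorPower.pairingDual ℝ _ 2 (exteriorPower.ιMulti ℝ 2 ![α, β]) ∘ₗ
      exteriorPower.map 2 g = exteriorPower.pairingDual ℝ _ 2
        (exteriorPower.ιMulti ℝ 2 ![α ∘ₗ g, β ∘ₗ g]) from LinearMap.congr_fun this T
  apply exteriorPower.linearMap_ext
  ext v
  simp only [LinearMap.compAlternatingMap_apply, LinearMap.comp_apply,
    exteriorPower.map_apply_ιMulti, exteriorPower.pairingDual_ιMulti_ιMulti]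
  congr 1
  ext i k
  fin_cases k <;> rfl

/-- Every functional on `⋀² V` is a pairing with an element of `⋀² V*`, and elements `α ∧ β` span
the latter. -/
theorem exteriorPower_two_ext {V : Type} [AddCommGroup V] [Module ℝ V] [Module.Finite ℝ V]
    {S T : ⋀[ℝ]^2 V} (h : ∀ α β : Module.Dual ℝ V,
      exteriorPower.pairingDual ℝ V 2 (exteriorPower.ιMulti ℝ 2 ![α, β]) S =
      exteriorPower.pairingDual ℝ V 2 (exteriorPower.ιMulti ℝ 2 ![α, β]) T) : S = T := by
  rw [← sub_eq_zero]
  refine (Module.forall_dual_apply_eq_zero_iff ℝ _).1 fun f => ?_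
  obtain ⟨ξ, rfl⟩ := (pairingDual_bijective V 2).2 f
  rw [map_sub, sub_eq_zero]
  have : (exteriorPower.pairingDual ℝ V 2).flip S = (exteriorPower.pairingDual ℝ V 2).flip T := by
    refine LinearMap.ext_on_range (exteriorPower.ιMulti_span ℝ 2 _) fun v => ?_
    have e : v = ![v 0, v 1] := by ext1 i; fin_cases i <;> rfl
    rw [e]
    exact h _ _
  exact LinearMap.congr_fun this ξ

namespace SmoothVB

/-- A family of linear maps over a smooth map is smooth if it pulls back smooth sections of the dual
bundle to smooth sections. -/
theorem contMDiff_of_pullback {M N : Mfd} {E : SmoothVB M} {F : SmoothVB N} {ψ : M → N}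
    (hψ : ContMDiff (𝓡 M.dim) (𝓡 N.dim) ∞ ψ) (g : ∀ x : M, E.Fib x →ₗ[ℝ] F.Fib (ψ x))
    (h : ∀ (U : Opens N) (α : ∀ y : N, Module.Dual ℝ (F.Fib y)), F.IsSmoothDual U α →
      E.IsSmoothDual ⟨ψ ⁻¹' U, U.2.preimage hψ.continuous⟩ fun x => α (ψ x) ∘ₗ g x) :
    ContMDiff E.totalModel F.totalModel ∞
      (fun p : E.Total => (⟨ψ p.proj, g p.proj p.snd⟩ : F.Total)) := by
  intro p
  let e := trivializationAt (EuclideanSpace ℝ (Fin F.rank)) F.Fib (ψ p.proj)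
  have hp : ψ p.proj ∈ F.trivSet (ψ p.proj) := F.mem_trivSet _
  have hs : (⟨ψ p.proj, g p.proj p.snd⟩ : F.Total) ∈ e.source := e.mem_source.2 hp
  refine (e.contMDiffAt_iff (f := fun p : E.Total => (⟨ψ p.proj, g p.proj p.snd⟩ : F.Total)) hs).2
    ⟨(hψ.comp (Bundle.contMDiff_proj E.Fib)) p, ?_⟩
  let b := Module.finBasis ℝ (EuclideanSpace ℝ (Fin F.rank))
  have ho : IsOpen {p' : E.Total | ψ p'.proj ∈ F.trivSet (ψ p.proj)} :=
    (F.trivSet (ψ p.proj)).2.preimage (hψ.continuous.comp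
      (FiberBundle.continuous_proj (EuclideanSpace ℝ (Fin E.rank)) E.Fib))
  -- The fibre coordinates of the map in the trivialization at `ψ p` are the pullbacks of the
  -- coordinate sections of the dual bundle, which are smooth by hypothesis.
  have key : ContMDiffOn E.totalModel 𝓘(ℝ, EuclideanSpace ℝ (Fin F.rank)) ∞
      (fun p' : E.Total => ∑ i, ((F.trivFrame (ψ p.proj)).frm (ψ p'.proj) (b.coord i) ∘ₗ
        g p'.proj) p'.snd • b i) {p' : E.Total | ψ p'.proj ∈ F.trivSet (ψ p.proj)} :=
    contMDiffOn_finsetSum fun i _ => ContMDiffOn.smul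
      (h _ _ ((F.trivFrame (ψ p.proj)).smooth_frm (b.coord i))) contMDiffOn_const
  refine (key.congr fun p' hp' => ?_).contMDiffAt (ho.mem_nhds hp)
  refine (b.sum_repr _).symm.trans (Finset.sum_congr rfl fun i _ => ?_)
  congr 1
  change _ = b.coord i (e.linearMapAt ℝ _ _)
  rw [Bundle.Trivialization.coe_linearMapAt_of_mem _ hp']
  rfl

end SmoothVB

/-! ### Homogeneous sections of low degree -/

namespace VB2
variable (E : VB2)

/-- A frame near `x` carries the claim to the split model. Together with `exists_of_mem_deg_one`
this identifies the degree one part of the fibre with the dual of the fibre of `E₁`. -/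
theorem gen₁_injective (x : E.M) : Function.Injective (FibreAlg.gen₁ (E.iota x)) := by
  obtain ⟨U, hx, ⟨D⟩⟩ := E.exists_frame x
  intro α β h
  have := congrArg (D.tau hx).symm h
  rw [D.tau_symm_gen₁, D.tau_symm_gen₁] at this
  exact (D.d₁.equiv hx).symm.injective (FibreAlg.split_gen₁_injective _ _ this)

theorem gen₂_injective (x : E.M) : Function.Injective (FibreAlg.gen₂ (E.iota x)) := by
  obtain ⟨U, hx, ⟨D⟩⟩ := E.exists_frame x
  intro α β h
  have := congrArg (D.tau hx).symm h
  rw [D.tau_symm_gen₂, D.tau_symm_gen₂] at this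
  exact (D.dt.equiv hx).symm.injective (FibreAlg.split_gen₂_injective _ _ this)

theorem polySec_le_locPoly (U : Opens E.M) : E.polySec U ≤ E.locPoly U :=
  fun _ hs x => ⟨U, le_rfl, x.2, hs⟩

variable {E}

theorem dual₁_mem_degSec {U : Opens E.M} {α : ∀ x : E.M, Module.Dual ℝ (E.E₁.Fib x)}
    (hα : E.E₁.IsSmoothDual U α) :
    (fun x : U => FibreAlg.gen₁ (E.iota x) (α x)) ∈ E.degSec U 1 :=
  E.mem_degSec.2 ⟨E.polySec_le_locPoly U (Algebra.subset_adjoin (Or.inl (Or.inr ⟨α, hα, rfl⟩))),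
    fun _ => FibreAlg.gen₁_mem _ _⟩

theorem dualt_mem_degSec {U : Opens E.M} {β : ∀ x : E.M, Module.Dual ℝ (E.Et.Fib x)}
    (hβ : E.Et.IsSmoothDual U β) :
    (fun x : U => FibreAlg.gen₂ (E.iota x) (β x)) ∈ E.degSec U 2 :=
  E.mem_degSec.2 ⟨E.polySec_le_locPoly U (Algebra.subset_adjoin (Or.inr ⟨β, hβ, rfl⟩)),
    fun _ => FibreAlg.gen₂_mem _ _⟩

/-- A left inverse `γ` of the generator map of the model expresses each coordinate of `α` in a frame
as a functional of the algebra-valued section, and such functionals vary smoothly. -/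
theorem isSmoothDual_of_gen₁_mem {U : Opens E.M} {α : ∀ x : E.M, Module.Dual ℝ (E.E₁.Fib x)}
    (h : (fun x : U => FibreAlg.gen₁ (E.iota x) (α x)) ∈ E.degSec U 1) :
    E.E₁.IsSmoothDual U α := by
  refine SmoothVB.IsSmoothDual.of_locally fun x hx => ?_
  obtain ⟨W, hxW, ⟨D⟩⟩ := E.exists_frame x
  refine ⟨U ⊓ W, ⟨hx, hxW⟩, α, ?_, fun _ _ => rfl⟩
  obtain ⟨γ, hγ⟩ := (FibreAlg.gen₁ (modelIncl E.E₁.rank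
    (E.Et.rank - E.E₁.rank.choose 2))).exists_leftInverse_of_injective
      (LinearMap.ker_eq_bot.2 (FibreAlg.split_gen₁_injective _ _))
  refine D.d₁.isSmoothDual_of_coord inf_le_right fun l => contMDiffOn_iff_isSmooth.2 ?_
  have := D.isSmooth_of_mem_locPoly (inf_le_right : U ⊓ W ≤ W)
    (E.mem_degSec.1 (E.restrict_degSec (inf_le_left : U ⊓ W ≤ U) _ _ h)).1 (l ∘ₗ γ)
  convert this using 2 with y
  refine congrArg l (Eq.trans (LinearMap.congr_fun hγ _).symm (congrArg γ ?_))
  exact (D.tau_symm_gen₁ y.2.2 (α y)).symm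

theorem isSmoothDual_of_gen₂_mem {U : Opens E.M} {β : ∀ x : E.M, Module.Dual ℝ (E.Et.Fib x)}
    (h : (fun x : U => FibreAlg.gen₂ (E.iota x) (β x)) ∈ E.degSec U 2) :
    E.Et.IsSmoothDual U β := by
  refine SmoothVB.IsSmoothDual.of_locally fun x hx => ?_
  obtain ⟨W, hxW, ⟨D⟩⟩ := E.exists_frame x
  refine ⟨U ⊓ W, ⟨hx, hxW⟩, β, ?_, fun _ _ => rfl⟩
  obtain ⟨γ, hγ⟩ := (FibreAlg.gen₂ (modelIncl E.E₁.rank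
    (E.Et.rank - E.E₁.rank.choose 2))).exists_leftInverse_of_injective
      (LinearMap.ker_eq_bot.2 (FibreAlg.split_gen₂_injective _ _))
  refine D.dt.isSmoothDual_of_coord inf_le_right fun l => contMDiffOn_iff_isSmooth.2 ?_
  have := D.isSmooth_of_mem_locPoly (inf_le_right : U ⊓ W ≤ W)
    (E.mem_degSec.1 (E.restrict_degSec (inf_le_left : U ⊓ W ≤ U) _ _ h)).1 (l ∘ₗ γ)
  convert this using 2 with y
  refine congrArg l (Eq.trans (LinearMap.congr_fun hγ _).symm (congrArg γ ?_))
  exact (D.tau_symm_gen₂ y.2.2 (β y)).symm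

variable (E) in
theorem exists_dual₁ (x : E.M) (w : Module.Dual ℝ (E.E₁.Fib x)) : ∃ U : Opens E.M, x ∈ U ∧
    ∃ α, E.E₁.IsSmoothDual U α ∧ α x = w :=
  ⟨_, E.E₁.mem_trivSet x, _, (E.E₁.trivFrame x).smooth_frm ((E.E₁.trivFrame x).inv x w),
    (E.E₁.trivFrame x).frm_inv x (E.E₁.mem_trivSet x) w⟩

variable (E) in
theorem exists_dualt (x : E.M) (w : Module.Dual ℝ (E.Et.Fib x)) : ∃ U : Opens E.M, x ∈ U ∧
    ∃ β, E.Et.IsSmoothDual U β ∧ β x = w :=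
  ⟨_, E.Et.mem_trivSet x, _, (E.Et.trivFrame x).smooth_frm ((E.Et.trivFrame x).inv x w),
    (E.Et.trivFrame x).frm_inv x (E.Et.mem_trivSet x) w⟩

end VB2

/-! ### The functor is fully faithful -/

/-- The algebra map underlying a morphism of graded algebras. -/
def GrAlg.algHom {A B : GrAlg} (f : A ⟶ B) : A →ₐ[ℝ] B :=
  GradedAlgHom.toAlgHom (f : A.gr →ₐᵍ[ℝ] B.gr)

theorem GrAlg.algHom_mem {A B : GrAlg} (f : A ⟶ B) {q : ℕ} {a : A} (ha : a ∈ A.gr q) :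
    GrAlg.algHom f a ∈ B.gr q :=
  GradedAlgHom.map_mem (f : A.gr →ₐᵍ[ℝ] B.gr) ha

theorem GrAlg.hom_ext {A B : GrAlg} {f g : A ⟶ B} (h : ∀ a, GrAlg.algHom f a = GrAlg.algHom g a) :
    f = g :=
  GradedAlgHom.coe_fn_injective (funext h : (f : A.gr →ₐᵍ[ℝ] B.gr).toFun = _)

/-! ### Faithfulness, by comparison of values at points -/

namespace VB2
variable {E F : VB2}

/-- The value at a point of the pullback of a section along a morphism of graded spaces. -/
def pullVal (h : functorF.obj E ⟶ functorF.obj F) (U : Opens F.M) (s : F.secAlg U) (x : E.M)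
    (hx : h.hom.base x ∈ U) : E.Alg x :=
  (GrAlg.algHom (h.hom.c.app (Opposite.op U)) s : E.secAlg _).1 ⟨x, hx⟩

/-- The open set over which a pullback lives depends on the base map. Values at points, with both
memberships as hypotheses, can be compared without identifying the two open sets. -/
theorem pullVal_congr {h h' : functorF.obj E ⟶ functorF.obj F} (e : h = h') (U : Opens F.M)
    (s : F.secAlg U) (x : E.M) (hx : h.hom.base x ∈ U) (hx' : h'.hom.base x ∈ U) :
    pullVal h U s x hx = pullVal h' U s x hx' := by
  subst e; rfl

/-- Equal morphisms pull sections back to equal values. Each covector at `b x` extends to a smooth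
local section, so the transposes of the bundle maps agree on all covectors by injectivity of the
generators. -/
theorem functorF_map_injective {f g : E ⟶ F} (h : functorF.map f = functorF.map g) : f = g := by
  have hb : f.base = g.base := congrArg (fun (k : functorF.obj E ⟶ functorF.obj F) (x : E.M) =>
    (k.hom.base x : F.M)) h
  have key : ∀ (U : Opens F.M) (s : F.secAlg U) (x : E.M) (hx : f.base x ∈ U)
      (hx' : g.base x ∈ U), algPull f x (s.1 ⟨f.base x, hx⟩) = algPull g x (s.1 ⟨g.base x, hx'⟩) :=
    fun U s x hx hx' => pullVal_congr h U s x hx hx'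
  obtain ⟨b, hb₁, ⟨f₁, hf₁⟩, ⟨ft, hft⟩, hf⟩ := f
  obtain ⟨b', hb₂, ⟨g₁, hg₁⟩, ⟨gt, hgt⟩, hg⟩ := g
  obtain rfl : b = b' := hb
  obtain rfl : f₁ = g₁ := by
    refine funext fun x => LinearMap.ext fun v => ?_
    rw [← sub_eq_zero]
    refine (Module.forall_dual_apply_eq_zero_iff ℝ _).1 fun w => ?_
    obtain ⟨U, hU, α, hα, rfl⟩ := F.exists_dual₁ (b x) w
    have := key U ⟨_, le_total _ (dual₁_mem_degSec hα)⟩ x hU hU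
    replace this := (algPull_gen₁ _ x _).symm.trans (this.trans (algPull_gen₁ _ x _))
    rw [map_sub, sub_eq_zero]
    exact LinearMap.congr_fun (E.gen₁_injective x this) v
  obtain rfl : ft = gt := by
    refine funext fun x => LinearMap.ext fun v => ?_
    rw [← sub_eq_zero]
    refine (Module.forall_dual_apply_eq_zero_iff ℝ _).1 fun w => ?_
    obtain ⟨U, hU, α, hα, rfl⟩ := F.exists_dualt (b x) w
    have := key U ⟨_, le_total _ (dualt_mem_degSec hα)⟩ x hU hU
    replace this := (algPull_gen₂ _ x _).symm.trans (this.trans (algPull_gen₂ _ x _))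
    rw [map_sub, sub_eq_zero]
    exact LinearMap.congr_fun (E.gen₂_injective x this) v
  rfl

/-! ### From a morphism of sheaves to algebra maps of fibres -/

section Full
variable (ψ : E.M → F.M) (hψ : ContMDiff (𝓡 E.M.dim) (𝓡 F.M.dim) ∞ ψ)
  (app : ∀ U : Opens F.M, F.secAlg U ⟶ E.secAlg ⟨ψ ⁻¹' U, U.2.preimage hψ.continuous⟩)

/-- A morphism of the structure sheaves is given by algebra maps of the fibres. -/
theorem exists_fibre_map
    (nat : ∀ {V U : Opens F.M} (h : V ≤ U), F.resSec h ≫ app V = app U ≫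
      E.resSec (V := ⟨ψ ⁻¹' V, V.2.preimage hψ.continuous⟩)
        (U := ⟨ψ ⁻¹' U, U.2.preimage hψ.continuous⟩) fun _ hx => h hx)
    (x : E.M) : ∃ A : F.Alg (ψ x) →ₐ[ℝ] E.Alg x,
    (∀ q a, a ∈ FibreAlg.deg (F.iota (ψ x)) q → A a ∈ FibreAlg.deg (E.iota x) q) ∧
    ∀ (U : Opens F.M) (hx : ψ x ∈ U) (s : F.secAlg U),
      (GrAlg.algHom (app U) s : E.secAlg _).1 ⟨x, hx⟩ = A (s.1 ⟨ψ x, hx⟩) := by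
  obtain ⟨U₀, hU₀, ⟨D⟩⟩ := F.exists_frame (ψ x)
  -- Read a section of the model as a section of the structure sheaf of `F`, pull it back, and
  -- evaluate at `x`.
  let χ : ∀ V : Opens F.M, V ≤ U₀ → ψ x ∈ V →
      Model F.M F.E₁.rank (F.Et.rank - F.E₁.rank.choose 2) V →ₐ[ℝ] E.Alg x := fun V hV hx =>
    (E.eval (U := ⟨ψ ⁻¹' V, V.2.preimage hψ.continuous⟩) ⟨x, hx⟩).comp
      ((total (E.degSec ⟨ψ ⁻¹' V, V.2.preimage hψ.continuous⟩)).val.comp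
        ((GrAlg.algHom (app V)).comp (D.equivSec hV).toAlgHom))
  have hnat : ∀ {V U : Opens F.M} (h : V ≤ U) (hx : ψ x ∈ V) (s : F.secAlg U),
      (GrAlg.algHom (app V) (GrAlg.algHom (F.resSec h) s) : E.secAlg _).1 ⟨x, hx⟩ =
        (GrAlg.algHom (app U) s : E.secAlg _).1 ⟨x, h hx⟩ := fun {V U} h hx s =>
    congrArg (fun k : F.secAlg U ⟶ E.secAlg ⟨ψ ⁻¹' V, V.2.preimage hψ.continuous⟩ =>
      (GrAlg.algHom k s : E.secAlg _).1 ⟨x, hx⟩) (nat h)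
  have hdeg : ∀ V hV hx q t, t ∈ Model.gr _ _ V q → χ V hV hx t ∈ FibreAlg.deg (E.iota x) q :=
    fun V hV hx q t ht => (E.mem_degSec.1 (GrAlg.algHom_mem (app V)
      (a := D.equivSec hV t) ((D.toSec_mem_degSec hV).2 ht))).2 ⟨x, hx⟩
  obtain ⟨B, hB, hχ⟩ := Model.exists_factor hU₀ (FibreAlg.aug (E.iota x)) χ
    (fun V V' h hV hy t => by
      refine Eq.trans ?_ (hnat h hy (D.equivSec hV t))
      exact congrArg (fun s : F.secAlg V' => (GrAlg.algHom (app V') s : E.secAlg _).1 ⟨x, hy⟩)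
        (D.equivSec_res hV h t))
    -- Functions have degree zero, and the degree zero part of the fibre over `x` consists of
    -- scalars.
    (fun V hV hy f => FibreAlg.exists_of_mem_deg_zero _ (hdeg V hV hy 0 _ (by
      rw [Model.mem_gr_iff]
      intro y
      rw [Model.ev_func, Algebra.algebraMap_eq_smul_one]
      exact Submodule.smul_mem _ _ SetLike.GradedOne.one_mem)))
  refine ⟨B.comp (D.tau hU₀).symm.toAlgHom, fun q a ha => ?_, fun U hx s => ?_⟩
  · have := hdeg U₀ le_rfl hU₀ q (Model.const ((D.tau hU₀).symm a)) (by
      rw [Model.mem_gr_iff]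
      intro y
      rw [Model.ev_const]
      exact (D.tau_symm_mem hU₀).2 ha)
    rw [← hB] at this
    exact this
  -- A section over an arbitrary `U` is first restricted to the framed set `U ⊓ U₀`, where it comes
  -- from the model.
  · have hle : U ⊓ U₀ ≤ U := inf_le_left
    have hx' : ψ x ∈ U ⊓ U₀ := ⟨hx, hU₀⟩
    obtain ⟨t, ht⟩ := (D.equivSec inf_le_right).surjective (GrAlg.algHom (F.resSec hle) s)
    refine (hnat hle hx' s).symm.trans ?_
    rw [← ht]
    refine (hχ (U ⊓ U₀) inf_le_right hx' t).trans (congrArg B ?_)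
    have h₁ : D.tau hU₀ (Model.ev ⟨ψ x, hx'⟩ t) = s.1 ⟨ψ x, hx⟩ :=
      congrArg (fun s : F.secAlg (U ⊓ U₀) => s.1 ⟨ψ x, hx'⟩) ht
    rw [← h₁]
    exact ((D.tau hU₀).symm_apply_apply _).symm

end Full

theorem eq_algPull (f : E ⟶ F) (x : E.M) (A : F.Alg (f.base x) →ₐ[ℝ] E.Alg x)
    (h₁ : ∀ w, A (FibreAlg.gen₁ _ w) = FibreAlg.gen₁ (E.iota x) (w ∘ₗ f.map₁.map x))
    (h₂ : ∀ w, A (FibreAlg.gen₂ _ w) = FibreAlg.gen₂ (E.iota x) (w ∘ₗ f.mapt.map x)) :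
    A = algPull f x :=
  FibreAlg.algHom_ext _ (fun w => (h₁ w).trans (algPull_gen₁ f x w).symm)
    fun w => (h₂ w).trans (algPull_gen₂ f x w).symm

/-! ### From algebra maps of fibres to bundle maps -/

section Full
variable (ψ : E.M → F.M) (hψ : ContMDiff (𝓡 E.M.dim) (𝓡 F.M.dim) ∞ ψ)
  (app : ∀ U : Opens F.M, F.secAlg U ⟶ E.secAlg ⟨ψ ⁻¹' U, U.2.preimage hψ.continuous⟩)

/-- The fibre maps preserve degrees one and two, where the fibre algebras are the duals of the
fibres of the two bundles. Transposing gives `g₁` and `gt`, and these determine the fibre maps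
because the generators generate. -/
theorem exists_hom
    (nat : ∀ {V U : Opens F.M} (h : V ≤ U), F.resSec h ≫ app V = app U ≫
      E.resSec (V := ⟨ψ ⁻¹' V, V.2.preimage hψ.continuous⟩)
        (U := ⟨ψ ⁻¹' U, U.2.preimage hψ.continuous⟩) fun _ hx => h hx) :
    ∃ f : E ⟶ F, f.base = ψ ∧ ∀ (U : Opens F.M) (x : E.M) (hx : ψ x ∈ U)
    (hx' : f.base x ∈ U) (s : F.secAlg U),
      (GrAlg.algHom (app U) s : E.secAlg _).1 ⟨x, hx⟩ = algPull f x (s.1 ⟨f.base x, hx'⟩) := by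
  choose A hdeg hA using exists_fibre_map ψ hψ app nat
  choose γ₁ hγ₁ using fun x => (FibreAlg.gen₁ (E.iota x)).exists_leftInverse_of_injective
    (LinearMap.ker_eq_bot.2 (E.gen₁_injective x))
  choose γ₂ hγ₂ using fun x => (FibreAlg.gen₂ (E.iota x)).exists_leftInverse_of_injective
    (LinearMap.ker_eq_bot.2 (E.gen₂_injective x))
  choose g₁ hg₁ using fun x => exists_transpose
    (γ₁ x ∘ₗ (A x).toLinearMap ∘ₗ FibreAlg.gen₁ (F.iota (ψ x)))
  choose gt hgt using fun x => exists_transpose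
    (γ₂ x ∘ₗ (A x).toLinearMap ∘ₗ FibreAlg.gen₂ (F.iota (ψ x)))
  have hA₁ : ∀ x w, A x (FibreAlg.gen₁ _ w) = FibreAlg.gen₁ (E.iota x) (w ∘ₗ g₁ x) := by
    intro x w
    obtain ⟨v, hv⟩ := FibreAlg.exists_of_mem_deg_one _ (hdeg x 1 _ (FibreAlg.gen₁_mem _ w))
    rw [hv, hg₁]
    simp only [LinearMap.comp_apply, AlgHom.toLinearMap_apply, hv]
    exact congrArg _ (LinearMap.congr_fun (hγ₁ x) v).symm
  have hA₂ : ∀ x w, A x (FibreAlg.gen₂ _ w) = FibreAlg.gen₂ (E.iota x) (w ∘ₗ gt x) := by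
    intro x w
    obtain ⟨v, hv⟩ := FibreAlg.exists_of_mem_deg_two _ (hdeg x 2 _ (FibreAlg.gen₂_mem _ w))
    rw [hv, hgt]
    simp only [LinearMap.comp_apply, AlgHom.toLinearMap_apply, hv]
    exact congrArg _ (LinearMap.congr_fun (hγ₂ x) v).symm
  -- Applying `A x` to the relation between `α β` and the image of `α ∧ β` in degree two gives the
  -- compatibility after pairing with `α ∧ β`; such pairings separate the points of `⋀²`.
  have hcompat : ∀ x, exteriorPower.map 2 (g₁ x) ∘ₗ E.φ x = F.φ (ψ x) ∘ₗ gt x := by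
    refine fun x => LinearMap.ext fun v => exteriorPower_two_ext fun α β => ?_
    have h := congrArg (A x) (FibreAlg.gen₁_mul_gen₁ (F.iota (ψ x)) α β)
    rw [map_mul, hA₁, hA₁, hA₂, FibreAlg.gen₁_mul_gen₁] at h
    have h' := LinearMap.congr_fun (E.gen₂_injective x h) v
    simp only [iota_ιMulti, LinearMap.comp_apply] at h' ⊢
    rw [pairingDual_map]
    exact h'
  -- The pullback of a smooth section of `F₁*` is a degree one section of the structure sheaf of
  -- `E`, and by `isSmoothDual_of_gen₁_mem` its coefficient is smooth.
  have hsm₁ : ∀ (U : Opens F.M) (α : ∀ y : F.M, Module.Dual ℝ (F.E₁.Fib y)),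
      F.E₁.IsSmoothDual U α → E.E₁.IsSmoothDual ⟨ψ ⁻¹' U, U.2.preimage hψ.continuous⟩
        fun x => α (ψ x) ∘ₗ g₁ x := by
    intro U α hα
    refine isSmoothDual_of_gen₁_mem ?_
    have h := GrAlg.algHom_mem (app U) (q := 1)
      (a := (⟨_, le_total _ (dual₁_mem_degSec hα)⟩ : F.secAlg U)) (dual₁_mem_degSec hα)
    have h' : (GrAlg.algHom (app U) ⟨_, le_total _ (dual₁_mem_degSec hα)⟩ : E.secAlg _).1 =
        fun x : (⟨ψ ⁻¹' U, U.2.preimage hψ.continuous⟩ : Opens E.M) =>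
          FibreAlg.gen₁ (E.iota x.1) (α (ψ x.1) ∘ₗ g₁ x.1) :=
      funext fun x => (hA x.1 U x.2 _).trans (hA₁ x.1 _)
    rw [← h']
    exact h
  have hsm₂ : ∀ (U : Opens F.M) (β : ∀ y : F.M, Module.Dual ℝ (F.Et.Fib y)),
      F.Et.IsSmoothDual U β → E.Et.IsSmoothDual ⟨ψ ⁻¹' U, U.2.preimage hψ.continuous⟩
        fun x => β (ψ x) ∘ₗ gt x := by
    intro U β hβ
    refine isSmoothDual_of_gen₂_mem ?_
    have h := GrAlg.algHom_mem (app U) (q := 2)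
      (a := (⟨_, le_total _ (dualt_mem_degSec hβ)⟩ : F.secAlg U)) (dualt_mem_degSec hβ)
    have h' : (GrAlg.algHom (app U) ⟨_, le_total _ (dualt_mem_degSec hβ)⟩ : E.secAlg _).1 =
        fun x : (⟨ψ ⁻¹' U, U.2.preimage hψ.continuous⟩ : Opens E.M) =>
          FibreAlg.gen₂ (E.iota x.1) (β (ψ x.1) ∘ₗ gt x.1) :=
      funext fun x => (hA x.1 U x.2 _).trans (hA₂ x.1 _)
    rw [← h']
    exact h
  let f : E ⟶ F := Hom.mk ψ hψ ⟨g₁, SmoothVB.contMDiff_of_pullback hψ g₁ hsm₁⟩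
    ⟨gt, SmoothVB.contMDiff_of_pullback hψ gt hsm₂⟩ hcompat
  have hf : ∀ x, A x = algPull f x := fun x => eq_algPull f x (A x) (hA₁ x) (hA₂ x)
  exact ⟨f, rfl, fun U x hx hx' s =>
    (hA x U hx s).trans (AlgHom.congr_fun (hf x) (s.1 ⟨ψ x, hx⟩))⟩

end Full

theorem map_eq_of_forall (f : E ⟶ F) (h : functorF.obj E ⟶ functorF.obj F)
    (hb : f.base = fun x => h.hom.base x)
    (hs : ∀ (U : Opens F.M) (s : F.secAlg U) (x : E.M) (hx : h.hom.base x ∈ U)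
      (hx' : f.base x ∈ U), algPull f x (s.1 ⟨f.base x, hx'⟩) = pullVal h U s x hx) :
    functorF.map f = h := by
  obtain ⟨⟨⟨⟨b, hc⟩⟩, c⟩, hsm⟩ := h
  obtain ⟨b', hbf, f₁, ft, hc'⟩ := f
  obtain rfl : b' = b := hb
  refine congrArg (fun c => GradedSpace.Hom.mk (X := functorF.obj E) (Y := functorF.obj F)
    ⟨TopCat.ofHom ⟨b', hc⟩, c⟩ hsm) (NatTrans.ext (funext fun U => ?_))
  exact GrAlg.hom_ext fun s => Subtype.ext (funext fun x => hs U.unop s x.1 x.2 x.2)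

theorem functorF_map_surjective (h : functorF.obj E ⟶ functorF.obj F) :
    ∃ f : E ⟶ F, functorF.map f = h := by
  obtain ⟨f, hf, hs⟩ := exists_hom (E := E) (F := F) (fun x => h.hom.base x) h.smooth
    (fun U => h.hom.c.app (Opposite.op U)) (fun e => h.hom.c.naturality (homOfLE e).op)
  exact ⟨f, map_eq_of_forall f h hf fun U s x hx hx' => (hs U x hx hx' s).symm⟩

end VB2

instance : functorF.Faithful where
  map_injective h := VB2.functorF_map_injective h

instance : functorF.Full where
  map_surjective h := VB2.functorF_map_surjective h

/-! ### Vector bundles from cocycles -/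

/-- A smooth cocycle, with values in the endomorphisms of a vector space `P`, for an open cover indexed by
the points of the manifold. The map `tr a b x` takes coordinates with respect to `a` to coordinates with
respect to `b`. -/
structure Cocycle (M : Mfd) (P : Type) [AddCommGroup P] [Module ℝ P] where
  dom : M → Opens M
  mem_dom : ∀ a, a ∈ dom a
  tr : M → M → M → P →ₗ[ℝ] P
  tr_self : ∀ a, ∀ x ∈ dom a, ∀ u, tr a a x u = u
  tr_tr : ∀ a b c x, x ∈ dom a → x ∈ dom b → x ∈ dom c → ∀ u, tr b c x (tr a b x u) = tr a c x u
  smooth : ∀ a b (l : Module.Dual ℝ P) u, SmoothOn (dom a ⊓ dom b) fun x => l (tr a b x u)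

namespace Cocycle
variable {M : Mfd} {P : Type} [AddCommGroup P] [Module ℝ P] [Module.Finite ℝ P] (c : Cocycle M P)

/-- An identification of `P` with the dual of a Euclidean space. -/
def dualEquiv (P : Type) [AddCommGroup P] [Module ℝ P] [Module.Finite ℝ P] :
    P ≃ₗ[ℝ] Module.Dual ℝ (EuclideanSpace ℝ (Fin (Module.finrank ℝ P))) :=
  LinearEquiv.ofFinrankEq _ _ (by rw [Subspace.dual_finrank_eq]; simp)

/-- The transposes of the maps of the cocycle. -/
def coord (a b x : M) : EuclideanSpace ℝ (Fin (Module.finrank ℝ P)) →ₗ[ℝ]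
    EuclideanSpace ℝ (Fin (Module.finrank ℝ P)) :=
  -- Transposition reverses arrows, so the change of coordinates from `a` to `b` comes from `tr b
  -- a`.
  (exists_transpose ((dualEquiv P).toLinearMap ∘ₗ c.tr b a x ∘ₗ
    (dualEquiv P).symm.toLinearMap)).choose

theorem dual_coord (a b x : M) (φ : Module.Dual ℝ (EuclideanSpace ℝ (Fin (Module.finrank ℝ P)))) (v) :
    φ (c.coord a b x v) = dualEquiv P (c.tr b a x ((dualEquiv P).symm φ)) v :=
  LinearMap.congr_fun ((exists_transpose ((dualEquiv P).toLinearMap ∘ₗ c.tr b a x ∘ₗ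
    (dualEquiv P).symm.toLinearMap)).choose_spec φ) v

theorem eq_of_dual {V : Type} [AddCommGroup V] [Module ℝ V] {v w : V}
    (h : ∀ φ : Module.Dual ℝ V, φ v = φ w) : v = w := by
  rw [← sub_eq_zero]
  exact (Module.forall_dual_apply_eq_zero_iff ℝ _).1 fun φ => by rw [map_sub, h, sub_self]

/-- Expanded in elementary endomorphisms, the coefficients are matrix entries, which `dual_coord`
rewrites as functionals of the cocycle maps. -/
theorem coord_smooth (a b : M) : ContMDiffOn (𝓡 M.dim)
    𝓘(ℝ, EuclideanSpace ℝ (Fin (Module.finrank ℝ P)) →L[ℝ]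
      EuclideanSpace ℝ (Fin (Module.finrank ℝ P))) ∞
    (fun x => LinearMap.toContinuousLinearMap (c.coord a b x)) (c.dom a ⊓ c.dom b : Opens M) := by
  let F := EuclideanSpace ℝ (Fin (Module.finrank ℝ P))
  let B := Module.finBasis ℝ F
  have e : ∀ x, LinearMap.toContinuousLinearMap (c.coord a b x) = ∑ i, ∑ k,
      B.coord i (c.coord a b x (B k)) • LinearMap.toContinuousLinearMap
        ((B.coord k).smulRight (B i)) := by
    intro x
    refine ContinuousLinearMap.coe_injective (B.ext fun k => ?_)
    have := B.sum_repr (c.coord a b x (B k))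
    simp only [ContinuousLinearMap.toLinearMap_sum, ContinuousLinearMap.toLinearMap_smul, LinearMap.sum_apply,
      LinearMap.smul_apply, LinearMap.coe_toContinuousLinearMap, LinearMap.smulRight_apply,
      Module.Basis.coord_apply, Module.Basis.repr_self, Finsupp.single_apply, ite_smul, one_smul, zero_smul, smul_ite, smul_zero,
      Finset.sum_ite_eq, Finset.mem_univ, if_true]
    exact this.symm
  refine ContMDiffOn.congr (f := fun x => ∑ i, ∑ k,
      B.coord i (c.coord a b x (B k)) • LinearMap.toContinuousLinearMap
        ((B.coord k).smulRight (B i))) (contMDiffOn_finsetSum fun i _ => contMDiffOn_finsetSum fun k _ => ?_)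
    fun x _ => e x
  have h : SmoothOn (c.dom a ⊓ c.dom b) fun x => B.coord i (c.coord a b x (B k)) := by
    refine ContMDiffOn.congr (f := fun x => dualEquiv P (c.tr b a x ((dualEquiv P).symm
      (B.coord i))) (B k)) ?_ fun x _ => c.dual_coord a b x (B.coord i) (B k)
    rw [inf_comm]
    exact c.smooth b a ((Module.Dual.eval ℝ F (B k)) ∘ₗ (dualEquiv P).toLinearMap) _
  exact ContMDiffOn.smul h (contMDiffOn_const (c := LinearMap.toContinuousLinearMap
    ((B.coord k).smulRight (B i))))

/-- The vector bundle whose dual is given by the cocycle. -/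
def core : VectorBundleCore ℝ M (EuclideanSpace ℝ (Fin (Module.finrank ℝ P))) M where
  baseSet a := c.dom a
  isOpen_baseSet a := (c.dom a).2
  -- The cover is indexed by the points of `M`, so the fibre over `x` is read in the chart of index
  -- `x`.
  indexAt := id
  mem_baseSet_at := c.mem_dom
  coordChange a b x := LinearMap.toContinuousLinearMap (c.coord a b x)
  coordChange_self a x hx v := eq_of_dual fun φ => by
    rw [LinearMap.coe_toContinuousLinearMap', dual_coord, c.tr_self a x hx,
      LinearEquiv.apply_symm_apply]
  continuousOn_coordChange a b := (c.coord_smooth a b).continuousOn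
  coordChange_comp a b d x hx v := eq_of_dual fun φ => by
    simp only [LinearMap.coe_toContinuousLinearMap', dual_coord, LinearEquiv.symm_apply_apply]
    rw [c.tr_tr d b a x hx.2 hx.1.2 hx.1.1]

instance : c.core.IsContMDiff (𝓡 M.dim) ∞ where
  contMDiffOn_coordChange a b := c.coord_smooth a b

/-- The vector bundle whose dual is given by the cocycle. -/
def bundle : SmoothVB M where
  rank := Module.finrank ℝ P
  Fib := c.core.Fiber
  addCommGroup x := c.core.addCommGroupFiber x
  module x := c.core.moduleFiber x
  topFib x := c.core.topologicalSpaceFiber x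
  topTotal := c.core.toTopologicalSpace
  fiberBundle := c.core.fiberBundle
  vectorBundle := c.core.vectorBundle
  smooth := VectorBundleCore.instContMDiffVectorBundle c.core

/-- The tautological frame of the dual bundle over `c.dom a`. -/
def frame (a : M) : c.bundle.DualFrame P (c.dom a) :=
  ((c.bundle.trivFrame a).congr (dualEquiv P)).restrict le_rfl

/-- As the fibre over `x` uses the chart of index `x`, the frame of index `a` is at `x` the
transition from `a` to `x`. -/
theorem frame_frm (a x : M) (hx : x ∈ c.dom a) (u : P) :
    (c.frame a).frm x u = dualEquiv P (c.tr a x x u) := by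
  refine LinearMap.ext fun v => ?_
  refine Eq.trans ?_ ((c.dual_coord x a x (dualEquiv P u) v).trans
    (congrArg (fun u => dualEquiv P (c.tr a x x u) v) ((dualEquiv P).symm_apply_apply u)))
  refine congrArg (dualEquiv P u) ?_
  exact congrArg (fun f => f v) (c.core.localTriv_continuousLinearMapAt (i := a) hx)

theorem frame_tr (a b x : M) (ha : x ∈ c.dom a) (hb : x ∈ c.dom b) (u : P) :
    (c.frame b).frm x (c.tr a b x u) = (c.frame a).frm x u := by
  rw [c.frame_frm a x ha, c.frame_frm b x hb, c.tr_tr a b x x ha hb (c.mem_dom x)]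

end Cocycle

/-- A cocycle for the degree one generators of the local model and a cocycle for the degree two generators
which are compatible with the products of degree one generators. -/
structure ModelCocycle (M : Mfd) (m₁ m₂ : ℕ) where
  one : Cocycle M (Fin m₁ → ℝ)
  two : Cocycle M (⋀[ℝ]^2 (Fin m₁ → ℝ) × (Fin m₂ → ℝ))
  dom_eq : two.dom = one.dom
  tr_modelIncl : ∀ a b x, x ∈ one.dom a → x ∈ one.dom b →
    two.tr a b x ∘ₗ modelIncl m₁ m₂ = modelIncl m₁ m₂ ∘ₗ exteriorPower.map 2 (one.tr a b x)

theorem isSmooth_bilinear {M : Mfd} {U : Opens M} {P : Type} [AddCommGroup P] [Module ℝ P]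
    [Module.Finite ℝ P] (B : P →ₗ[ℝ] P →ₗ[ℝ] ℝ) {u v : M → P}
    (hu : ∀ l : Module.Dual ℝ P, SmoothOn U fun x => l (u x))
    (hv : ∀ l : Module.Dual ℝ P, SmoothOn U fun x => l (v x)) :
    SmoothOn U fun x => B (u x) (v x) := by
  let b := Module.finBasis ℝ P
  have e : ∀ x, B (u x) (v x) = ∑ i, b.coord i (u x) * B (b i) (v x) := by
    intro x
    conv_lhs => rw [← b.sum_repr (u x)]
    simp only [map_sum, map_smul, LinearMap.sum_apply, LinearMap.smul_apply, smul_eq_mul,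
      Module.Basis.coord_apply]
  simp only [e]
  exact contMDiffOn_finsetSum fun i _ => ContMDiffOn.mul (hu (b.coord i)) (hv (B (b i)))

/-! ### The triple given by a pair of compatible cocycles -/

namespace ModelCocycle
variable {M : Mfd} {m₁ m₂ : ℕ} (c : ModelCocycle M m₁ m₂)

/-- The frame of the bundle in degree two. -/
def frameTwo (a : M) :
    c.two.bundle.DualFrame (⋀[ℝ]^2 (Fin m₁ → ℝ) × (Fin m₂ → ℝ)) (c.one.dom a) :=
  (c.two.frame a).restrict (by rw [c.dom_eq])

theorem frameTwo_tr (a b x : M) (ha : x ∈ c.one.dom a) (hb : x ∈ c.one.dom b) (u) :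
    (c.frameTwo b).frm x (c.two.tr a b x u) = (c.frameTwo a).frm x u :=
  c.two.frame_tr a b x (by rwa [c.dom_eq]) (by rwa [c.dom_eq]) u

/-- The inclusion of the second exterior power of the dual bundle in degree one. -/
def incl (x : M) : ⋀[ℝ]^2 (Module.Dual ℝ (c.one.bundle.Fib x)) →ₗ[ℝ]
    Module.Dual ℝ (c.two.bundle.Fib x) :=
  (c.frameTwo x).frm x ∘ₗ modelIncl m₁ m₂ ∘ₗ exteriorPower.map 2 ((c.one.frame x).inv x)

/-- `incl x` is defined with the frames of index `x`. Compatibility of the two cocycles with `⋀²`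
makes it independent of the index. -/
theorem frameTwo_modelIncl (a x : M) (hx : x ∈ c.one.dom a) :
    (c.frameTwo a).frm x ∘ₗ modelIncl m₁ m₂ =
      c.incl x ∘ₗ exteriorPower.map 2 ((c.one.frame a).frm x) := by
  have h₁ : (c.one.frame x).inv x ∘ₗ (c.one.frame a).frm x = c.one.tr a x x := by
    refine LinearMap.ext fun u => ?_
    rw [LinearMap.comp_apply, ← c.one.frame_tr a x x hx (c.one.mem_dom x),
      (c.one.frame x).inv_frm x (c.one.mem_dom x)]
  have h₂ : (c.frameTwo a).frm x = (c.frameTwo x).frm x ∘ₗ c.two.tr a x x :=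
    LinearMap.ext fun u => (c.frameTwo_tr a x x hx (c.one.mem_dom x) u).symm
  rw [incl, LinearMap.comp_assoc, LinearMap.comp_assoc, ← exteriorPower.map_comp, h₁, h₂,
    LinearMap.comp_assoc, c.tr_modelIncl a x x hx (c.one.mem_dom x)]

theorem incl_injective (x : M) : Function.Injective (c.incl x) := by
  have h : Function.Injective (exteriorPower.map 2 ((c.one.frame x).inv x)) := by
    refine Function.LeftInverse.injective (g := exteriorPower.map 2 ((c.one.frame x).frm x))
      fun T => ?_
    rw [← LinearMap.comp_apply, ← exteriorPower.map_comp, LinearMap.ext (f := (c.one.frame x).frm x ∘ₗ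
      (c.one.frame x).inv x) (g := LinearMap.id) ((c.one.frame x).frm_inv x (c.one.mem_dom x)), exteriorPower.map_id, LinearMap.id_apply]
  exact ((c.frameTwo x).equiv (c.one.mem_dom x)).injective.comp
    (LinearMap.inl_injective.comp h)

theorem exists_phi (x : M) : ∃ φ : c.two.bundle.Fib x →ₗ[ℝ] ⋀[ℝ]^2 (c.one.bundle.Fib x),
    ∀ ξ, exteriorPower.pairingDual ℝ (c.one.bundle.Fib x) 2 ξ ∘ₗ φ = c.incl x ξ := by
  obtain ⟨φ, hφ⟩ := exists_transpose (c.incl x ∘ₗ (LinearEquiv.ofBijective _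
    (pairingDual_bijective (c.one.bundle.Fib x) 2)).symm.toLinearMap)
  refine ⟨φ, fun ξ => (hφ _).trans (congrArg (c.incl x) ?_)⟩
  exact (LinearEquiv.ofBijective _ (pairingDual_bijective (c.one.bundle.Fib x) 2)).symm_apply_apply ξ

/-- The transpose of the inclusion of the second exterior power. -/
def phi (x : M) : c.two.bundle.Fib x →ₗ[ℝ] ⋀[ℝ]^2 (c.one.bundle.Fib x) := (c.exists_phi x).choose

theorem pairingDual_phi (x : M) (ξ) :
    exteriorPower.pairingDual ℝ (c.one.bundle.Fib x) 2 ξ ∘ₗ c.phi x = c.incl x ξ :=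
  (c.exists_phi x).choose_spec ξ

/-- A linear map is onto when its transpose is injective, and through the pairing the transpose of
`phi` is `incl`. -/
theorem phi_surjective (x : M) : Function.Surjective (c.phi x) := by
  rw [← LinearMap.dualMap_injective_iff]
  intro f g h
  obtain ⟨ξ, rfl⟩ := (pairingDual_bijective (c.one.bundle.Fib x) 2).2 f
  obtain ⟨η, rfl⟩ := (pairingDual_bijective (c.one.bundle.Fib x) 2).2 g
  exact congrArg _ (c.incl_injective x
    ((c.pairingDual_phi x ξ).symm.trans (h.trans (c.pairingDual_phi x η))))

theorem incl_smooth (U : Opens M) (α β : ∀ x : M, Module.Dual ℝ (c.one.bundle.Fib x))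
    (hα : c.one.bundle.IsSmoothDual U α) (hβ : c.one.bundle.IsSmoothDual U β) :
    c.two.bundle.IsSmoothDual U fun x => c.incl x (exteriorPower.ιMulti ℝ 2 ![α x, β x]) := by
  refine SmoothVB.IsSmoothDual.of_locally fun a ha => ⟨U ⊓ c.one.dom a, ⟨ha, c.one.mem_dom a⟩, _, ?_,
    fun _ _ => rfl⟩
  refine (c.frameTwo a).isSmoothDual_of_coord inf_le_right fun l => ?_
  have e : ∀ x ∈ U ⊓ c.one.dom a,
      (c.frameTwo a).inv x (c.incl x (exteriorPower.ιMulti ℝ 2 ![α x, β x])) =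
        modelIncl m₁ m₂ (exteriorPower.ιMulti ℝ 2
          ![(c.one.frame a).inv x (α x), (c.one.frame a).inv x (β x)]) := by
    intro x hx
    have h := LinearMap.congr_fun (c.frameTwo_modelIncl a x hx.2) (exteriorPower.ιMulti ℝ 2
      ![(c.one.frame a).inv x (α x), (c.one.frame a).inv x (β x)])
    have h' : (c.one.frame a).frm x ∘
        ![(c.one.frame a).inv x (α x), (c.one.frame a).inv x (β x)] = ![α x, β x] := by
      funext i
      fin_cases i
      · exact (c.one.frame a).frm_inv x hx.2 _
      · exact (c.one.frame a).frm_inv x hx.2 _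
    rw [LinearMap.comp_apply, LinearMap.comp_apply, exteriorPower.map_apply_ιMulti, h'] at h
    rw [← h, (c.frameTwo a).inv_frm x hx.2]
  obtain ⟨γ, hγ⟩ := (FibreAlg.gen₂ (modelIncl m₁ m₂)).exists_leftInverse_of_injective
    (LinearMap.ker_eq_bot.2 (FibreAlg.split_gen₂_injective _ _))
  -- The form `(u, v) ↦ l (u ∧ v, 0)` is read off the product of degree one generators in the model,
  -- where bilinearity is evident.
  let B : (Fin m₁ → ℝ) →ₗ[ℝ] (Fin m₁ → ℝ) →ₗ[ℝ] ℝ :=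
    ((LinearMap.mul ℝ (ModelFib m₁ m₂)).compl₁₂ (FibreAlg.gen₁ _) (FibreAlg.gen₁ _)).compr₂ (l ∘ₗ γ)
  have hB : ∀ u v, B u v = l (modelIncl m₁ m₂ (exteriorPower.ιMulti ℝ 2 ![u, v])) := fun u v =>
    congrArg l ((congrArg γ (FibreAlg.gen₁_mul_gen₁ _ u v)).trans (LinearMap.congr_fun hγ _))
  refine ContMDiffOn.congr (isSmooth_bilinear B
    ((c.one.frame a).smooth_inv _ inf_le_right _ (hα.mono inf_le_left))
    ((c.one.frame a).smooth_inv _ inf_le_right _ (hβ.mono inf_le_left))) fun x hx => ?_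
  exact (congrArg l (e x hx)).trans (hB _ _).symm

/-- The triple given by a pair of compatible cocycles. -/
def toVB2 : VB2 where
  M := M
  E₁ := c.one.bundle
  Et := c.two.bundle
  φ := c.phi
  φ_surjective := c.phi_surjective
  φ_smooth U α β hα hβ := (c.incl_smooth U α β hα hβ).congr fun x _ => c.pairingDual_phi x _

theorem iota_toVB2 (x : M) : c.toVB2.iota x = c.incl x :=
  LinearMap.ext fun ξ => c.pairingDual_phi x ξ

/-- The frame over a member of the cover. -/
def frame (a : M) : c.toVB2.Frame m₁ m₂ (c.one.dom a) where
  d₁ := c.one.frame a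
  dt := c.frameTwo a
  compat x hx := (c.frameTwo_modelIncl a x hx).trans
    (congrArg (· ∘ₗ exteriorPower.map 2 ((c.one.frame a).frm x)) (c.iota_toVB2 x).symm)

end ModelCocycle

/-! ### Transition maps between local trivializations -/

/-- A left inverse of the inclusion of the degree one generators. -/
def modelCoord₁ (m₁ m₂ : ℕ) : ModelFib m₁ m₂ →ₗ[ℝ] (Fin m₁ → ℝ) :=
  ((FibreAlg.gen₁ (modelIncl m₁ m₂)).exists_leftInverse_of_injective
    (LinearMap.ker_eq_bot.2 (FibreAlg.split_gen₁_injective _ _))).choose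

theorem modelCoord₁_gen₁ {m₁ m₂ : ℕ} (v : Fin m₁ → ℝ) :
    modelCoord₁ m₁ m₂ (FibreAlg.gen₁ _ v) = v :=
  LinearMap.congr_fun ((FibreAlg.gen₁ (modelIncl m₁ m₂)).exists_leftInverse_of_injective
    (LinearMap.ker_eq_bot.2 (FibreAlg.split_gen₁_injective _ _))).choose_spec v

/-- A left inverse of the inclusion of the degree two generators. -/
def modelCoord₂ (m₁ m₂ : ℕ) : ModelFib m₁ m₂ →ₗ[ℝ] ⋀[ℝ]^2 (Fin m₁ → ℝ) × (Fin m₂ → ℝ) :=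
  ((FibreAlg.gen₂ (modelIncl m₁ m₂)).exists_leftInverse_of_injective
    (LinearMap.ker_eq_bot.2 (FibreAlg.split_gen₂_injective _ _))).choose

theorem modelCoord₂_gen₂ {m₁ m₂ : ℕ} (w : ⋀[ℝ]^2 (Fin m₁ → ℝ) × (Fin m₂ → ℝ)) :
    modelCoord₂ m₁ m₂ (FibreAlg.gen₂ _ w) = w :=
  LinearMap.congr_fun ((FibreAlg.gen₂ (modelIncl m₁ m₂)).exists_leftInverse_of_injective
    (LinearMap.ker_eq_bot.2 (FibreAlg.split_gen₂_injective _ _))).choose_spec w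

namespace GradedSpace.LocalTrivialization
variable {X : GradedSpace} {m₁ m₂ : ℕ} {U U' U'' : Opens X.body}
  (T : X.LocalTrivialization m₁ m₂ U) (T' : X.LocalTrivialization m₁ m₂ U')
  (T'' : X.LocalTrivialization m₁ m₂ U'')

theorem iso_symm_res {V V' : Opens X.body} (hV : V ≤ U) (h : V' ≤ V) (t : Model X.body m₁ m₂ V) :
    (T.iso V' (h.trans hV)).symm (Model.res m₁ m₂ h t) = X.res h ((T.iso V hV).symm t) := by
  rw [AlgEquiv.symm_apply_eq, T.res_iso V V' hV, AlgEquiv.apply_symm_apply]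

theorem iso_symm_mem {V : Opens X.body} (hV : V ≤ U) {q : ℕ} {t : Model X.body m₁ m₂ V} :
    (T.iso V hV).symm t ∈ (X.sections V).gr q ↔ t ∈ Model.gr m₁ m₂ V q := by
  rw [T.mem_iff V hV, AlgEquiv.apply_symm_apply]

/-- The change of trivialization followed by evaluation at `x` is a compatible family of algebra
maps that sends functions to scalars, for degree reasons; so `exists_factor` applies. -/
theorem exists_transition (x : X.body) : ∃ B : ModelFib m₁ m₂ →ₐ[ℝ] ModelFib m₁ m₂,
    ∀ (V : Opens X.body) (hV : V ≤ U) (hV' : V ≤ U') (hx : x ∈ V) (s : X.sections V),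
      Model.ev ⟨x, hx⟩ (T'.iso V hV' s) = B (Model.ev ⟨x, hx⟩ (T.iso V hV s)) := by
  by_cases hx : x ∈ U ⊓ U'
  · obtain ⟨B, -, hB⟩ := Model.exists_factor hx (FibreAlg.aug (modelIncl m₁ m₂))
      (fun V hV hy => (Model.ev ⟨x, hy⟩).comp ((T'.iso V (hV.trans inf_le_right)).toAlgHom.comp
        (T.iso V (hV.trans inf_le_left)).symm.toAlgHom))
      (fun V V' h hV hy t => by
        refine Eq.trans (congrArg (fun s => Model.ev ⟨x, hy⟩ (T'.iso V' _ s))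
          (T.iso_symm_res (hV.trans inf_le_left) h t)) ?_
        rw [T'.res_iso V V' (hV.trans inf_le_right) h, Model.ev_res]
        rfl)
      (fun V hV hy f => FibreAlg.exists_of_mem_deg_zero _ (Model.ev_mem
        ((T'.mem_iff V (hV.trans inf_le_right) 0 _).1
          ((T.iso_symm_mem (hV.trans inf_le_left)).2 (by
            rw [Model.mem_gr_iff]
            intro y
            rw [Model.ev_func, Algebra.algebraMap_eq_smul_one]
            exact Submodule.smul_mem _ _ SetLike.GradedOne.one_mem))) _))
    refine ⟨B, fun V hV hV' hx s => ?_⟩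
    refine Eq.trans ?_ (hB V (le_inf hV hV') hx (T.iso V hV s))
    exact congrArg (fun s => Model.ev ⟨x, hx⟩ (T'.iso V hV' s)) ((T.iso V hV).symm_apply_apply s).symm
  -- Outside `U ⊓ U'` the condition is vacuous and the identity is only a default value.
  · exact ⟨AlgHom.id ℝ _, fun V hV hV' h => absurd ⟨hV h, hV' h⟩ hx⟩

/-- The transition map between the fibres of two local trivializations. -/
def transition (x : X.body) : ModelFib m₁ m₂ →ₐ[ℝ] ModelFib m₁ m₂ :=
  (exists_transition T T' x).choose

theorem transition_ev {V : Opens X.body} (hV : V ≤ U) (hV' : V ≤ U') {x : X.body} (hx : x ∈ V)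
    (s : X.sections V) :
    transition T T' x (Model.ev ⟨x, hx⟩ (T.iso V hV s)) = Model.ev ⟨x, hx⟩ (T'.iso V hV' s) :=
  ((exists_transition T T' x).choose_spec V hV hV' hx s).symm

theorem ev_iso_const {V : Opens X.body} (hV : V ≤ U) {x : X.body} (hx : x ∈ V)
    (b : ModelFib m₁ m₂) :
    Model.ev ⟨x, hx⟩ (T.iso V hV ((T.iso V hV).symm (Model.const b))) = b := by
  rw [AlgEquiv.apply_symm_apply, Model.ev_const]

theorem transition_apply {V : Opens X.body} (hV : V ≤ U) (hV' : V ≤ U') {x : X.body} (hx : x ∈ V)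
    (b : ModelFib m₁ m₂) : transition T T' x b =
      Model.ev ⟨x, hx⟩ (T'.iso V hV' ((T.iso V hV).symm (Model.const b))) := by
  rw [← transition_ev T T' hV hV' hx, ev_iso_const]

theorem transition_mem {x : X.body} (hx : x ∈ U) (hx' : x ∈ U') {q : ℕ} {b : ModelFib m₁ m₂}
    (hb : b ∈ FibreAlg.deg (modelIncl m₁ m₂) q) :
    transition T T' x b ∈ FibreAlg.deg (modelIncl m₁ m₂) q := by
  rw [transition_apply T T' inf_le_left inf_le_right (V := U ⊓ U') ⟨hx, hx'⟩]
  refine Model.ev_mem ((T'.mem_iff _ _ q _).1 ((T.iso_symm_mem _).2 ?_)) _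
  rw [Model.mem_gr_iff]
  intro y
  rwa [Model.ev_const]

theorem transition_self {x : X.body} (hx : x ∈ U) (b : ModelFib m₁ m₂) :
    transition T T x b = b := by
  rw [transition_apply T T le_rfl le_rfl hx, ev_iso_const]

theorem transition_transition {x : X.body} (hx : x ∈ U) (hx' : x ∈ U') (hx'' : x ∈ U'')
    (b : ModelFib m₁ m₂) :
    transition T' T'' x (transition T T' x b) = transition T T'' x b := by
  have hV : U ⊓ U' ⊓ U'' ≤ U := inf_le_left.trans inf_le_left
  have hV' : U ⊓ U' ⊓ U'' ≤ U' := inf_le_left.trans inf_le_right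
  have h : x ∈ U ⊓ U' ⊓ U'' := ⟨⟨hx, hx'⟩, hx''⟩
  rw [transition_apply T T' hV hV' h, transition_ev T' T'' hV' inf_le_right h,
    transition_apply T T'' hV inf_le_right h]

/-- On the overlap the transition map applied to a fixed `b` is the value of one section: the
constant `b` of the first trivialization, seen in the second. -/
theorem smooth_transition (l : Module.Dual ℝ (ModelFib m₁ m₂)) (b : ModelFib m₁ m₂) :
    SmoothOn (U ⊓ U') fun x => l (transition T T' x b) := by
  refine contMDiffOn_iff_isSmooth.2 ?_
  refine (funext fun x => ?_ : (fun x : (U ⊓ U' : Opens X.body) => l (transition T T' x.1 b)) = _) ▸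
    Model.isSmooth_ev l
      (T'.iso (U ⊓ U') inf_le_right ((T.iso (U ⊓ U') inf_le_left).symm (Model.const b)))
  exact congrArg l (transition_apply T T' inf_le_left inf_le_right x.2 b)

/-- The transition map on the degree one generators. -/
def trans₁ (x : X.body) : (Fin m₁ → ℝ) →ₗ[ℝ] (Fin m₁ → ℝ) :=
  modelCoord₁ m₁ m₂ ∘ₗ (transition T T' x).toLinearMap ∘ₗ FibreAlg.gen₁ _

/-- The transition map on the degree two generators. -/
def trans₂ (x : X.body) : ⋀[ℝ]^2 (Fin m₁ → ℝ) × (Fin m₂ → ℝ) →ₗ[ℝ]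
    ⋀[ℝ]^2 (Fin m₁ → ℝ) × (Fin m₂ → ℝ) :=
  modelCoord₂ m₁ m₂ ∘ₗ (transition T T' x).toLinearMap ∘ₗ FibreAlg.gen₂ _

/-- The transition map preserves degree one, which consists of generators, so the left inverse
`modelCoord₁` loses nothing. -/
theorem gen₁_trans₁ {x : X.body} (hx : x ∈ U) (hx' : x ∈ U') (v : Fin m₁ → ℝ) :
    FibreAlg.gen₁ _ (trans₁ T T' x v) = transition T T' x (FibreAlg.gen₁ _ v) := by
  obtain ⟨u, hu⟩ := FibreAlg.exists_of_mem_deg_one _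
    (transition_mem T T' hx hx' (FibreAlg.gen₁_mem _ v))
  simp only [trans₁, LinearMap.comp_apply, AlgHom.toLinearMap_apply, hu, modelCoord₁_gen₁]

theorem gen₂_trans₂ {x : X.body} (hx : x ∈ U) (hx' : x ∈ U')
    (w : ⋀[ℝ]^2 (Fin m₁ → ℝ) × (Fin m₂ → ℝ)) :
    FibreAlg.gen₂ _ (trans₂ T T' x w) = transition T T' x (FibreAlg.gen₂ _ w) := by
  obtain ⟨u, hu⟩ := FibreAlg.exists_of_mem_deg_two _
    (transition_mem T T' hx hx' (FibreAlg.gen₂_mem _ w))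
  simp only [trans₂, LinearMap.comp_apply, AlgHom.toLinearMap_apply, hu, modelCoord₂_gen₂]

/-- In the algebra `v ∧ v'` is the product of two degree one generators, and the transition map is
multiplicative. -/
theorem trans₂_modelIncl {x : X.body} (hx : x ∈ U) (hx' : x ∈ U') :
    trans₂ T T' x ∘ₗ modelIncl m₁ m₂ =
      modelIncl m₁ m₂ ∘ₗ exteriorPower.map 2 (trans₁ T T' x) := by
  refine exteriorPower.linearMap_ext (AlternatingMap.ext fun v => ?_)
  have e : v = ![v 0, v 1] := by ext i; fin_cases i <;> rfl
  have e' : trans₁ T T' x ∘ v = ![trans₁ T T' x (v 0), trans₁ T T' x (v 1)] := by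
    funext i; fin_cases i <;> rfl
  refine FibreAlg.split_gen₂_injective _ _ ?_
  refine (gen₂_trans₂ T T' hx hx' _).trans ?_
  simp only [LinearMap.compAlternatingMap_apply, LinearMap.comp_apply,
    exteriorPower.map_apply_ιMulti, e']
  rw [← FibreAlg.gen₁_mul_gen₁, gen₁_trans₁ T T' hx hx', gen₁_trans₁ T T' hx hx', ← map_mul,
    FibreAlg.gen₁_mul_gen₁, ← e]
  rfl

end GradedSpace.LocalTrivialization

namespace GradedSpace
open LocalTrivialization
variable {X : GradedSpace} {m₁ m₂ : ℕ} (U : X.body → Opens X.body) (hU : ∀ a, a ∈ U a)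
  (T : ∀ a, X.LocalTrivialization m₁ m₂ (U a))

/-- The cocycles of generators of a family of local trivializations. -/
def modelCocycle : ModelCocycle X.body m₁ m₂ where
  one :=
    { dom := U
      mem_dom := hU
      tr := fun a b => trans₁ (T a) (T b)
      tr_self := fun a x hx u => by
        refine FibreAlg.split_gen₁_injective _ (Fin m₂ → ℝ) ?_
        exact (gen₁_trans₁ (T a) (T a) hx hx u).trans (transition_self _ hx _)
      tr_tr := fun a b c x ha hb hc u => by
        refine FibreAlg.split_gen₁_injective _ (Fin m₂ → ℝ) ?_
        refine (gen₁_trans₁ (T b) (T c) hb hc _).trans ?_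
        rw [gen₁_trans₁ (T a) (T b) ha hb, transition_transition _ _ _ ha hb hc]
        exact (gen₁_trans₁ (T a) (T c) ha hc u).symm
      smooth := fun a b l u => smooth_transition (T a) (T b) (l ∘ₗ modelCoord₁ m₁ m₂) _ }
  two :=
    { dom := U
      mem_dom := hU
      tr := fun a b => trans₂ (T a) (T b)
      tr_self := fun a x hx u => by
        refine FibreAlg.split_gen₂_injective _ _ ?_
        exact (gen₂_trans₂ (T a) (T a) hx hx u).trans (transition_self _ hx _)
      tr_tr := fun a b c x ha hb hc u => by
        refine FibreAlg.split_gen₂_injective _ _ ?_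
        refine (gen₂_trans₂ (T b) (T c) hb hc _).trans ?_
        rw [gen₂_trans₂ (T a) (T b) ha hb, transition_transition _ _ _ ha hb hc]
        exact (gen₂_trans₂ (T a) (T c) ha hc u).symm
      smooth := fun a b l u => smooth_transition (T a) (T b) (l ∘ₗ modelCoord₂ m₁ m₂) _ }
  dom_eq := rfl
  tr_modelIncl a b x ha hb := trans₂_modelIncl (T a) (T b) ha hb

end GradedSpace

/-! ### Comparison of a degree two manifold with the structure sheaf of a triple -/

-- A degree-preserving map commutes with taking homogeneous components. So bijectivity may be tested
-- in each degree, which is the form in which the sheaf property is available.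
open Classical in
theorem GrAlg.isIso_of_bijective {A B : GrAlg} (f : A ⟶ B)
    (hinj : ∀ q, ∀ a ∈ A.gr q, GrAlg.algHom f a = 0 → a = 0)
    (hsurj : ∀ q, ∀ b ∈ B.gr q, ∃ a ∈ A.gr q, GrAlg.algHom f a = b) : IsIso f := by
  have hdec : ∀ a q, GrAlg.algHom f (DirectSum.decompose A.gr a q) =
      DirectSum.decompose B.gr (GrAlg.algHom f a) q := by
    intro a q
    induction a using DirectSum.Decomposition.inductionOn A.gr with
    | zero => simp
    | add a a' h h' => simp [h, h']
    | @homogeneous i a =>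
      by_cases h : i = q
      · subst h
        rw [DirectSum.decompose_coe, DirectSum.of_eq_same,
          DirectSum.decompose_of_mem_same _ (GrAlg.algHom_mem f a.2)]
      · rw [DirectSum.decompose_of_mem_ne _ a.2 h,
          DirectSum.decompose_of_mem_ne _ (GrAlg.algHom_mem f a.2) h, map_zero]
  have hf : Function.Bijective (GrAlg.algHom f) := by
    refine ⟨(injective_iff_map_eq_zero _).2 fun a ha => ?_, fun b => ?_⟩
    · rw [← DirectSum.sum_support_decompose A.gr a]
      refine Finset.sum_eq_zero fun q _ => hinj q _ (SetLike.coe_mem _) ?_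
      rw [hdec, ha]
      simp
    · induction b using DirectSum.Decomposition.inductionOn B.gr with
      | zero => exact ⟨0, map_zero _⟩
      | add b b' h h' =>
        obtain ⟨a, rfl⟩ := h
        obtain ⟨a', rfl⟩ := h'
        exact ⟨a + a', map_add _ _ _⟩
      | @homogeneous i b =>
        obtain ⟨a, -, h⟩ := hsurj i b b.2
        exact ⟨a, h⟩
  let e := AlgEquiv.ofBijective (GrAlg.algHom f) hf
  refine ⟨GrAlg.ofHom e.symm.toAlgHom fun q b hb => ?_, ?_, ?_⟩
  · obtain ⟨a, ha, rfl⟩ := hsurj q b hb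
    exact (e.symm_apply_apply a).symm ▸ ha
  · exact GrAlg.hom_ext fun a => e.symm_apply_apply a
  · exact GrAlg.hom_ext fun b => e.apply_symm_apply b

namespace GradedSpace
variable {X : GradedSpace}

theorem res_mem {V U : Opens X.body} (h : V ≤ U) {q : ℕ} {s : X.sections U}
    (hs : s ∈ (X.sections U).gr q) : X.res h s ∈ (X.sections V).gr q :=
  GrAlg.algHom_mem (X.resHom h) hs

theorem res_res {W V U : Opens X.body} (h : V ≤ U) (h' : W ≤ V) (s : X.sections U) :
    X.res h' (X.res h s) = X.res (h'.trans h) s :=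
  (congrArg (fun k : X.sections U ⟶ X.sections W => GrAlg.algHom k s)
    (X.sheaf.map_comp (homOfLE h).op (homOfLE h').op)).symm

/-! ### Separation and gluing in a fixed degree -/

namespace IsDegreeTwo
variable {ι : Type} {V : Opens X.body} {W : ι → Opens X.body}

theorem eq_of_res (hX : X.IsDegreeTwo) (hW : ∀ i, W i ≤ V) (hcov : V ≤ iSup W) {q : ℕ}
    {s t : X.sections V} (hs : s ∈ (X.sections V).gr q) (ht : t ∈ (X.sections V).gr q)
    (h : ∀ i, X.res (hW i) s = X.res (hW i) t) : s = t := by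
  let F : TopCat.Sheaf Type (TopCat.of X.body) := ⟨X.sheaf ⋙ GrAlg.homogeneous q, hX.isSheaf q⟩
  let s' : (X.sections V).gr q := ⟨s, hs⟩
  let t' : (X.sections V).gr q := ⟨t, ht⟩
  have h' : ∀ i, F.1.map (homOfLE (hW i)).op s' = F.1.map (homOfLE (hW i)).op t' :=
    fun i => Subtype.ext (h i)
  exact congrArg (fun z : (X.sections V).gr q => z.1)
    (F.eq_of_locally_eq' W V (fun i => homOfLE (hW i)) hcov s' t' h')

theorem exists_glue (hX : X.IsDegreeTwo) (hW : ∀ i, W i ≤ V) (hcov : V ≤ iSup W) {q : ℕ}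
    (sf : ∀ i, X.sections (W i)) (hsf : ∀ i, sf i ∈ (X.sections (W i)).gr q)
    (h : ∀ i k, X.res (inf_le_left : W i ⊓ W k ≤ W i) (sf i) = X.res inf_le_right (sf k)) :
    ∃ s ∈ (X.sections V).gr q, ∀ i, X.res (hW i) s = sf i := by
  obtain ⟨s, hs, -⟩ := TopCat.Sheaf.existsUnique_gluing'
    (⟨X.sheaf ⋙ GrAlg.homogeneous q, hX.isSheaf q⟩ : TopCat.Sheaf Type (TopCat.of X.body)) W V
    (fun i => homOfLE (hW i)) hcov (fun i => (⟨sf i, hsf i⟩ : (X.sections (W i)).gr q))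
    fun i k => Subtype.ext (h i k)
  exact ⟨_, Subtype.property (p := fun s => s ∈ (X.sections V).gr q) s,
    fun i => congrArg Subtype.val (hs i)⟩

end IsDegreeTwo
end GradedSpace

/-- Compatible families of frames of the triple `E` and of local trivializations of a presheaf of graded
algebras on the same base. -/
structure CommonAtlas (E : VB2) (C : TopCat.Presheaf GrAlg (TopCat.of E.M)) (m₁ m₂ : ℕ) where
  dom : E.M → Opens E.M
  mem_dom : ∀ a, a ∈ dom a
  frame : ∀ a, E.Frame m₁ m₂ (dom a)
  triv : ∀ a, (GradedSpace.mk E.M C).LocalTrivialization m₁ m₂ (dom a)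
  compat : ∀ (a b : E.M) (V : Opens E.M) (ha : V ≤ dom a) (hb : V ≤ dom b) (x : V)
    (s : (GradedSpace.mk E.M C).sections V),
    (frame a).tau (ha x.2) (Model.ev (M := E.M) x ((triv a).iso V ha s)) =
      (frame b).tau (hb x.2) (Model.ev (M := E.M) x ((triv b).iso V hb s))

/-! ### The comparison isomorphism of a common atlas -/

namespace CommonAtlas
variable {E : VB2} {C : TopCat.Presheaf GrAlg (TopCat.of E.M)} {m₁ m₂ : ℕ}
  (A : CommonAtlas E C m₁ m₂)

/-- The local identification of the presheaf with the structure sheaf of the triple. -/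
def localEquiv (a : E.M) {V : Opens E.M} (hV : V ≤ A.dom a) :
    (GradedSpace.mk E.M C).sections V ≃ₐ[ℝ] E.secAlg V :=
  ((A.triv a).iso V hV).trans ((A.frame a).equivSec hV)

theorem localEquiv_eq (a b : E.M) {V : Opens E.M} (ha : V ≤ A.dom a) (hb : V ≤ A.dom b)
    (s : (GradedSpace.mk E.M C).sections V) : A.localEquiv a ha s = A.localEquiv b hb s :=
  Subtype.ext (funext fun x => A.compat a b V ha hb x s)

theorem localEquiv_res (a : E.M) {V V' : Opens E.M} (hV : V ≤ A.dom a) (h : V' ≤ V)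
    (s : (GradedSpace.mk E.M C).sections V) :
    (A.localEquiv a (h.trans hV) ((GradedSpace.mk E.M C).res h s)).1 =
      E.restrict h (A.localEquiv a hV s).1 :=
  (congrArg (fun t => ((A.frame a).equivSec (h.trans hV) t).1)
    ((A.triv a).res_iso V V' hV h s)).trans ((A.frame a).toSec_res hV h _)

theorem localEquiv_mem (a : E.M) {V : Opens E.M} (hV : V ≤ A.dom a) {q : ℕ}
    {s : (GradedSpace.mk E.M C).sections V} :
    (A.localEquiv a hV s).1 ∈ E.degSec V q ↔ s ∈ ((GradedSpace.mk E.M C).sections V).gr q :=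
  ((A.frame a).toSec_mem_degSec hV).trans ((A.triv a).mem_iff V hV q s).symm

/-- The section of the bundle of algebras of the triple given by a section of the presheaf. -/
def toRough (V : Opens E.M) : (GradedSpace.mk E.M C).sections V →ₐ[ℝ] E.RoughSec V :=
  AlgHom.pi fun x : V => (E.eval (U := V ⊓ A.dom x.1) ⟨x.1, x.2, A.mem_dom x.1⟩).comp
    ((total (E.degSec (V ⊓ A.dom x.1))).val.comp
      ((A.localEquiv x.1 inf_le_right).toAlgHom.comp
        (GrAlg.algHom ((GradedSpace.mk E.M C).resHom (V := V ⊓ A.dom x.1) inf_le_left))))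

/-- `toRough` computes the value at `x` with the chart of index `x`. By compatibility of the atlas
any other chart around `x` gives the same value. -/
theorem restrict_toRough (a : E.M) {V V' : Opens E.M} (hV : V' ≤ A.dom a) (h : V' ≤ V)
    (s : (GradedSpace.mk E.M C).sections V) :
    E.restrict h (A.toRough V s) =
      (A.localEquiv a hV ((GradedSpace.mk E.M C).res h s)).1 := by
  funext x
  let W : Opens E.M := V' ⊓ A.dom x.1
  have hx : x.1 ∈ W := ⟨x.2, A.mem_dom x.1⟩
  have hW : W ≤ V' := inf_le_left
  have hW' : W ≤ V ⊓ A.dom x.1 := inf_le_inf_right _ h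
  have h₁ := congrFun (A.localEquiv_res x.1 (inf_le_right : V ⊓ A.dom x.1 ≤ _) hW'
    ((GradedSpace.mk E.M C).res inf_le_left s)) ⟨x.1, hx⟩
  have h₂ := congrFun (A.localEquiv_res a hV hW ((GradedSpace.mk E.M C).res h s)) ⟨x.1, hx⟩
  refine h₁.symm.trans (Eq.trans ?_ h₂)
  rw [GradedSpace.res_res, GradedSpace.res_res, A.localEquiv_eq x.1 a _ (hW.trans hV)]

theorem toRough_mem {V : Opens E.M} {q : ℕ} {s : (GradedSpace.mk E.M C).sections V}
    (hs : s ∈ ((GradedSpace.mk E.M C).sections V).gr q) : A.toRough V s ∈ E.degSec V q := by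
  have h : ∀ x : V, E.restrict (inf_le_left : V ⊓ A.dom x.1 ≤ V) (A.toRough V s) ∈
      E.degSec (V ⊓ A.dom x.1) q := fun x => by
    rw [A.restrict_toRough x.1 inf_le_right inf_le_left]
    exact (A.localEquiv_mem x.1 inf_le_right).2 (GradedSpace.res_mem _ hs)
  refine E.mem_degSec.2 ⟨fun x => ?_, fun x =>
    (E.mem_degSec.1 (h x)).2 ⟨x.1, x.2, A.mem_dom x.1⟩⟩
  obtain ⟨W, hW, hx, hp⟩ := (E.mem_degSec.1 (h x)).1 ⟨x.1, x.2, A.mem_dom x.1⟩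
  exact ⟨W, hW.trans inf_le_left, hx, hp⟩

theorem toRough_mem_total {V : Opens E.M} (s : (GradedSpace.mk E.M C).sections V) :
    A.toRough V s ∈ total (E.degSec V) := by
  induction s using DirectSum.Decomposition.inductionOn
    ((GradedSpace.mk E.M C).sections V).gr with
  | zero => rw [map_zero]; exact zero_mem _
  | add s t hs ht => rw [map_add]; exact add_mem hs ht
  | homogeneous s => exact le_total _ (A.toRough_mem s.2)

/-- The comparison map over an open set. -/
def comparison (V : Opens E.M) : (GradedSpace.mk E.M C).sections V ⟶ E.secAlg V :=
  GrAlg.ofHom ((A.toRough V).codRestrict (total (E.degSec V)) A.toRough_mem_total)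
    fun _ _ hs => A.toRough_mem hs

theorem comparison_val {V : Opens E.M} (s : (GradedSpace.mk E.M C).sections V) :
    (GrAlg.algHom (A.comparison V) s : E.secAlg V).1 = A.toRough V s := rfl

theorem toRough_res {V V' : Opens E.M} (h : V' ≤ V) (s : (GradedSpace.mk E.M C).sections V) :
    A.toRough V' ((GradedSpace.mk E.M C).res h s) = E.restrict h (A.toRough V s) := by
  funext x
  have hW : V' ⊓ A.dom x.1 ≤ V' := inf_le_left
  have h₁ := A.restrict_toRough x.1 inf_le_right hW ((GradedSpace.mk E.M C).res h s)
  have h₂ := A.restrict_toRough x.1 inf_le_right (hW.trans h) s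
  rw [GradedSpace.res_res] at h₁
  exact congrFun (h₁.trans h₂.symm) ⟨x.1, x.2, A.mem_dom x.1⟩

theorem resHom_comparison {V V' : Opens E.M} (h : V' ≤ V) :
    (GradedSpace.mk E.M C).resHom h ≫ A.comparison V' = A.comparison V ≫ E.resSec h :=
  GrAlg.hom_ext fun s => Subtype.ext (A.toRough_res h s)

/-- Over a member of the atlas the comparison map is the isomorphism `localEquiv`. In each degree,
separation for `C` then gives injectivity and gluing gives surjectivity. -/
theorem isIso_comparison (hC : (GradedSpace.mk E.M C).IsDegreeTwo) (V : Opens E.M) :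
    IsIso (A.comparison V) := by
  have hle : ∀ a, V ⊓ A.dom a ≤ V := fun _ => inf_le_left
  have hdom : ∀ a, V ⊓ A.dom a ≤ A.dom a := fun _ => inf_le_right
  have hcov : V ≤ ⨆ a, V ⊓ A.dom a := fun x hx =>
    Opens.mem_iSup.2 ⟨x, hx, A.mem_dom x⟩
  refine GrAlg.isIso_of_bijective _ (fun q s hs h => ?_) fun q t ht => ?_
  · refine hC.eq_of_res hle hcov hs (zero_mem _) fun a => ?_
    refine (A.localEquiv a (hdom a)).injective (Subtype.ext ?_)
    rw [← A.restrict_toRough a (hdom a) (hle a), ← A.restrict_toRough a (hdom a) (hle a),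
      ← A.comparison_val, h, map_zero]
    rfl
  · let sf : ∀ a, (GradedSpace.mk E.M C).sections (V ⊓ A.dom a) := fun a =>
      (A.localEquiv a (hdom a)).symm (GrAlg.algHom (E.resSec (hle a)) t)
    have hsf : ∀ a, A.localEquiv a (hdom a) (sf a) = GrAlg.algHom (E.resSec (hle a)) t := fun a =>
      (A.localEquiv a (hdom a)).apply_symm_apply _
    obtain ⟨s, hs, h⟩ := hC.exists_glue hle hcov (q := q) sf (fun a => by
      refine (A.localEquiv_mem a (hdom a)).1 ?_
      rw [hsf]
      exact E.restrict_degSec (hle a) q _ ht) (fun a b => by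
      have ha : V ⊓ A.dom a ⊓ (V ⊓ A.dom b) ≤ V ⊓ A.dom a := inf_le_left
      have hb : V ⊓ A.dom a ⊓ (V ⊓ A.dom b) ≤ V ⊓ A.dom b := inf_le_right
      -- Two local preimages agree on an overlap because a common local isomorphism sends both to
      -- the restriction of `t`.
      refine (A.localEquiv a (ha.trans (hdom a))).injective (Subtype.ext ?_)
      rw [A.localEquiv_res a (hdom a) ha, A.localEquiv_eq a b _ (hb.trans (hdom b)),
        A.localEquiv_res b (hdom b) hb, hsf, hsf]
      rfl)
    refine ⟨s, hs, Subtype.ext (funext fun x => ?_)⟩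
    have h' := A.restrict_toRough x.1 (hdom x.1) (hle x.1) s
    rw [h, hsf] at h'
    exact congrFun h' ⟨x.1, x.2, A.mem_dom x.1⟩

theorem nonempty_iso (A : CommonAtlas E C m₁ m₂) (hC : (GradedSpace.mk E.M C).IsDegreeTwo) :
    Nonempty (functorF.obj E ≅ GradedSpace.mk E.M C) := by
  have := A.isIso_comparison hC
  let invc : ∀ V : Opens E.M, E.secAlg V ⟶ (GradedSpace.mk E.M C).sections V :=
    fun V => inv (A.comparison V)
  have nat : ∀ {V' V : Opens E.M} (h : V' ≤ V), E.resSec h ≫ invc V' =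
      invc V ≫ (GradedSpace.mk E.M C).resHom h := fun {V' V} h => by
    dsimp only [invc]
    rw [IsIso.comp_inv_eq, Category.assoc, A.resHom_comparison, IsIso.inv_hom_id_assoc]
  have hi : ∀ V, invc V ≫ A.comparison V = 𝟙 (E.secAlg V) :=
    fun V => IsIso.inv_hom_id (A.comparison V)
  have hi' : ∀ V, A.comparison V ≫ invc V = 𝟙 ((GradedSpace.mk E.M C).sections V) :=
    fun V => IsIso.hom_inv_id (A.comparison V)
  let f : functorF.obj E ⟶ GradedSpace.mk E.M C :=
    GradedSpace.mkHom (X := functorF.obj E) (Y := GradedSpace.mk E.M C) id contMDiff_id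
      A.comparison A.resHom_comparison
  let g : GradedSpace.mk E.M C ⟶ functorF.obj E :=
    GradedSpace.mkHom (X := GradedSpace.mk E.M C) (Y := functorF.obj E) id contMDiff_id
      invc nat
  have hfg : f ≫ g = 𝟙 _ :=
    ((GradedSpace.mkHom_comp (X := functorF.obj E) (Y := GradedSpace.mk E.M C)
      (Z := functorF.obj E) id contMDiff_id A.comparison A.resHom_comparison id contMDiff_id
      invc nat).trans
      (GradedSpace.mkHom_congr (X := functorF.obj E) (Y := functorF.obj E) id contMDiff_id
        hi _ (fun _ => rfl))).trans
      (GradedSpace.mkHom_id _)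
  have hgf : g ≫ f = 𝟙 _ :=
    ((GradedSpace.mkHom_comp (X := GradedSpace.mk E.M C) (Y := functorF.obj E)
      (Z := GradedSpace.mk E.M C) id contMDiff_id invc nat id
      contMDiff_id A.comparison A.resHom_comparison).trans
      (GradedSpace.mkHom_congr (X := GradedSpace.mk E.M C) (Y := GradedSpace.mk E.M C) id
        contMDiff_id hi' _ (fun _ => rfl))).trans
      (GradedSpace.mkHom_id _)
  exact ⟨⟨f, g, hfg, hgf⟩⟩

end CommonAtlas

/-! ### Essential surjectivity -/

namespace GradedSpace
open LocalTrivialization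
variable {X : GradedSpace} {m₁ m₂ : ℕ} (U : X.body → Opens X.body) (hU : ∀ a, a ∈ U a)
  (T : ∀ a, X.LocalTrivialization m₁ m₂ (U a))

/-- Both sides are algebra maps in `t`. On generators the equality says that the frames of the glued
bundles change by the cocycle. -/
theorem tau_transition (a b x : X.body) (ha : x ∈ U a) (hb : x ∈ U b) (t : ModelFib m₁ m₂) :
    ((modelCocycle U hU T).frame b).tau hb (transition (T a) (T b) x t) =
      ((modelCocycle U hU T).frame a).tau ha t := by
  refine AlgHom.congr_fun (φ₁ := (((modelCocycle U hU T).frame b).tau hb).toAlgHom.comp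
    (transition (T a) (T b) x)) (φ₂ := (((modelCocycle U hU T).frame a).tau ha).toAlgHom)
    (FibreAlg.algHom_ext _ (fun v => ?_) fun w => ?_) t
  · refine (congrArg (((modelCocycle U hU T).frame b).tau hb)
      (gen₁_trans₁ (T a) (T b) ha hb v).symm).trans ?_
    refine (VB2.Frame.tau_gen₁ _ _ _).trans (Eq.trans ?_ (VB2.Frame.tau_gen₁ _ _ _).symm)
    exact congrArg _ ((modelCocycle U hU T).one.frame_tr a b x ha hb v)
  · refine (congrArg (((modelCocycle U hU T).frame b).tau hb)
      (gen₂_trans₂ (T a) (T b) ha hb w).symm).trans ?_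
    refine (VB2.Frame.tau_gen₂ _ _ _).trans (Eq.trans ?_ (VB2.Frame.tau_gen₂ _ _ _).symm)
    exact congrArg _ ((modelCocycle U hU T).frameTwo_tr a b x ha hb w)

/-- The local trivializations of a degree two manifold and the frames of the triple of its cocycles. -/
def commonAtlas : CommonAtlas (modelCocycle U hU T).toVB2 X.sheaf m₁ m₂ where
  dom := U
  mem_dom := hU
  frame := (modelCocycle U hU T).frame
  triv := T
  compat a b V ha hb x s := by
    refine (tau_transition U hU T a b x.1 (ha x.2) (hb x.2) _).symm.trans ?_
    exact congrArg (((modelCocycle U hU T).frame b).tau (hb x.2))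
      (transition_ev (T a) (T b) ha hb x.2 s)

theorem IsDegreeTwo.exists_iso (hX : X.IsDegreeTwo) : ∃ E : VB2, Nonempty (functorF.obj E ≅ X) := by
  obtain ⟨m₁, m₂, h⟩ := hX.locallyTrivial
  choose U hU T using h
  exact ⟨_, (commonAtlas U hU fun a => (T a).some).nonempty_iso hX⟩

end GradedSpace

theorem essSurj_lift (h : ∀ E : VB2, isDegreeTwo (functorF.obj E)) :
    (isDegreeTwo.lift functorF h).EssSurj where
  mem_essImage X := by
    obtain ⟨E, ⟨e⟩⟩ := GradedSpace.IsDegreeTwo.exists_iso X.property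
    exact ⟨E, ⟨isDegreeTwo.isoMk e⟩⟩

end DegTwo

end

theorem proposition2p3 :
    ∃ h : ∀ E : DegTwo.VB2, DegTwo.isDegreeTwo (DegTwo.functorF.obj E),
      ((DegTwo.isDegreeTwo.lift DegTwo.functorF h : DegTwo.VB2 ⥤ DegTwo.NMan2)).IsEquivalence :=
  ⟨DegTwo.VB2.isDegreeTwo_obj, have := DegTwo.essSurj_lift DegTwo.VB2.isDegreeTwo_obj; { }⟩
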